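/- Let $0<h_1<h_2$ and let $q_1,q_2:\mathbb{R}\to\mathbb{R}$ satisfy, for $i=1,2$: $q_i\in C^1(\mathbb{R})$, $q_i'$ is absolutely continuous on compact intervals, $q_i''\in L^2(\mathbb{R})$, and $\int_{\mathbb{R}}(1+|x|^3)\,|q_i^{(k)}(x)|\,dx<\infty$ for $0\le k\le 2$. In $\mathcal{H}=L^2(\mathbb{R})$ let $D_i$ be the operator $D_iu=-u''+(q_i+h_i)u$ with domain $H^2(\mathbb{R})$, and assume that there is $c_2>0$ with $(D_2u,u)\ge c_2\|u\|^2$ for all $u\in\mathrm{dom}(D_2)$. Let $L=D_2D_1$ and $\Lambda=D_2^{1/2}D_1D_2^{1/2}$, on their natural domains (for instance $\mathrm{dom}(L)=\{u\in\mathrm{dom}(D_1): D_1u\in\mathrm{dom}(D_2)\}$), where $D_2^{1/2}$ is the positive selfadjoint square root of $D_2$; $\Lambda$ is selfadjoint. Let $E_\Lambda$ be the resolution of the identity of $\Lambda$, $\mathcal{B}$ the Borel $\sigma$-algebra of $\mathbb{R}$, and for bounded $b\in\mathcal{B}$ let $$B_L(b)=D_2^{1/2}E_\Lambda(b)D_2^{-1/2}.$$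 For an operator $T$ in a Banach space let $\sigma(T)$ be its spectrum, $\rho(T)$ its resolvent set and $R_T(z)=(T-z)^{-1}$ for $z\in\rho(T)$. **Theorem.** For each bounded $b\in\mathcal{B}$ the operator $B_L(b)$ is everywhere defined and bounded, and $B_L$ has a unique extension to a strongly countably additive map $E_L$ from $\mathcal{B}$ to the bounded operators on $\mathcal{H}$. This map is a spectral resolution of the identity for $L$, that is: 1. $E_L(b)=B_L(b)$ for each bounded $b\in\mathcal{B}$. 2. There is $c>0$ such that $\|E_L(b)\|\le c$ for all $b\in\mathcal{B}$. 3. $E_L(\emptyset)=0$, $\sigma(L)\cap\mathbb{R}$ is a Borel set, and $E_L(\mathbb{R})=E_L(\sigma(L)\cap\mathbb{R})=I$. 4. $E_L(b_1\cap b_2)=E_L(b_1)E_L(b_2)$ for $b_1,b_2\in\mathcal{B}$. 5. $E_L(b_1\cup b_2)=E_L(b_1)+E_L(b_2)-E_L(b_1)E_L(b_2)$ for $b_1,b_2\in\mathcal{B}$. 6. If $(b_i)_{i\in\mathbb{N}}$ is a sequence of pairwise disjoint Borel sets and $f\in\mathcal{H}$, then $E_L(\bigcup_ib_i)f=\sum_iE_L(b_i)f$,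 where the series converges unconditionally. 7. If $(b_i)_{i\in\mathbb{N}}$ is an ascending sequence of Borel sets and $f\in\mathcal{H}$, then $E_L(\bigcup_ib_i)f=\lim_iE_L(b_i)f$; if the sequence is descending, then $E_L(\bigcap_ib_i)f=\lim_iE_L(b_i)f$. 8. $E_L(b)R_L(z)=R_L(z)E_L(b)$ for $b\in\mathcal{B}$ and $z\in\rho(L)$. 9. If $b\in\mathcal{B}$ is bounded, then $\mathrm{ran}(E_L(b))\subseteq\mathrm{dom}(L)$. 10. If $b\in\mathcal{B}$ and $f\in\mathrm{dom}(L)$, then $E_L(b)f\in\mathrm{dom}(L)$ and $E_L(b)Lf=LE_L(b)f$. 11. If $b\in\mathcal{B}$ and $L_b$ is the restriction of $L$ to $\mathrm{ran}(E_L(b))$, then $\sigma(L_b)\subseteq\overline{b}$ (in particular, with $b=\mathbb{R}$, $\sigma(L)\subseteq\mathbb{R}$). The map $E_{L^*}(b)=E_L(b)^*$, $b\in\mathcal{B}$, is a spectral resolution of the identity for the adjoint $L^*$ of $L$: statements 1–11 hold with $L$, $E_L$ and $B_L$ replaced by $L^*$, $E_{L^*}$ and $B_{L^*}$, where $B_{L^*}(b)=B_L(b)^*$.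 -/

import Mathlib

open MeasureTheory
open scoped SchwartzMap ENNReal

noncomputable section

/-! ### Unbounded operators -/

section Operators

variable {X : Type*} [NormedAddCommGroup X] [NormedSpace ℂ X]

/-- The product `g f` of two operators, on its natural domain `{x ∈ dom f | f x ∈ dom g}`. -/
def opMul (g f : X →ₗ.[ℂ] X) : X →ₗ.[ℂ] X :=
  g.comp (f.domRestrict ((g.domain.comap f.toFun).map f.domain.subtype)) (by
    rintro ⟨x, ⟨y, hy, hyx⟩, hx⟩
    have hxy : (⟨x, hx⟩ : f.domain) = y := Subtype.ext hyx.symm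
    change f ⟨x, hx⟩ ∈ g.domain
    rw [hxy]
    exact hy)

/-- A bounded operator, regarded as an operator with domain the whole space. -/
def boundedOp (A : X →L[ℂ] X) : X →ₗ.[ℂ] X :=
  (A : X →ₗ[ℂ] X).toPMap ⊤

/-- The restriction of `T` to a subspace `K`, as an operator in `K`. Its graph consists of the
pairs `(x, T x)` with `x ∈ dom T`, `x ∈ K` and `T x ∈ K`. -/
def restrictOp (T : X →ₗ.[ℂ] X) (K : Submodule ℂ X) : K →ₗ.[ℂ] K :=
  (T.graph.comap (K.subtype.prodMap K.subtype)).toLinearPMap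

/-- `R` is the resolvent `(T - z)⁻¹`: a bounded, everywhere defined, two-sided inverse. -/
def IsResolvent (T : X →ₗ.[ℂ] X) (z : ℂ) (R : X →L[ℂ] X) : Prop :=
  (∀ x : X, ∃ h : R x ∈ T.domain, T ⟨R x, h⟩ - z • R x = x) ∧
    ∀ u : T.domain, R (T u - z • (u : X)) = u

/-- The resolvent set of `T`. -/
def opResolventSet (T : X →ₗ.[ℂ] X) : Set ℂ :=
  {z | ∃ R : X →L[ℂ] X, IsResolvent T z R}

/-- The spectrum of `T`. -/
def opSpectrum (T : X →ₗ.[ℂ] X) : Set ℂ :=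
  (opResolventSet T)ᶜ

/-- Strong countable additivity of an operator-valued map on the Borel sets of `ℝ`. -/
def StronglyCountablyAdditive (E : Set ℝ → X →L[ℂ] X) : Prop :=
  ∀ b : ℕ → Set ℝ, (∀ i, MeasurableSet (b i)) → Pairwise (Function.onFun Disjoint b) →
    ∀ f : X, HasSum (fun i => E (b i) f) (E (⋃ i, b i) f)

/-- `E` agrees on every bounded Borel set `b` with the operator `B b`
(in particular `B b` is then everywhere defined and bounded). -/
def ExtendsFromBounded (B : Set ℝ → X →ₗ.[ℂ] X) (E : Set ℝ → X →L[ℂ] X) : Prop :=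
  ∀ b : Set ℝ, MeasurableSet b → Bornology.IsBounded b → boundedOp (E b) = B b

/-- `E` extends `B` from the bounded Borel sets to all Borel sets of `ℝ`, and is a (not necessarily
selfadjoint) spectral resolution of the identity for `T`. -/
structure IsSpectralResolution (T : X →ₗ.[ℂ] X) (B : Set ℝ → X →ₗ.[ℂ] X)
    (E : Set ℝ → X →L[ℂ] X) : Prop where
  extends_bounded : ExtendsFromBounded B E
  uniformly_bounded : ∃ c : ℝ, 0 < c ∧ ∀ b : Set ℝ, MeasurableSet b → ‖E b‖ ≤ c
  empty : E ∅ = 0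
  univ : E Set.univ = 1
  spectrum_measurable : MeasurableSet {t : ℝ | (t : ℂ) ∈ opSpectrum T}
  spectrum : E {t : ℝ | (t : ℂ) ∈ opSpectrum T} = 1
  inter : ∀ b₁ b₂ : Set ℝ, MeasurableSet b₁ → MeasurableSet b₂ → E (b₁ ∩ b₂) = E b₁ * E b₂
  union : ∀ b₁ b₂ : Set ℝ, MeasurableSet b₁ → MeasurableSet b₂ →
    E (b₁ ∪ b₂) = E b₁ + E b₂ - E b₁ * E b₂
  countably_additive : StronglyCountablyAdditive E
  ascending : ∀ b : ℕ → Set ℝ, (∀ i, MeasurableSet (b i)) → Monotone b →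
    ∀ f : X, Filter.Tendsto (fun i => E (b i) f) Filter.atTop (nhds (E (⋃ i, b i) f))
  descending : ∀ b : ℕ → Set ℝ, (∀ i, MeasurableSet (b i)) → Antitone b →
    ∀ f : X, Filter.Tendsto (fun i => E (b i) f) Filter.atTop (nhds (E (⋂ i, b i) f))
  resolvent_comm : ∀ b : Set ℝ, MeasurableSet b → ∀ (z : ℂ) (R : X →L[ℂ] X),
    IsResolvent T z R → E b * R = R * E b
  range_subset : ∀ b : Set ℝ, MeasurableSet b → Bornology.IsBounded b →
    ∀ f : X, E b f ∈ T.domain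
  op_comm : ∀ b : Set ℝ, MeasurableSet b → ∀ f : T.domain,
    ∃ h : E b (f : X) ∈ T.domain, E b (T f) = T ⟨E b (f : X), h⟩
  restrict_spectrum : ∀ b : Set ℝ, MeasurableSet b →
    opSpectrum (restrictOp T (LinearMap.range (E b : X →ₗ[ℂ] X))) ⊆
      (fun t : ℝ => (t : ℂ)) '' closure b

end Operators

/-! ### Selfadjoint operators in a Hilbert space -/

section Hilbert

variable {X : Type*} [NormedAddCommGroup X] [InnerProductSpace ℂ X] [CompleteSpace X]

/-- `A` is a positive selfadjoint operator with `A² = T`. -/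
def IsPositiveSqrt (T A : X →ₗ.[ℂ] X) : Prop :=
  IsSelfAdjoint A ∧ (∀ u : A.domain, 0 ≤ (inner ℂ (u : X) (A u)).re) ∧ opMul A A = T

/-- The positive square root of a positive selfadjoint operator (which exists and is unique). -/
def positiveSqrt (T : X →ₗ.[ℂ] X) : X →ₗ.[ℂ] X :=
  Classical.epsilon (IsPositiveSqrt T)

/-- `E` is the resolution of the identity of the selfadjoint operator `T`: a projection-valued
measure on the Borel sets of `ℝ`, with orthogonal projections as values, such that
`T = ∫ λ E(dλ)`. For each `f` the Borel measure `μ` below is `b ↦ (E b f, f) = ‖E b f‖²`. -/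
structure IsResolutionOfIdentity (T : X →ₗ.[ℂ] X) (E : Set ℝ → X →L[ℂ] X) : Prop where
  projection : ∀ b : Set ℝ, MeasurableSet b → IsStarProjection (E b)
  univ : E Set.univ = 1
  countably_additive : StronglyCountablyAdditive E
  represents : ∀ f : X, ∃ μ : Measure ℝ,
    (∀ b : Set ℝ, MeasurableSet b → μ b = ENNReal.ofReal (‖E b f‖ ^ 2)) ∧
    (f ∈ T.domain ↔ Integrable (fun t : ℝ => t ^ 2) μ) ∧
    ∀ hf : f ∈ T.domain, inner ℂ f (T ⟨f, hf⟩) = ((∫ t : ℝ, t ∂μ : ℝ) : ℂ)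

/-- The resolution of the identity of a selfadjoint operator (which exists and is unique, as a map
on the Borel sets, by the spectral theorem). -/
def resolutionOfIdentity (T : X →ₗ.[ℂ] X) : Set ℝ → X →L[ℂ] X :=
  Classical.epsilon (IsResolutionOfIdentity T)

end Hilbert

/-! ### The differential operators -/

/-- The Hilbert space `L²(ℝ)` of complex functions. -/
abbrev HilbertL2 : Type := Lp ℂ 2 (volume : Measure ℝ)

/-- The hypotheses on the potentials `q`. -/
structure AdmissiblePotential (q : ℝ → ℝ) : Prop where
  contDiff : ContDiff ℝ 1 q
  deriv_ac : ∀ a b : ℝ, AbsolutelyContinuousOnInterval (deriv q) a b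
  deriv2_memLp : MemLp (deriv (deriv q)) 2 volume
  integrable : ∀ k : ℕ, k ≤ 2 →
    Integrable (fun x : ℝ => (1 + |x| ^ 3) * |iteratedDeriv k q x|) volume

/-- The graph of `-D² + q + h` with domain `H²(ℝ)`: the pairs `(u, v)` with `u ∈ H²(ℝ)` and
`v = -u'' + (q + h) u`, where `u'' = w` is the distributional second derivative. -/
def schrodingerGraph (q : ℝ → ℝ) (h : ℝ) : Submodule ℂ (HilbertL2 × HilbertL2) where
  carrier := {p | TemperedDistribution.MemSobolev 2 2 (p.1 : 𝓢'(ℝ, ℂ)) ∧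
    ∃ w : HilbertL2,
      (w : 𝓢'(ℝ, ℂ)) = TemperedDistribution.derivCLM ℂ
        (TemperedDistribution.derivCLM ℂ (p.1 : 𝓢'(ℝ, ℂ))) ∧
      ∀ᵐ x : ℝ, p.2 x = -w x + ((q x + h : ℝ) : ℂ) * p.1 x}
  zero_mem' := by
    refine ⟨?_, 0, ?_, ?_⟩
    · change TemperedDistribution.MemSobolev 2 2
        (Lp.toTemperedDistributionCLM ℂ (volume : Measure ℝ) 2 (0 : HilbertL2))
      rw [map_zero]
      exact TemperedDistribution.memSobolev_fun_zero ℝ ℂ 2 2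
    · change Lp.toTemperedDistributionCLM ℂ (volume : Measure ℝ) 2 (0 : HilbertL2) =
        TemperedDistribution.derivCLM ℂ (TemperedDistribution.derivCLM ℂ
          (Lp.toTemperedDistributionCLM ℂ (volume : Measure ℝ) 2 (0 : HilbertL2)))
      simp only [map_zero]
    · exact Filter.Eventually.of_forall fun x => by simp
  add_mem' := by
    rintro ⟨u₁, v₁⟩ ⟨u₂, v₂⟩ ⟨hu₁, w₁, hw₁, hv₁⟩ ⟨hu₂, w₂, hw₂, hv₂⟩
    have hadd : ∀ a b : HilbertL2, ((a + b : HilbertL2) : 𝓢'(ℝ, ℂ)) = (a : 𝓢'(ℝ, ℂ)) + b :=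
      map_add (Lp.toTemperedDistributionCLM ℂ (volume : Measure ℝ) 2)
    refine ⟨?_, w₁ + w₂, ?_, ?_⟩
    · simp only [Prod.fst_add, hadd]
      exact hu₁.add hu₂
    · simp only [Prod.fst_add, hadd, map_add]
      rw [hw₁, hw₂]
    · simp only [Prod.fst_add, Prod.snd_add]
      filter_upwards [hv₁, hv₂, Lp.coeFn_add u₁ u₂, Lp.coeFn_add v₁ v₂, Lp.coeFn_add w₁ w₂]
        with x h₁ h₂ h₃ h₄ h₅
      simp only [h₃, h₄, h₅, Pi.add_apply, h₁, h₂]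
      ring
  smul_mem' := by
    rintro c ⟨u, v⟩ ⟨hu, w, hw, hv⟩
    have hsmul : ∀ a : HilbertL2, ((c • a : HilbertL2) : 𝓢'(ℝ, ℂ)) = c • (a : 𝓢'(ℝ, ℂ)) :=
      map_smul (Lp.toTemperedDistributionCLM ℂ (volume : Measure ℝ) 2) c
    refine ⟨?_, c • w, ?_, ?_⟩
    · simp only [Prod.smul_fst, hsmul]
      exact hu.smul c
    · simp only [Prod.smul_fst, hsmul, map_smul]
      rw [hw]
    · simp only [Prod.smul_fst, Prod.smul_snd]
      filter_upwards [hv, Lp.coeFn_smul c u, Lp.coeFn_smul c v, Lp.coeFn_smul c w]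
        with x h₁ h₂ h₃ h₄
      simp only [h₂, h₃, h₄, Pi.smul_apply, h₁, smul_eq_mul]
      ring

/-- The graph is that of a function: `u` determines `v`. -/
theorem schrodingerGraph_functional (q : ℝ → ℝ) (h : ℝ) (p : HilbertL2 × HilbertL2)
    (hp : p ∈ schrodingerGraph q h) (hp0 : p.1 = 0) : p.2 = 0 := by
  obtain ⟨u, v⟩ := p
  obtain ⟨-, w, hw, hv⟩ := hp
  simp only at hp0 hw hv ⊢
  subst hp0
  have hinj := Lp.ker_toTemperedDistributionCLM_eq_bot (F := ℂ) (μ := (volume : Measure ℝ)) (p := 2)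
  have hw0 : w = 0 := by
    refine (LinearMap.ker_eq_bot'.mp hinj) w ?_
    change (w : 𝓢'(ℝ, ℂ)) = 0
    rw [hw]
    change TemperedDistribution.derivCLM ℂ (TemperedDistribution.derivCLM ℂ
      (Lp.toTemperedDistributionCLM ℂ (volume : Measure ℝ) 2 (0 : HilbertL2))) = 0
    simp only [map_zero]
  subst hw0
  rw [Lp.eq_zero_iff_ae_eq_zero]
  filter_upwards [hv, Lp.coeFn_zero ℂ 2 (volume : Measure ℝ)] with x hx h0
  rw [hx, h0]
  simp

/-- The operator `-D² + q + h` in `L²(ℝ)`, with domain `H²(ℝ)`. -/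
def schrodingerOp (q : ℝ → ℝ) (h : ℝ) : HilbertL2 →ₗ.[ℂ] HilbertL2 :=
  (schrodingerGraph q h).toLinearPMap

/-- The operator `L = D₂ D₁`. -/
def opL (D₁ D₂ : HilbertL2 →ₗ.[ℂ] HilbertL2) : HilbertL2 →ₗ.[ℂ] HilbertL2 :=
  opMul D₂ D₁

/-- The selfadjoint operator `Λ = D₂^{1/2} D₁ D₂^{1/2}`. -/
def opLambda (D₁ D₂ : HilbertL2 →ₗ.[ℂ] HilbertL2) : HilbertL2 →ₗ.[ℂ] HilbertL2 :=
  opMul (positiveSqrt D₂) (opMul D₁ (positiveSqrt D₂))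

/-- The operators `B_L(b) = D₂^{1/2} E_Λ(b) D₂^{-1/2}`, on their natural domain. -/
def opBL (D₁ D₂ : HilbertL2 →ₗ.[ℂ] HilbertL2) (b : Set ℝ) : HilbertL2 →ₗ.[ℂ] HilbertL2 :=
  opMul (positiveSqrt D₂)
    (opMul (boundedOp (resolutionOfIdentity (opLambda D₁ D₂) b)) (positiveSqrt D₂).inverse)

end

/-!
The operator `L = D₂ D₁` is similar, by a bounded transformation with bounded inverse, to the
selfadjoint operator `Λ = D₂^{1/2} D₁ D₂^{1/2}`, and the similarity carries the resolution of the
identity of `Λ` to `B_L`. Everything else is transported from `Λ`.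

**The similarity.** Write `A = D₂⁻¹`, `S = A^{1/2}` and `D₁ = D₂ + V`, where `V` is the
multiplication by `w = q₁ + h₁ - q₂ - h₂`. Formally `L = S⁻¹ Λ S`, but `S⁻¹` is unbounded. This is
repaired by a factor that commutes with `Λ`. The functions `w` and `w'` are bounded, so `V` is
bounded in the Sobolev space `H¹`, the form domain of `D₂`; by duality it is bounded in the norm
`‖S u‖` (`IsFreeResolvent.exists_mul_form_bound`), and `V S = S W` with `W` bounded. Hence
`Λ = A⁻² + W A⁻¹ = (1 + W A) A⁻²`, and for large `m` the operator `Q = (Λ + m)⁻¹` is `A²` times a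
bounded operator with bounded inverse. So `‖Q u‖` and `‖A² u‖` are comparable. Applying operator
monotonicity of the square root twice makes `‖|Q|^{1/4} u‖` and `‖S u‖` comparable, so that
`G = |Q|^{1/4}` has the form `S Y`, where `Y` is bounded and has a bounded inverse
(`exists_quarter_power_factorization`). As `G` commutes with `Λ`, one has
`L = S⁻¹ Λ S = S⁻¹ G Λ G⁻¹ S = Y Λ Y⁻¹` (`exists_isSimilar_opMul`), and likewise
`D₂^{1/2} E_Λ(b) D₂^{-1/2} = Y E_Λ(b) Y⁻¹` for every Borel set `b`
(`exists_isSpectralResolution_opMul`). Taking adjoints gives `L* = (Y*)⁻¹ Λ Y*`.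

**The differential operators.** On `L²(ℝ)` the operator `(2π)² - d²` is a Fourier multiplier with a
bounded inverse `R`, and `D₁`, `D₂` are bounded perturbations of `R⁻¹`. The lower bound of `D₂`
makes it boundedly invertible, with `A` and `R` comparable as quadratic forms
(`exists_inverse_of_perturbation`), so that the estimate of `V` need only be made for `R`. There it
comes from an integration by parts on Schwartz functions.

**The spectral theorem.** `Λ` is determined by its bounded selfadjoint resolvent `Q`. The spectral
measures of `Q` come from the Riesz-Markov-Kakutani theorem applied to the continuous functional
calculus, and the spectral projections of closed sets are strong limits of continuous functions of
`Q`; the substitution `s ↦ s⁻¹ - m` then gives a resolution of the identity for `Λ`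
(`IsShiftedInverse.exists_isResolutionOfIdentity`). The properties of a spectral resolution are
derived for an arbitrary resolution of the identity of `Λ`
(`IsSimilar.isSpectralResolution`). The localization of the spectrum rests on the bound
`‖(Λ - t) u‖ ≥ d ‖u‖` for `u` in the range of `E_Λ(b)` and real `t` at distance `d` from `b`,
which holds because the quadratic form of `Λ - t` is definite on either side of `t`.
-/


/-! ### Graphs of unbounded operators -/

section Graphs

variable {X : Type*} [NormedAddCommGroup X] [NormedSpace ℂ X]

theorem mem_graph_opMul {g f : X →ₗ.[ℂ] X} {x z : X} :
    (x, z) ∈ (opMul g f).graph ↔ ∃ y, (x, y) ∈ f.graph ∧ (y, z) ∈ g.graph := by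
  constructor
  · intro h
    obtain ⟨⟨a, ⟨⟨⟨a', ha'⟩, hb, hab⟩, ha⟩⟩, rfl, hz⟩ := (LinearPMap.mem_graph_iff _).1 h
    change a' = a at hab
    subst hab
    exact ⟨f ⟨a', ha'⟩, f.mem_graph ⟨a', ha'⟩,
      (LinearPMap.mem_graph_iff _).2 ⟨⟨f ⟨a', ha'⟩, hb⟩, rfl, hz⟩⟩
  · rintro ⟨y, h₁, h₂⟩
    obtain ⟨a, rfl, rfl⟩ := (LinearPMap.mem_graph_iff _).1 h₁
    obtain ⟨b, hb, rfl⟩ := (LinearPMap.mem_graph_iff _).1 h₂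
    have hfa : f a ∈ g.domain := by
      have h := b.2
      rwa [hb] at h
    obtain rfl : b = ⟨f a, hfa⟩ := Subtype.ext hb
    exact (LinearPMap.mem_graph_iff _).2 ⟨⟨a, ⟨⟨a, hfa, rfl⟩, a.2⟩⟩, rfl, rfl⟩

theorem mem_graph_boundedOp {A : X →L[ℂ] X} {x y : X} :
    (x, y) ∈ (boundedOp A).graph ↔ y = A x := by
  constructor
  · intro h
    obtain ⟨a, rfl, rfl⟩ := (LinearPMap.mem_graph_iff _).1 h
    rfl
  · rintro rfl
    exact (LinearPMap.mem_graph_iff _).2 ⟨⟨x, trivial⟩, rfl, rfl⟩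

theorem mem_graph_restrictOp {T : X →ₗ.[ℂ] X} {K : Submodule ℂ X} {x y : K} :
    (x, y) ∈ (restrictOp T K).graph ↔ ((x : X), (y : X)) ∈ T.graph := by
  rw [restrictOp, Submodule.toLinearPMap_graph_eq]
  · rfl
  · rintro ⟨a, b⟩ h h0
    change ((a : X), (b : X)) ∈ T.graph at h
    change a = 0 at h0
    subst h0
    exact Subtype.ext (LinearPMap.graph_fst_eq_zero_snd T h rfl)

theorem isResolvent_iff {T : X →ₗ.[ℂ] X} {z : ℂ} {R : X →L[ℂ] X} :
    IsResolvent T z R ↔ (∀ x, (R x, x + z • R x) ∈ T.graph) ∧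
      ∀ u v, (u, v) ∈ T.graph → R (v - z • u) = u := by
  constructor
  · rintro ⟨h₁, h₂⟩
    refine ⟨fun x => ?_, fun u v huv => ?_⟩
    · obtain ⟨h, hx⟩ := h₁ x
      exact (LinearPMap.mem_graph_iff _).2 ⟨⟨R x, h⟩, rfl, by
        rw [sub_eq_iff_eq_add] at hx; exact hx⟩
    · obtain ⟨a, rfl, rfl⟩ := (LinearPMap.mem_graph_iff _).1 huv
      exact h₂ a
  · rintro ⟨h₁, h₂⟩
    refine ⟨fun x => ?_, fun u => h₂ _ _ (T.mem_graph u)⟩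
    obtain ⟨a, ha, ha'⟩ := (LinearPMap.mem_graph_iff _).1 (h₁ x)
    have h : R x ∈ T.domain := by
      have h := a.2
      rwa [ha] at h
    obtain rfl : a = ⟨R x, h⟩ := Subtype.ext ha
    exact ⟨h, by rw [sub_eq_iff_eq_add]; exact ha'⟩

theorem mem_graph_inverse {T : X →ₗ.[ℂ] X} (hT : ∀ u, (u, 0) ∈ T.graph → u = 0) {x y : X} :
    (x, y) ∈ T.inverse.graph ↔ (y, x) ∈ T.graph := by
  rw [LinearPMap.inverse_graph]
  · simp only [Submodule.mem_map]
    constructor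
    · rintro ⟨⟨a, b⟩, h, hab⟩
      obtain ⟨rfl, rfl⟩ := Prod.mk.inj hab
      exact h
    · exact fun h => ⟨(y, x), h, rfl⟩
  · rw [LinearMap.ker_eq_bot']
    intro m hm
    have h := T.mem_graph m
    rw [show T m = 0 from hm] at h
    exact Subtype.ext (hT _ h)

theorem LinearPMap.ext_graph {T T' : X →ₗ.[ℂ] X}
    (h : ∀ x y, (x, y) ∈ T.graph ↔ (x, y) ∈ T'.graph) : T = T' :=
  LinearPMap.eq_of_eq_graph (SetLike.ext fun p => h p.1 p.2)

end Graphs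

section AdjointGraph

variable {X : Type*} [NormedAddCommGroup X] [InnerProductSpace ℂ X] [CompleteSpace X]

theorem mem_graph_adjoint {T : X →ₗ.[ℂ] X} (hT : Dense (T.domain : Set X)) {x y : X} :
    (x, y) ∈ T.adjoint.graph ↔ ∀ a b, (a, b) ∈ T.graph → inner ℂ b x = inner ℂ a y := by
  rw [LinearPMap.adjoint_graph_eq_graph_adjoint hT, Submodule.mem_adjoint_iff]
  simp only [sub_eq_zero]

theorem adjoint_boundedOp (A : X →L[ℂ] X) :
    (boundedOp A).adjoint = boundedOp (ContinuousLinearMap.adjoint A) :=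
  ContinuousLinearMap.toPMap_adjoint_eq_adjoint_toPMap_of_dense A (by simp)

end AdjointGraph

/-! ### Comparison of bounded operators -/

section Bounded

variable {X : Type*} [NormedAddCommGroup X] [InnerProductSpace ℂ X] [CompleteSpace X]

theorem IsSelfAdjoint.inner_map_left {A : X →L[ℂ] X} (hA : IsSelfAdjoint A) (x y : X) :
    inner ℂ (A x) y = inner ℂ x (A y) :=
  (ContinuousLinearMap.isSelfAdjoint_iff_isSymmetric.1 hA) x y

theorem IsSelfAdjoint.denseRange {A : X →L[ℂ] X} (hA : IsSelfAdjoint A)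
    (hinj : Function.Injective A) : DenseRange A := by
  have h := Submodule.topologicalClosure_eq_top_iff (K := LinearMap.range (A : X →ₗ[ℂ] X))
  have h2 : (LinearMap.range (A : X →ₗ[ℂ] X))ᗮ = ⊥ := by
    rw [Submodule.eq_bot_iff]
    intro x hx
    apply hinj
    rw [map_zero, ← inner_self_eq_zero (𝕜 := ℂ), ← hA.inner_map_left, hA.inner_map_left,
      hA.inner_map_left]
    have := (Submodule.mem_orthogonal _ _).1 hx (A (A x)) ⟨A x, rfl⟩
    rwa [hA.inner_map_left, hA.inner_map_left] at this
  have h3 := h.2 h2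
  rw [DenseRange, ← dense_closure]
  have h4 : (LinearMap.range (A : X →ₗ[ℂ] X)).topologicalClosure.carrier = Set.univ := by
    rw [h3]; rfl
  have h5 : closure (Set.range A) = Set.univ := by
    rw [← h4]; rfl
  rw [h5]
  exact dense_univ

/-- Operator monotonicity of the square root: a bound in norm between positive operators gives
a bound between their quadratic forms. -/
theorem ContinuousLinearMap.le_smul_of_norm_le {A B : X →L[ℂ] X} (hA : 0 ≤ A) (hB : 0 ≤ B)
    {c : ℝ} (hc : 0 ≤ c) (h : ∀ u, ‖A u‖ ≤ c * ‖B u‖) : A ≤ c • B := by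
  have hA' := hA.isSelfAdjoint
  have hcB : 0 ≤ c • B := smul_nonneg hc hB
  have hB' := hcB.isSelfAdjoint
  have key : A * A ≤ (c • B) * (c • B) := by
    rw [ContinuousLinearMap.le_def, ContinuousLinearMap.isPositive_def']
    refine ⟨?_, fun u => ?_⟩
    · exact ((hB'.commute_iff hB').1 (Commute.refl _)).sub
        ((hA'.commute_iff hA').1 (Commute.refl _))
    · rw [ContinuousLinearMap.reApplyInnerSelf_apply]
      simp only [_root_.sub_apply, mul_apply_eq_comp, inner_sub_left]
      rw [hB'.inner_map_left, hA'.inner_map_left, inner_self_eq_norm_sq_to_K,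
        inner_self_eq_norm_sq_to_K]
      simp only [map_sub]
      norm_cast
      have := h u
      rw [sub_nonneg]
      have h2 : ‖(c • B) u‖ = c * ‖B u‖ := by
        rw [_root_.smul_apply, norm_smul, Real.norm_of_nonneg hc]
      rw [h2]
      gcongr
  have := CFC.sqrt_le_sqrt _ _ key
  rwa [CFC.sqrt_mul_self A hA, CFC.sqrt_mul_self (c • B) hcB] at this

theorem ContinuousLinearMap.norm_le_of_le_smul {a b : X →L[ℂ] X} (ha : IsSelfAdjoint a)
    (hb : IsSelfAdjoint b) {c : ℝ} (hc : 0 ≤ c) (h : a * a ≤ c • (b * b)) (u : X) :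
    ‖a u‖ ≤ Real.sqrt c * ‖b u‖ := by
  have h1 := ((ContinuousLinearMap.le_def _ _).1 h).re_inner_nonneg_right u
  simp only [_root_.sub_apply, _root_.smul_apply,
    mul_apply_eq_comp, inner_sub_right] at h1
  rw [← ha.inner_map_left, RCLike.real_smul_eq_coe_smul (K := ℂ), inner_smul_right,
    ← hb.inner_map_left, inner_self_eq_norm_sq_to_K, inner_self_eq_norm_sq_to_K] at h1
  simp only [map_sub] at h1
  norm_cast at h1
  refine abs_le_of_sq_le_sq' ?_ (by positivity) |>.2
  rw [mul_pow, Real.sq_sqrt hc]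
  linarith

/-- Douglas factorization through a selfadjoint injective operator. -/
theorem ContinuousLinearMap.exists_mul_eq_of_norm_le {A B : X →L[ℂ] X} (hB : IsSelfAdjoint B)
    (hinj : Function.Injective B) {c : ℝ} (h : ∀ u, ‖A u‖ ≤ c * ‖B u‖) :
    ∃ W : X →L[ℂ] X, W * B = A := by
  refine ⟨(A : X →ₗ[ℂ] X).extendOfNorm (B : X →ₗ[ℂ] X), ?_⟩
  ext u
  exact LinearMap.extendOfNorm_eq (f := (A : X →ₗ[ℂ] X)) (e := (B : X →ₗ[ℂ] X))
    (hB.denseRange hinj) ⟨c, h⟩ u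

end Bounded

/-! ### Spectral measures of a bounded selfadjoint operator -/

section SpectralMeasure

open Filter Topology

variable {X : Type*} [NormedAddCommGroup X] [InnerProductSpace ℂ X] [CompleteSpace X]

/-- The Riesz–Markov–Kakutani theorem, applied to the functional `φ ↦ (φ(Q) f, f)` on the continuous
functions on the spectrum. -/
theorem exists_spectralMeasure {Q : X →L[ℂ] X} (hQ : IsSelfAdjoint Q) (f : X) :
    ∃ μ : Measure ℝ, IsFiniteMeasure μ ∧ ∀ φ : ℝ → ℝ, Continuous φ →
      Integrable φ μ ∧ ∫ x, φ x ∂μ = (inner ℂ f (cfc φ Q f)).re := by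
  let K := spectrum ℝ Q
  have : CompactSpace K := isCompact_iff_compactSpace.1 (spectrum.isCompact Q)
  let Λ₀ : CompactlySupportedContinuousMap K ℝ →ₗ[ℝ] ℝ :=
    { toFun := fun φ => (inner ℂ f (cfcHom hQ φ.toContinuousMap f)).re
      map_add' := fun φ ψ => by
        have : (φ + ψ).toContinuousMap = φ.toContinuousMap + ψ.toContinuousMap := rfl
        rw [this, map_add, _root_.add_apply, inner_add_right, Complex.add_re]
      map_smul' := fun c φ => by
        have : (c • φ).toContinuousMap = c • φ.toContinuousMap := rfl
        rw [this, map_smul, _root_.smul_apply, RCLike.real_smul_eq_coe_smul (K := ℂ),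
          inner_smul_right]
        simp }
  let Λ : CompactlySupportedContinuousMap K ℝ →ₚ[ℝ] ℝ := PositiveLinearMap.mk₀ Λ₀ (by
    intro φ hφ
    have h : 0 ≤ cfcHom hQ φ.toContinuousMap := (cfcHom_nonneg_iff hQ).2 hφ
    exact ((ContinuousLinearMap.nonneg_iff_isPositive _).1 h).re_inner_nonneg_right f)
  let μ₀ := RealRMK.rieszMeasure Λ
  refine ⟨μ₀.map Subtype.val, inferInstance, fun φ hφ => ⟨?_, ?_⟩⟩
  · rw [(MeasurableEmbedding.subtype_coe (spectrum.isCompact Q).measurableSet).integrable_map_iff]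
    exact (hφ.comp continuous_subtype_val).integrable_of_hasCompactSupport
      (HasCompactSupport.of_compactSpace _)
  · rw [(MeasurableEmbedding.subtype_coe
      (spectrum.isCompact Q).measurableSet).integral_map]
    have h := RealRMK.integral_rieszMeasure Λ
      (CompactlySupportedContinuousMap.continuousMapEquiv
        (⟨fun x : K => φ x, hφ.comp continuous_subtype_val⟩ : C(K, ℝ)))
    refine h.trans ?_
    rw [cfc_apply φ Q hQ hφ.continuousOn]
    rfl

open Classical in
/-- The spectral measure of the selfadjoint operator `Q` at the vector `f`, the measure
`b ↦ (E_Q(b) f, f)`; it is set to `0` if `Q` is not selfadjoint. -/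
noncomputable def spectralMeasure (Q : X →L[ℂ] X) (f : X) : Measure ℝ :=
  if hQ : IsSelfAdjoint Q then (exists_spectralMeasure hQ f).choose else 0

variable {Q : X →L[ℂ] X}

theorem isFiniteMeasure_spectralMeasure (hQ : IsSelfAdjoint Q) (f : X) :
    IsFiniteMeasure (spectralMeasure Q f) := by
  rw [spectralMeasure, dif_pos hQ]
  exact (exists_spectralMeasure hQ f).choose_spec.1

theorem integrable_spectralMeasure (hQ : IsSelfAdjoint Q) (f : X) {φ : ℝ → ℝ}
    (hφ : Continuous φ) : Integrable φ (spectralMeasure Q f) := by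
  rw [spectralMeasure, dif_pos hQ]
  exact ((exists_spectralMeasure hQ f).choose_spec.2 φ hφ).1

theorem integral_spectralMeasure (hQ : IsSelfAdjoint Q) (f : X) {φ : ℝ → ℝ}
    (hφ : Continuous φ) :
    ∫ x, φ x ∂(spectralMeasure Q f) = (inner ℂ f (cfc φ Q f)).re := by
  rw [spectralMeasure, dif_pos hQ]
  exact ((exists_spectralMeasure hQ f).choose_spec.2 φ hφ).2

theorem norm_cfc_apply_sq (hQ : IsSelfAdjoint Q) (f : X) {φ : ℝ → ℝ} (hφ : Continuous φ) :
    ‖cfc φ Q f‖ ^ 2 = ∫ x, φ x ^ 2 ∂(spectralMeasure Q f) := by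
  rw [integral_spectralMeasure hQ f (φ := fun x => φ x ^ 2) (hφ.pow 2)]
  have h : cfc (fun x => φ x ^ 2) Q = cfc φ Q * cfc φ Q := by
    rw [← cfc_mul φ φ Q hφ.continuousOn hφ.continuousOn]
    simp only [sq]
  have hs : IsSelfAdjoint (cfc φ Q) := cfc_predicate φ Q
  rw [h, mul_apply_eq_comp, ← hs.inner_map_left, inner_self_eq_norm_sq_to_K]
  norm_cast

theorem measureReal_univ_spectralMeasure (hQ : IsSelfAdjoint Q) (f : X) :
    (spectralMeasure Q f).real Set.univ = ‖f‖ ^ 2 := by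
  have h := norm_cfc_apply_sq hQ f (φ := fun _ => 1) continuous_const
  rw [cfc_const_one ℝ Q hQ] at h
  simpa using h.symm

/-- Convergence of continuous functions in `L²` of the spectral measure is strong convergence of the
operators of the functional calculus. -/
theorem exists_tendsto_cfc_apply (hQ : IsSelfAdjoint Q) (f : X) {φ : ℕ → ℝ → ℝ} {g G : ℝ → ℝ}
    (hφ : ∀ n, Continuous (φ n)) (hlim : ∀ x, Tendsto (fun n => φ n x) atTop (𝓝 (g x)))
    (hG : Integrable (fun x => G x ^ 2) (spectralMeasure Q f)) (hbd : ∀ n x, |φ n x| ≤ G x) :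
    ∃ h : X, Tendsto (fun n => cfc (φ n) Q f) atTop (𝓝 h) ∧
      ‖h‖ ^ 2 = ∫ x, g x ^ 2 ∂(spectralMeasure Q f) := by
  have hg : ∀ x, |g x| ≤ G x := fun x =>
    le_of_tendsto (hlim x).abs (Eventually.of_forall fun n => hbd n x)
  have hgm : Measurable g := measurable_of_tendsto_metrizable (fun n => (hφ n).measurable)
    (tendsto_pi_nhds.2 hlim)
  have hdiff : Tendsto (fun n => ∫ x, (φ n x - g x) ^ 2 ∂(spectralMeasure Q f)) atTop (𝓝 0) := by
    have : Tendsto (fun n => ∫ x, (φ n x - g x) ^ 2 ∂(spectralMeasure Q f)) atTop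
        (𝓝 (∫ _, (0 : ℝ) ∂(spectralMeasure Q f))) := by
      refine tendsto_integral_of_dominated_convergence (fun x => 4 * G x ^ 2)
        (fun n => (((hφ n).measurable.sub hgm).pow_const 2).aestronglyMeasurable)
        (hG.const_mul 4) (fun n => Eventually.of_forall fun x => ?_)
        (Eventually.of_forall fun x => ?_)
      · rw [Real.norm_of_nonneg (sq_nonneg _)]
        have h1 := abs_le.1 (hbd n x)
        have h2 := abs_le.1 (hg x)
        nlinarith
      · simpa using ((hlim x).sub_const (g x)).pow 2
    simpa using this
  have hcauchy : CauchySeq fun n => cfc (φ n) Q f := by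
    rw [Metric.cauchySeq_iff']
    have key : ∀ n m, ‖cfc (φ n) Q f - cfc (φ m) Q f‖ ^ 2 ≤
        2 * ∫ x, (φ n x - g x) ^ 2 ∂(spectralMeasure Q f) +
        2 * ∫ x, (φ m x - g x) ^ 2 ∂(spectralMeasure Q f) := by
      intro n m
      have hint : ∀ n, Integrable (fun x => (φ n x - g x) ^ 2) (spectralMeasure Q f) := by
        intro n
        refine (hG.const_mul 4).mono'
          (((hφ n).measurable.sub hgm).pow_const 2).aestronglyMeasurable
          (Eventually.of_forall fun x => ?_)
        rw [Real.norm_of_nonneg (sq_nonneg _)]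
        have h1 := abs_le.1 (hbd n x)
        have h2 := abs_le.1 (hg x)
        nlinarith
      rw [← _root_.sub_apply, ← cfc_sub (φ n) (φ m) Q (hφ n).continuousOn (hφ m).continuousOn,
        norm_cfc_apply_sq hQ f (φ := fun x => φ n x - φ m x) ((hφ n).sub (hφ m)),
        ← integral_const_mul, ← integral_const_mul,
        ← integral_add ((hint n).const_mul 2) ((hint m).const_mul 2)]
      refine integral_mono (integrable_spectralMeasure hQ f (((hφ n).sub (hφ m)).pow 2))
        (((hint n).const_mul 2).add ((hint m).const_mul 2)) fun x => ?_
      nlinarith [sq_nonneg ((φ n x - g x) + (φ m x - g x))]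
    intro ε hε
    obtain ⟨N, hN⟩ := eventually_atTop.1 (hdiff.eventually
      (gt_mem_nhds (show (0 : ℝ) < ε ^ 2 / 4 by positivity)))
    refine ⟨N, fun n hn => ?_⟩
    rw [dist_eq_norm]
    have h1 := key n N
    have h2 := hN n hn
    have h3 := hN N le_rfl
    exact lt_of_pow_lt_pow_left₀ 2 hε.le (by linarith)
  obtain ⟨h, hh⟩ := cauchySeq_tendsto_of_complete hcauchy
  refine ⟨h, hh, tendsto_nhds_unique (hh.norm.pow 2) ?_⟩
  simp only [norm_cfc_apply_sq hQ f (hφ _)]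
  refine tendsto_integral_of_dominated_convergence (fun x => G x ^ 2)
    (fun n => ((hφ n).pow 2).aestronglyMeasurable) hG
    (fun n => Eventually.of_forall fun x => ?_) (Eventually.of_forall fun x => (hlim x).pow 2)
  rw [Real.norm_of_nonneg (sq_nonneg _), ← sq_abs]
  exact pow_le_pow_left₀ (abs_nonneg _) (hbd n x) 2

end SpectralMeasure

/-! ### Projection-valued measures -/

section ProjectionMeasure

open Filter Topology

variable {X : Type*} [NormedAddCommGroup X] [InnerProductSpace ℂ X] [CompleteSpace X]

theorem IsSelfAdjoint.eq_of_re_inner_eq {A B : X →L[ℂ] X} (hA : IsSelfAdjoint A)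
    (hB : IsSelfAdjoint B) (h : ∀ f, (inner ℂ f (A f)).re = (inner ℂ f (B f)).re) : A = B := by
  have hAB := hA.sub hB
  have h0 : ((A - B : X →L[ℂ] X) : X →ₗ[ℂ] X) = 0 := by
    rw [← inner_map_self_eq_zero]
    intro f
    change inner ℂ ((A - B) f) f = 0
    apply Complex.ext
    · rw [hAB.inner_map_left, _root_.sub_apply, inner_sub_right, Complex.sub_re, h f]
      simp
    · exact Complex.conj_eq_iff_im.1 (by rw [inner_conj_symm, hAB.inner_map_left])
  exact sub_eq_zero.1 (ContinuousLinearMap.coe_injective h0)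

theorem IsStarProjection.apply_apply {P : X →L[ℂ] X} (hP : IsStarProjection P) (f : X) :
    P (P f) = P f :=
  DFunLike.congr_fun hP.isIdempotentElem f

theorem IsStarProjection.re_inner_self {P : X →L[ℂ] X} (hP : IsStarProjection P) (f : X) :
    (inner ℂ f (P f)).re = ‖P f‖ ^ 2 := by
  rw [← hP.apply_apply, ← hP.isSelfAdjoint.inner_map_left, hP.apply_apply,
    inner_self_eq_norm_sq_to_K]
  norm_cast

theorem isStarProjection_of_re_inner_self {P : X →L[ℂ] X} (hP : IsSelfAdjoint P)
    (h : ∀ f, (inner ℂ f (P f)).re = ‖P f‖ ^ 2) : IsStarProjection P := by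
  refine ⟨IsSelfAdjoint.eq_of_re_inner_eq ((hP.commute_iff hP).1 (Commute.refl _)) hP
    fun f => ?_, hP⟩
  rw [h f, mul_apply_eq_comp, ← hP.inner_map_left, inner_self_eq_norm_sq_to_K]
  norm_cast

theorem IsStarProjection.norm_sq_add {P : X →L[ℂ] X} (hP : IsStarProjection P) (f : X) :
    ‖P f‖ ^ 2 + ‖f - P f‖ ^ 2 = ‖f‖ ^ 2 := by
  have h1 := hP.re_inner_self f
  have h2 := hP.one_sub.re_inner_self f
  have h3 : inner ℂ f ((1 - P) f) = inner ℂ f f - inner ℂ f (P f) := by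
    rw [← inner_sub_right]; rfl
  have h4 : (inner ℂ f f).re = ‖f‖ ^ 2 := by
    rw [inner_self_eq_norm_sq_to_K]; norm_cast
  rw [h3, Complex.sub_re, h1, h4] at h2
  change _ = ‖f - P f‖ ^ 2 at h2
  linarith

theorem IsStarProjection.norm_apply_le {P : X →L[ℂ] X} (hP : IsStarProjection P) (f : X) :
    ‖P f‖ ≤ ‖f‖ :=
  le_of_sq_le_sq (by nlinarith [hP.norm_sq_add f, sq_nonneg ‖f - P f‖]) (norm_nonneg _)

/-- A family of orthogonal projections indexed by the Borel sets of `ℝ`, such that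
`b ↦ ‖E b f‖²` is a measure for each vector `f`. -/
structure IsProjectionMeasure (E : Set ℝ → X →L[ℂ] X) : Prop where
  projection : ∀ b, MeasurableSet b → IsStarProjection (E b)
  measure : ∀ f, ∃ μ : Measure ℝ, ∀ b, MeasurableSet b → μ b = ENNReal.ofReal (‖E b f‖ ^ 2)

theorem measure_ne_top_of_univ_eq {μ : Measure ℝ} {r : ℝ} (h : μ Set.univ = ENNReal.ofReal r)
    (b : Set ℝ) : μ b ≠ ⊤ :=
  ne_top_of_le_ne_top (h ▸ ENNReal.ofReal_ne_top) (measure_mono (Set.subset_univ b))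

namespace IsProjectionMeasure

variable {E : Set ℝ → X →L[ℂ] X} (hE : IsProjectionMeasure E)
include hE

theorem norm_sq_union {a b : Set ℝ} (ha : MeasurableSet a) (hb : MeasurableSet b)
    (hab : Disjoint a b) (f : X) : ‖E (a ∪ b) f‖ ^ 2 = ‖E a f‖ ^ 2 + ‖E b f‖ ^ 2 := by
  obtain ⟨μ, hμ⟩ := hE.measure f
  have h := measure_union (μ := μ) hab hb
  rw [hμ _ ha, hμ _ hb, hμ _ (ha.union hb), ← ENNReal.ofReal_add (by positivity) (by positivity),
    ENNReal.ofReal_eq_ofReal_iff (by positivity) (by positivity)] at h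
  exact h

/-- Additivity of `‖E b f‖²` alone makes projections of disjoint sets orthogonal: for `f` in the
range of `E b`, the projection `E (a ∪ b)` would otherwise increase the norm. -/
theorem mul_eq_zero {a b : Set ℝ} (ha : MeasurableSet a) (hb : MeasurableSet b)
    (hab : Disjoint a b) : E a * E b = 0 := by
  ext f
  have h1 := hE.norm_sq_union ha hb hab (E b f)
  have h2 := (hE.projection _ (ha.union hb)).norm_apply_le (E b f)
  rw [(hE.projection _ hb).apply_apply] at h1
  have h3 : ‖E a (E b f)‖ ^ 2 ≤ 0 := by
    nlinarith [pow_le_pow_left₀ (norm_nonneg _) h2 2]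
  exact norm_eq_zero.1 (pow_eq_zero_iff two_ne_zero |>.1 (le_antisymm h3 (sq_nonneg _)))

theorem union_of_disjoint {a b : Set ℝ} (ha : MeasurableSet a) (hb : MeasurableSet b)
    (hab : Disjoint a b) : E (a ∪ b) = E a + E b := by
  refine IsSelfAdjoint.eq_of_re_inner_eq (hE.projection _ (ha.union hb)).isSelfAdjoint
    ((hE.projection _ ha).isSelfAdjoint.add (hE.projection _ hb).isSelfAdjoint) fun f => ?_
  rw [_root_.add_apply, inner_add_right, Complex.add_re, (hE.projection _ ha).re_inner_self,
    (hE.projection _ hb).re_inner_self, (hE.projection _ (ha.union hb)).re_inner_self,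
    hE.norm_sq_union ha hb hab]

theorem inter {a b : Set ℝ} (ha : MeasurableSet a) (hb : MeasurableSet b) :
    E (a ∩ b) = E a * E b := by
  have h1 : E a = E (a ∩ b) + E (a \ b) := by
    rw [← hE.union_of_disjoint (ha.inter hb) (ha.diff hb)
      (Set.disjoint_sdiff_inter.symm), Set.inter_union_sdiff]
  have h2 : E b = E (a ∩ b) + E (b \ a) := by
    rw [← hE.union_of_disjoint (ha.inter hb) (hb.diff ha), Set.inter_comm, Set.inter_union_sdiff]
    rw [Set.inter_comm]
    exact Set.disjoint_sdiff_inter.symm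
  have h3 := (hE.projection _ (ha.inter hb)).isIdempotentElem.eq
  have h4 : E (a ∩ b) * E (b \ a) = 0 := hE.mul_eq_zero (ha.inter hb) (hb.diff ha)
    (Set.disjoint_left.2 fun x hx hx' => hx'.2 hx.1)
  have h5 : E (a \ b) * E (a ∩ b) = 0 := hE.mul_eq_zero (ha.diff hb) (ha.inter hb)
    (Set.disjoint_left.2 fun x hx hx' => hx.2 hx'.2)
  have h6 : E (a \ b) * E (b \ a) = 0 := hE.mul_eq_zero (ha.diff hb) (hb.diff ha)
    (Set.disjoint_left.2 fun x hx hx' => hx.2 hx'.1)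
  rw [h1, h2, add_mul, mul_add, mul_add, h3, h4, h5, h6]
  simp

theorem diff_apply {a b : Set ℝ} (ha : MeasurableSet a) (hb : MeasurableSet b) (h : b ⊆ a)
    (f : X) : E (a \ b) f = E a f - E b f := by
  have h1 := hE.union_of_disjoint hb (ha.diff hb) Set.disjoint_sdiff_right
  rw [Set.union_sdiff_cancel h] at h1
  rw [h1, _root_.add_apply, add_sub_cancel_left]

theorem union {a b : Set ℝ} (ha : MeasurableSet a) (hb : MeasurableSet b) :
    E (a ∪ b) = E a + E b - E a * E b := by
  ext f
  have h1 := hE.union_of_disjoint ha (hb.diff ha) Set.disjoint_sdiff_right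
  rw [Set.union_sdiff_self] at h1
  have h2 : b \ a = b \ (a ∩ b) := by rw [Set.sdiff_inter_self_eq_sdiff]
  rw [h1, h2, _root_.add_apply, hE.diff_apply hb (ha.inter hb) Set.inter_subset_right,
    hE.inter ha hb, _root_.sub_apply, _root_.add_apply]
  abel

theorem empty : E ∅ = 0 := by
  have h := hE.mul_eq_zero MeasurableSet.empty MeasurableSet.empty (disjoint_bot_left)
  rwa [(hE.projection _ MeasurableSet.empty).isIdempotentElem.eq] at h

theorem finset_sum (b : ℕ → Set ℝ) (hb : ∀ i, MeasurableSet (b i))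
    (hd : Pairwise (Function.onFun Disjoint b)) (s : Finset ℕ) :
    E (⋃ i ∈ s, b i) = ∑ i ∈ s, E (b i) := by
  induction s using Finset.induction_on with
  | empty => simp [hE.empty]
  | insert i s hi ih =>
    rw [Finset.set_biUnion_insert, Finset.sum_insert hi, ← ih]
    refine hE.union_of_disjoint (hb i) (s.measurableSet_biUnion fun i _ => hb i) ?_
    rw [Set.disjoint_iUnion₂_right]
    exact fun j hj => hd (fun h => hi (h ▸ hj))

theorem ascending (b : ℕ → Set ℝ) (hb : ∀ i, MeasurableSet (b i)) (hm : Monotone b) (f : X) :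
    Tendsto (fun i => E (b i) f) atTop (𝓝 (E (⋃ i, b i) f)) := by
  obtain ⟨μ, hμ⟩ := hE.measure f
  have hU := MeasurableSet.iUnion hb
  have h1 := tendsto_measure_iInter_atTop (μ := μ) (s := fun i => (⋃ i, b i) \ b i)
    (fun i => (hU.diff (hb i)).nullMeasurableSet)
    (fun i j hij => Set.sdiff_subset_sdiff_right (hm hij))
    ⟨0, measure_ne_top_of_univ_eq (hμ _ MeasurableSet.univ) _⟩
  rw [← Set.sdiff_iUnion, Set.sdiff_self, measure_empty] at h1
  simp only [Function.comp_def, hμ _ (hU.diff (hb _))] at h1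
  have h2 := (ENNReal.tendsto_toReal ENNReal.zero_ne_top).comp h1
  simp only [Function.comp_def, ENNReal.toReal_ofReal (sq_nonneg _), ENNReal.toReal_zero] at h2
  rw [tendsto_iff_norm_sub_tendsto_zero]
  have h3 : ∀ i, ‖E (b i) f - E (⋃ i, b i) f‖ = Real.sqrt (‖E ((⋃ i, b i) \ b i) f‖ ^ 2) := by
    intro i
    rw [hE.diff_apply hU (hb i) (Set.subset_iUnion b i), Real.sqrt_sq (norm_nonneg _),
      norm_sub_rev]
  simp only [h3]
  simpa only [Function.comp_def, Real.sqrt_zero] using (Real.continuous_sqrt.tendsto 0).comp h2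

theorem compl_apply (huniv : E Set.univ = 1) {b : Set ℝ} (hb : MeasurableSet b) (f : X) :
    E bᶜ f = f - E b f := by
  rw [Set.compl_eq_univ_sdiff, hE.diff_apply MeasurableSet.univ hb (Set.subset_univ _), huniv]
  rfl

theorem descending (huniv : E Set.univ = 1) (b : ℕ → Set ℝ) (hb : ∀ i, MeasurableSet (b i))
    (hm : Antitone b) (f : X) : Tendsto (fun i => E (b i) f) atTop (𝓝 (E (⋂ i, b i) f)) := by
  have h := hE.ascending (fun i => (b i)ᶜ) (fun i => (hb i).compl)
    (fun i j hij => Set.compl_subset_compl.2 (hm hij)) f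
  rw [← Set.compl_iInter, hE.compl_apply huniv (MeasurableSet.iInter hb)] at h
  simp only [hE.compl_apply huniv (hb _)] at h
  simpa using h.const_sub f

/-- The squared norm of the remainder of the series is the remainder of the series of measures. -/
theorem countablyAdditive : StronglyCountablyAdditive E := by
  intro b hb hd f
  obtain ⟨μ, hμ⟩ := hE.measure f
  have hU := MeasurableSet.iUnion hb
  have h1 := measure_iUnion (μ := μ) hd hb
  have h2 : HasSum (fun i => ‖E (b i) f‖ ^ 2) (‖E (⋃ i, b i) f‖ ^ 2) := by
    have h3 : ∀ i, ‖E (b i) f‖ ^ 2 = (μ (b i)).toReal := fun i => by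
      rw [hμ _ (hb i), ENNReal.toReal_ofReal (sq_nonneg _)]
    have h4 : ‖E (⋃ i, b i) f‖ ^ 2 = (μ (⋃ i, b i)).toReal := by
      rw [hμ _ hU, ENNReal.toReal_ofReal (sq_nonneg _)]
    simp only [h3, h4, h1]
    rw [ENNReal.tsum_toReal_eq fun i => measure_ne_top_of_univ_eq (hμ _ MeasurableSet.univ) _]
    refine ENNReal.hasSum_toReal ?_
    rw [← h1]
    exact measure_ne_top_of_univ_eq (hμ _ MeasurableSet.univ) _
  have h5 : ∀ s : Finset ℕ, ‖∑ i ∈ s, E (b i) f - E (⋃ i, b i) f‖ =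
      Real.sqrt (‖E (⋃ i, b i) f‖ ^ 2 - ∑ i ∈ s, ‖E (b i) f‖ ^ 2) := by
    intro s
    have hs : MeasurableSet (⋃ i ∈ s, b i) := s.measurableSet_biUnion fun i _ => hb i
    have hsub : (⋃ i ∈ s, b i) ⊆ ⋃ i, b i := Set.iUnion₂_subset fun i _ => Set.subset_iUnion b i
    have h6 : ∑ i ∈ s, E (b i) f = E (⋃ i ∈ s, b i) f := by
      rw [hE.finset_sum b hb hd s, _root_.sum_apply]
    have h7 : ∑ i ∈ s, ‖E (b i) f‖ ^ 2 = ‖E (⋃ i ∈ s, b i) f‖ ^ 2 := by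
      have h8 := measure_biUnion_finset (μ := μ) (s := s) (f := b)
        (fun i _ j _ hij => hd hij) (fun i _ => hb i)
      rw [hμ _ hs] at h8
      simp only [hμ _ (hb _)] at h8
      rw [← ENNReal.ofReal_sum_of_nonneg (fun i _ => sq_nonneg _),
        ENNReal.ofReal_eq_ofReal_iff (sq_nonneg _)
          (Finset.sum_nonneg fun i _ => sq_nonneg _)] at h8
      exact h8.symm
    have h9 := hE.norm_sq_union hs (hU.diff hs) Set.disjoint_sdiff_right f
    rw [Set.union_sdiff_cancel hsub] at h9
    rw [h6, h7, h9, add_sub_cancel_left, Real.sqrt_sq (norm_nonneg _),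
      hE.diff_apply hU hs hsub, norm_sub_rev]
  rw [HasSum, tendsto_iff_norm_sub_tendsto_zero]
  simp only [h5]
  have h6 := (h2.const_sub (‖E (⋃ i, b i) f‖ ^ 2))
  simpa [Function.comp_def] using (Real.continuous_sqrt.tendsto _).comp h6

end IsProjectionMeasure

theorem exists_clm_of_tendsto {A : ℕ → X →L[ℂ] X}
    (h : ∀ f, ∃ g, Tendsto (fun n => A n f) atTop (𝓝 g)) :
    ∃ B : X →L[ℂ] X, ∀ f, Tendsto (fun n => A n f) atTop (𝓝 (B f)) := by
  choose B hB using h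
  exact ⟨continuousLinearMapOfTendsto A (tendsto_pi_nhds.2 hB), hB⟩

theorem isSelfAdjoint_of_tendsto {A : ℕ → X →L[ℂ] X} {B : X →L[ℂ] X}
    (hA : ∀ n, IsSelfAdjoint (A n)) (h : ∀ f, Tendsto (fun n => A n f) atTop (𝓝 (B f))) :
    IsSelfAdjoint B := by
  rw [ContinuousLinearMap.isSelfAdjoint_iff_isSymmetric]
  intro x y
  refine tendsto_nhds_unique (((h x).inner (tendsto_const_nhds (x := y)) (𝕜 := ℂ))) ?_
  simp only [(hA _).inner_map_left]
  exact (tendsto_const_nhds (x := x)).inner (h y)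

end ProjectionMeasure

/-! ### The spectral theorem for bounded operators -/

section SpectralTheorem

open Filter Topology

variable {X : Type*} [NormedAddCommGroup X] [InnerProductSpace ℂ X] [CompleteSpace X]

/-- The spectral projection of a closed set is the strong limit of `φₙ(Q)`, where the continuous
functions `φₙ` tend to the indicator of the set. -/
theorem exists_spectralProjection_of_isClosed {Q : X →L[ℂ] X} (hQ : IsSelfAdjoint Q) {b : Set ℝ}
    (hb : IsClosed b) : ∃ E : X →L[ℂ] X, IsStarProjection E ∧
      ∀ f, ‖E f‖ ^ 2 = (spectralMeasure Q f).real b := by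
  let φ : ℕ → ℝ → ℝ := fun n x => (hb.apprSeq n x : ℝ)
  have hφ : ∀ n, Continuous (φ n) := fun n =>
    NNReal.continuous_coe.comp (hb.apprSeq n).continuous
  have hlim : ∀ x, Tendsto (fun n => φ n x) atTop (𝓝 (b.indicator (fun _ => (1 : ℝ)) x)) := by
    intro x
    have h := tendsto_pi_nhds.1 (HasOuterApproxClosed.tendsto_apprSeq hb) x
    have h2 := (NNReal.continuous_coe.tendsto _).comp h
    convert! h2 using 2
    by_cases hx : x ∈ b <;> simp [hx]
  have hbd : ∀ n x, |φ n x| ≤ 1 := fun n x => by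
    rw [abs_of_nonneg (NNReal.coe_nonneg _)]
    exact_mod_cast HasOuterApproxClosed.apprSeq_apply_le_one hb n x
  have hex : ∀ f : X, ∃ h : X, Tendsto (fun n => cfc (φ n) Q f) atTop (𝓝 h) ∧
      ‖h‖ ^ 2 = (spectralMeasure Q f).real b := by
    intro f
    have := isFiniteMeasure_spectralMeasure hQ f
    obtain ⟨h, h1, h2⟩ := exists_tendsto_cfc_apply hQ f (G := fun _ => 1) hφ hlim
      (integrable_const _) hbd
    refine ⟨h, h1, h2.trans ?_⟩
    have h3 : ∀ x, b.indicator (fun _ => (1 : ℝ)) x ^ 2 = b.indicator (fun _ => (1 : ℝ)) x := by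
      intro x
      by_cases hx : x ∈ b <;> simp [hx]
    simp only [h3]
    rw [integral_indicator_const _ hb.measurableSet]
    simp
  obtain ⟨E, hE⟩ := exists_clm_of_tendsto fun f => (hex f).imp fun h hh => hh.1
  have hsq : ∀ f, ‖E f‖ ^ 2 = (spectralMeasure Q f).real b := by
    intro f
    obtain ⟨h, h1, h2⟩ := hex f
    rw [tendsto_nhds_unique (hE f) h1, h2]
  have hsa : IsSelfAdjoint E := isSelfAdjoint_of_tendsto (fun n => cfc_predicate (φ n) Q) hE
  refine ⟨E, isStarProjection_of_re_inner_self hsa fun f => ?_, hsq⟩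
  have := isFiniteMeasure_spectralMeasure hQ f
  -- `(φₙ(Q) f, f) = ∫ φₙ dμ` has the same limit as `‖φₙ(Q) f‖² = ∫ φₙ² dμ`
  have h1 : Tendsto (fun n => (inner ℂ f (cfc (φ n) Q f)).re) atTop
      (𝓝 (inner ℂ f (E f)).re) :=
    (Complex.continuous_re.tendsto _).comp ((tendsto_const_nhds (x := f)).inner (hE f))
  refine tendsto_nhds_unique h1 ?_
  simp only [← integral_spectralMeasure hQ f (hφ _)]
  have h2 : ‖E f‖ ^ 2 = ∫ x, b.indicator (fun _ => (1 : ℝ)) x ∂(spectralMeasure Q f) := by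
    rw [hsq, integral_indicator_const _ hb.measurableSet]
    simp
  rw [h2]
  exact tendsto_integral_of_dominated_convergence (fun _ => 1)
    (fun n => (hφ n).aestronglyMeasurable) (integrable_const _)
    (fun n => Eventually.of_forall (hbd n)) (Eventually.of_forall hlim)

/-- The closed sets generate the Borel sets; a disjoint union is treated as a strong limit of
partial sums, which are Cauchy because their squared norms converge. -/
theorem exists_spectralProjection {Q : X →L[ℂ] X} (hQ : IsSelfAdjoint Q) {b : Set ℝ}
    (hb : MeasurableSet b) : ∃ E : X →L[ℂ] X, IsStarProjection E ∧
      ∀ f, ‖E f‖ ^ 2 = (spectralMeasure Q f).real b := by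
  refine MeasurableSpace.induction_on_inter
    (C := fun b _ => ∃ E : X →L[ℂ] X, IsStarProjection E ∧
      ∀ f, ‖E f‖ ^ 2 = (spectralMeasure Q f).real b)
    (BorelSpace.measurable_eq.trans borel_eq_generateFrom_isClosed) isPiSystem_isClosed
    ?_ ?_ ?_ ?_ b hb
  · exact ⟨0, ⟨by simp [IsIdempotentElem], IsSelfAdjoint.zero _⟩, fun f => by simp⟩
  · exact fun t ht => exists_spectralProjection_of_isClosed hQ ht
  · rintro t ht ⟨E, hE, h⟩
    refine ⟨1 - E, hE.one_sub, fun f => ?_⟩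
    have := isFiniteMeasure_spectralMeasure hQ f
    have h1 := hE.norm_sq_add f
    rw [h f, ← measureReal_univ_spectralMeasure hQ f] at h1
    rw [measureReal_compl ht, ← h1]
    simp
  · intro b hd hb hE
    choose E hE hEμ using hE
    have horth : ∀ i j, i ≠ j → ∀ f, E i (E j f) = 0 := by
      intro i j hij f
      have := isFiniteMeasure_spectralMeasure hQ (E j f)
      have h1 := measureReal_union (μ := spectralMeasure Q (E j f)) (hd hij) (hb j)
      have h2 : (spectralMeasure Q (E j f)).real (b i ∪ b j) ≤ ‖E j f‖ ^ 2 := by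
        rw [← measureReal_univ_spectralMeasure hQ]
        exact measureReal_mono (Set.subset_univ _)
      rw [h1, ← hEμ, ← hEμ, (hE j).apply_apply] at h2
      exact norm_eq_zero.1 (pow_eq_zero_iff two_ne_zero |>.1
        (le_antisymm (by linarith) (sq_nonneg ‖E i (E j f)‖)))
    let S : ℕ → X →L[ℂ] X := fun n => ∑ i ∈ Finset.range n, E i
    have hSsucc : ∀ n, S (n + 1) = S n + E n := fun n => Finset.sum_range_succ _ _
    have hSE : ∀ n m, n ≤ m → ∀ f, S n (E m f) = 0 := by
      intro n m hnm f
      simp only [S, _root_.sum_apply]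
      exact Finset.sum_eq_zero fun i hi =>
        horth i m (by have := Finset.mem_range.1 hi; omega) f
    have hES : ∀ n m, n ≤ m → ∀ f, E m (S n f) = 0 := by
      intro n m hnm f
      simp only [S, _root_.sum_apply, map_sum]
      exact Finset.sum_eq_zero fun i hi =>
        horth m i (by have := Finset.mem_range.1 hi; omega) f
    have hSp : ∀ n, IsStarProjection (S n) := by
      intro n
      induction n with
      | zero => exact ⟨by simp [S, IsIdempotentElem], by simp [S]⟩
      | succ n ih =>
        rw [hSsucc]
        exact ih.add (hE n) (by ext f; exact hSE n n le_rfl f)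
    have hSS : ∀ n k f, S n (S (n + k) f) = S n f := by
      intro n k f
      induction k with
      | zero => exact (hSp n).apply_apply f
      | succ k ih =>
        rw [← add_assoc, hSsucc, _root_.add_apply, map_add, ih, hSE n (n + k) (by omega), add_zero]
    have hSμ : ∀ n f, ‖S n f‖ ^ 2 = ∑ i ∈ Finset.range n, (spectralMeasure Q f).real (b i) := by
      intro n f
      rw [← (hSp n).re_inner_self]
      simp only [S, _root_.sum_apply, inner_sum, Complex.re_sum, (hE _).re_inner_self, hEμ]
    have hsum : ∀ f, Tendsto (fun n => ‖S n f‖ ^ 2) atTop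
        (𝓝 ((spectralMeasure Q f).real (⋃ i, b i))) := by
      intro f
      have := isFiniteMeasure_spectralMeasure hQ f
      simp only [hSμ]
      have h1 : HasSum (fun i => (spectralMeasure Q f).real (b i))
          ((spectralMeasure Q f).real (⋃ i, b i)) := by
        rw [measureReal_def, measure_iUnion hd hb,
          ENNReal.tsum_toReal_eq fun i => measure_ne_top _ _]
        refine ENNReal.hasSum_toReal ?_
        rw [← measure_iUnion hd hb]
        exact measure_ne_top _ _
      exact h1.tendsto_sum_nat
    have hdiff : ∀ n k f, ‖S (n + k) f - S n f‖ ^ 2 = ‖S (n + k) f‖ ^ 2 - ‖S n f‖ ^ 2 := by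
      intro n k f
      have h1 := (hSp n).norm_sq_add (S (n + k) f)
      rw [hSS] at h1
      linarith
    obtain ⟨P, hP⟩ := exists_clm_of_tendsto (A := S) fun f => by
      refine cauchySeq_tendsto_of_complete (Metric.cauchySeq_iff'.2 fun ε hε => ?_)
      obtain ⟨N, hN⟩ := Metric.cauchySeq_iff'.1 (hsum f).cauchySeq (ε ^ 2) (by positivity)
      refine ⟨N, fun n hn => ?_⟩
      obtain ⟨k, rfl⟩ := Nat.exists_eq_add_of_le hn
      rw [dist_eq_norm]
      refine lt_of_pow_lt_pow_left₀ 2 hε.le ?_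
      rw [hdiff]
      exact lt_of_le_of_lt (le_abs_self _) (hN (N + k) hn)
    have hPsq : ∀ f, ‖P f‖ ^ 2 = (spectralMeasure Q f).real (⋃ i, b i) := fun f =>
      tendsto_nhds_unique ((hP f).norm.pow 2) (hsum f)
    refine ⟨P, isStarProjection_of_re_inner_self
      (isSelfAdjoint_of_tendsto (fun n => (hSp n).isSelfAdjoint) hP) fun f => ?_, hPsq⟩
    refine tendsto_nhds_unique ((Complex.continuous_re.tendsto _).comp
      ((tendsto_const_nhds (x := f)).inner (hP f))) ?_
    simp only [Function.comp_def, (hSp _).re_inner_self]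
    exact (hP f).norm.pow 2

end SpectralTheorem

/-! ### The spectral theorem for unbounded operators -/

section SpectralTheoremUnbounded

open Filter Topology

variable {X : Type*} [NormedAddCommGroup X] [InnerProductSpace ℂ X] [CompleteSpace X]

/-- `T` is the unbounded operator `Q⁻¹ - m`, where `Q` is bounded, selfadjoint and injective. -/
structure IsShiftedInverse (T : X →ₗ.[ℂ] X) (Q : X →L[ℂ] X) (m : ℝ) : Prop where
  isSelfAdjoint : IsSelfAdjoint Q
  injective : Function.Injective Q
  mem_graph_iff : ∀ u v, (u, v) ∈ T.graph ↔ u = Q (v + m • u)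

/-- `(φ(Q) Q g, Q g) = (Q φ(Q) Q g, g)`. -/
theorem spectralMeasure_apply_self {Q : X →L[ℂ] X} (hQ : IsSelfAdjoint Q) (g : X) :
    spectralMeasure Q (Q g) =
      (spectralMeasure Q g).withDensity fun s => ENNReal.ofReal (s ^ 2) := by
  have hfin := isFiniteMeasure_spectralMeasure hQ (Q g)
  have hfin' : IsFiniteMeasure
      ((spectralMeasure Q g).withDensity fun s => ENNReal.ofReal (s ^ 2)) :=
    isFiniteMeasure_withDensity_ofReal
      (integrable_spectralMeasure hQ g (continuous_pow 2)).2
  refine ext_of_forall_integral_eq_of_IsFiniteMeasure fun φ => ?_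
  rw [integral_spectralMeasure hQ _ φ.continuous,
    integral_withDensity_eq_integral_toReal_smul (by fun_prop)
      (Eventually.of_forall fun _ => ENNReal.ofReal_lt_top)]
  simp only [ENNReal.toReal_ofReal (sq_nonneg _), smul_eq_mul]
  rw [integral_spectralMeasure hQ g (φ := fun x => x ^ 2 * φ x)
    ((continuous_pow 2).mul φ.continuous), hQ.inner_map_left]
  have h : cfc (fun x => x ^ 2 * φ x) Q = Q * cfc φ Q * Q := by
    have h1 : cfc (fun x => x ^ 2 * φ x) Q = cfc (fun x : ℝ => x * (φ x * x)) Q := by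
      congr 1
      ext x
      ring
    rw [h1, cfc_mul (fun x => x) (fun x => φ x * x) Q (by fun_prop)
        (φ.continuous.mul continuous_id).continuousOn,
      cfc_mul φ (fun x => x) Q φ.continuous.continuousOn (by fun_prop), cfc_id' ℝ Q hQ, mul_assoc]
  rw [h]
  rfl

/-- For injective `Q`, the spectral measures have no mass at `0`: `Q` annihilates the limit of
`ψₙ(Q) f`, where `ψₙ` are bump functions shrinking to `0`. -/
theorem spectralMeasure_singleton_zero {Q : X →L[ℂ] X} (hQ : IsSelfAdjoint Q)
    (hinj : Function.Injective Q) (f : X) : (spectralMeasure Q f).real {0} = 0 := by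
  have := isFiniteMeasure_spectralMeasure hQ f
  let ψ : ℕ → ℝ → ℝ := fun n s => max 0 (1 - n * |s|)
  have hψ : ∀ n, Continuous (ψ n) := fun n => by fun_prop
  have hbd : ∀ n s, |ψ n s| ≤ 1 := fun n s => by
    rw [abs_of_nonneg (le_max_left _ _)]
    have h0 : 0 ≤ (n : ℝ) * |s| := by positivity
    exact max_le zero_le_one (by linarith)
  have hlim : ∀ s, Tendsto (fun n => ψ n s) atTop
      (𝓝 (({0} : Set ℝ).indicator (fun _ => (1 : ℝ)) s)) := by
    intro s
    by_cases hs : s = 0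
    · simp [ψ, hs]
    · rw [Set.indicator_of_notMem (by simpa using hs)]
      refine tendsto_const_nhds.congr' ?_
      obtain ⟨N, hN⟩ := exists_nat_gt (1 / |s|)
      filter_upwards [eventually_ge_atTop N] with n hn
      have h1 : 0 < |s| := abs_pos.2 hs
      have h2 : 1 ≤ (n : ℝ) * |s| := by
        rw [div_lt_iff₀ h1] at hN
        have : (N : ℝ) ≤ n := by exact_mod_cast hn
        nlinarith
      exact (max_eq_left (by linarith)).symm
  obtain ⟨h, h1, h2⟩ := exists_tendsto_cfc_apply hQ f (G := fun _ => 1) hψ hlim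
    (integrable_const _) hbd
  have h3 : Tendsto (fun n => Q (cfc (ψ n) Q f)) atTop (𝓝 0) := by
    refine squeeze_zero_norm' (a := fun n : ℕ => 1 / (n : ℝ) * ‖f‖) ?_ ?_
    · filter_upwards [eventually_gt_atTop 0] with n hn
      have hn' : (0 : ℝ) < n := by exact_mod_cast hn
      have h4 : cfc (fun s => s * ψ n s) Q = Q * cfc (ψ n) Q := by
        rw [cfc_mul (fun x => x) (ψ n) Q (by fun_prop) (hψ n).continuousOn, cfc_id' ℝ Q hQ]
      rw [← mul_apply_eq_comp, ← h4]
      refine (ContinuousLinearMap.le_opNorm _ _).trans ?_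
      gcongr
      refine norm_cfc_le (by positivity) fun s _ => ?_
      rw [norm_mul, Real.norm_eq_abs, Real.norm_eq_abs,
        abs_of_nonneg (le_max_left _ _ : 0 ≤ ψ n s),
        le_div_iff₀ hn']
      rcases le_total (1 - n * |s|) 0 with h5 | h5
      · rw [max_eq_left h5]
        simp
      · rw [max_eq_right h5]
        nlinarith [abs_nonneg s, sq_nonneg ((n : ℝ) * |s| - 1)]
    · have := (tendsto_one_div_atTop_nhds_zero_nat (𝕜 := ℝ)).mul_const ‖f‖
      simpa using this
  have h4 : h = 0 := hinj (by
    rw [map_zero]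
    exact tendsto_nhds_unique ((Q.continuous.tendsto h).comp h1) h3)
  have h5 : ∀ x, ({0} : Set ℝ).indicator (fun _ => (1 : ℝ)) x ^ 2 =
      ({0} : Set ℝ).indicator (fun _ => (1 : ℝ)) x := by
    intro x
    by_cases hx : x = 0 <;> simp [hx]
  simp only [h5] at h2
  rw [integral_indicator_const _ (measurableSet_singleton 0), h4] at h2
  simpa using h2.symm

/-- A vector is in the range of `Q` if `s⁻¹` is square integrable for its spectral measure. -/
theorem mem_range_of_integrable {Q : X →L[ℂ] X} (hQ : IsSelfAdjoint Q)
    (hinj : Function.Injective Q) {f : X}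
    (h : Integrable (fun s => |s⁻¹| ^ 2) (spectralMeasure Q f)) : ∃ g, Q g = f := by
  have := isFiniteMeasure_spectralMeasure hQ f
  -- continuous functions tending to `s⁻¹` (with `0⁻¹ = 0`) and bounded by `|s⁻¹|`
  let φ : ℕ → ℝ → ℝ := fun n s => s / max (s ^ 2) (1 / (n + 1))
  have hpos : ∀ (n : ℕ) (s : ℝ), 0 < max (s ^ 2) (1 / ((n : ℝ) + 1)) := fun n s =>
    lt_max_of_lt_right (by positivity)
  have hφ : ∀ n, Continuous (φ n) := fun n =>
    continuous_id.div (by fun_prop) fun s => (hpos n s).ne'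
  have hbd : ∀ n s, |φ n s| ≤ |s⁻¹| := by
    intro n s
    by_cases hs : s = 0
    · simp [φ, hs]
    · have h1 : 0 < |s| := abs_pos.2 hs
      rw [abs_div, abs_of_pos (hpos n s), abs_inv, div_le_iff₀ (hpos n s)]
      calc |s| = |s|⁻¹ * s ^ 2 := by rw [← sq_abs]; field_simp
        _ ≤ _ := by gcongr; exact le_max_left _ _
  have hev : ∀ s, s ≠ 0 → ∀ᶠ n : ℕ in atTop, φ n s = s⁻¹ := by
    intro s hs
    obtain ⟨N, hN⟩ := exists_nat_gt (1 / s ^ 2)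
    filter_upwards [eventually_ge_atTop N] with n hn
    have h1 : 0 < s ^ 2 := by positivity
    have h2 : 1 / ((n : ℝ) + 1) ≤ s ^ 2 := by
      rw [div_lt_iff₀ h1] at hN
      have : (N : ℝ) ≤ n := by exact_mod_cast hn
      rw [div_le_iff₀ (by positivity)]
      nlinarith
    simp only [φ, max_eq_left h2]
    field_simp
  have hlim : ∀ s, Tendsto (fun n => φ n s) atTop (𝓝 s⁻¹) := by
    intro s
    by_cases hs : s = 0
    · simp [φ, hs]
    · exact tendsto_const_nhds.congr' ((hev s hs).mono fun n hn => hn.symm)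
  obtain ⟨g, h1, -⟩ := exists_tendsto_cfc_apply hQ f hφ hlim h hbd
  refine ⟨g, ?_⟩
  -- `f - Q φₙ(Q) f = χₙ(Q) f`, where `χₙ` tends to the indicator of the null set `{0}`
  let χ : ℕ → ℝ → ℝ := fun n s => 1 - s * φ n s
  have hχ : ∀ n, Continuous (χ n) := fun n => continuous_const.sub (continuous_id.mul (hφ n))
  have hχ0 : ∀ n s, |χ n s| ≤ 1 := by
    intro n s
    have h2 : s * φ n s = s ^ 2 / max (s ^ 2) (1 / ((n : ℝ) + 1)) := by
      simp only [φ]; ring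
    have h3 : s ^ 2 / max (s ^ 2) (1 / ((n : ℝ) + 1)) ≤ 1 := by
      rw [div_le_one (hpos n s)]
      exact le_max_left _ _
    have h4 : 0 ≤ s ^ 2 / max (s ^ 2) (1 / ((n : ℝ) + 1)) := by positivity
    simp only [χ, h2]
    rw [abs_of_nonneg (by linarith)]
    linarith
  have hχlim : ∀ s, Tendsto (fun n => χ n s) atTop
      (𝓝 (({0} : Set ℝ).indicator (fun _ => (1 : ℝ)) s)) := by
    intro s
    by_cases hs : s = 0
    · simp [χ, hs]
    · rw [Set.indicator_of_notMem (by simpa using hs)]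
      refine tendsto_const_nhds.congr' ((hev s hs).mono fun n hn => ?_)
      simp only [χ, hn]
      field_simp
      simp
  obtain ⟨k, h2, h3⟩ := exists_tendsto_cfc_apply hQ f (G := fun _ => 1) hχ hχlim
    (integrable_const _) hχ0
  have h5 : ∀ x, ({0} : Set ℝ).indicator (fun _ => (1 : ℝ)) x ^ 2 =
      ({0} : Set ℝ).indicator (fun _ => (1 : ℝ)) x := by
    intro x
    by_cases hx : x = 0 <;> simp [hx]
  simp only [h5] at h3
  rw [integral_indicator_const _ (measurableSet_singleton 0),
    spectralMeasure_singleton_zero hQ hinj] at h3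
  have hk : k = 0 := by simpa using h3
  have h6 : ∀ n, cfc (χ n) Q f = f - Q (cfc (φ n) Q f) := by
    intro n
    rw [cfc_sub (fun _ => 1) (fun s => s * φ n s) Q (by fun_prop)
      (continuous_id.mul (hφ n)).continuousOn, cfc_const_one ℝ Q hQ,
      cfc_mul (fun x => x) (φ n) Q (by fun_prop) (hφ n).continuousOn, cfc_id' ℝ Q hQ]
    rfl
  have h7 := ((Q.continuous.tendsto g).comp h1).const_sub f
  simp only [Function.comp_def, ← h6] at h7
  rw [hk] at h2
  exact (sub_eq_zero.1 (tendsto_nhds_unique h7 h2)).symm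

/-- **Spectral theorem** for a selfadjoint operator with a real point in its resolvent set. -/
theorem IsShiftedInverse.exists_isResolutionOfIdentity {T : X →ₗ.[ℂ] X} {Q : X →L[ℂ] X} {m : ℝ}
    (hT : IsShiftedInverse T Q m) : ∃ F, IsResolutionOfIdentity T F := by
  have hQ := hT.isSelfAdjoint
  have hex : ∀ b : Set ℝ, ∃ E : X →L[ℂ] X, MeasurableSet b → IsStarProjection E ∧
      ∀ f, ‖E f‖ ^ 2 = (spectralMeasure Q f).real b := by
    intro b
    by_cases hb : MeasurableSet b
    · obtain ⟨E, hE⟩ := exists_spectralProjection hQ hb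
      exact ⟨E, fun _ => hE⟩
    · exact ⟨0, fun h => absurd h hb⟩
  choose E hE using hex
  -- the value of `τ` at `0` is irrelevant, as `{0}` is a null set for the spectral measures
  let τ : ℝ → ℝ := fun s => s⁻¹ - m
  have hτ : Measurable τ := measurable_inv.sub_const m
  have hμ : ∀ f b, MeasurableSet b →
      (spectralMeasure Q f).map τ b = ENNReal.ofReal (‖E (τ ⁻¹' b) f‖ ^ 2) := by
    intro f b hb
    have := isFiniteMeasure_spectralMeasure hQ f
    rw [Measure.map_apply hτ hb, (hE _ (hτ hb)).2 f, ofReal_measureReal]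
  have hF : IsProjectionMeasure fun b => E (τ ⁻¹' b) :=
    ⟨fun b hb => (hE _ (hτ hb)).1, fun f => ⟨_, hμ f⟩⟩
  refine ⟨fun b => E (τ ⁻¹' b), hF.projection, ?_, hF.countablyAdditive, fun f =>
    ⟨(spectralMeasure Q f).map τ, hμ f, ?_⟩⟩
  · refine IsSelfAdjoint.eq_of_re_inner_eq (hF.projection _ MeasurableSet.univ).isSelfAdjoint
      (IsSelfAdjoint.one _) fun f => ?_
    rw [(hF.projection _ MeasurableSet.univ).re_inner_self, Set.preimage_univ,
      (hE _ MeasurableSet.univ).2, measureReal_univ_spectralMeasure hQ]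
    rw [one_apply_eq_self, inner_self_eq_norm_sq_to_K]
    norm_cast
  -- the vectors of the domain are `f = Q g`, with spectral measure `s² μ_g`
  have hdom : ∀ {f}, f ∈ T.domain → ∃ g, Q g = f := by
    intro f hf
    exact ⟨T ⟨f, hf⟩ + m • f, ((hT.mem_graph_iff _ _).1 (T.mem_graph ⟨f, hf⟩)).symm⟩
  constructor
  · rw [integrable_map_measure (by fun_prop) hτ.aemeasurable]
    constructor
    · intro hf
      obtain ⟨g, rfl⟩ := hdom hf
      rw [spectralMeasure_apply_self hQ, integrable_withDensity_iff (by fun_prop)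
        (Eventually.of_forall fun _ => ENNReal.ofReal_lt_top)]
      simp only [ENNReal.toReal_ofReal (sq_nonneg _)]
      refine (integrable_spectralMeasure hQ g (φ := fun s => (1 - m * s) ^ 2)
        (by fun_prop)).mono' (by fun_prop) (Eventually.of_forall fun s => ?_)
      simp only [Function.comp_def, τ]
      rw [Real.norm_of_nonneg (by positivity)]
      by_cases hs : s = 0
      · simp [hs]
      · apply le_of_eq
        field_simp
    · intro h
      have := isFiniteMeasure_spectralMeasure hQ f
      obtain ⟨g, rfl⟩ := mem_range_of_integrable hQ hT.injective (f := f) (by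
        refine ((h.const_mul 2).add (integrable_const (2 * m ^ 2))).mono' (by fun_prop)
          (Eventually.of_forall fun s => ?_)
        simp only [Function.comp_def, τ, Pi.add_apply]
        rw [Real.norm_of_nonneg (by positivity), sq_abs]
        nlinarith [sq_nonneg (s⁻¹ - 2 * m)])
      refine LinearPMap.mem_domain_iff.2 ⟨g - m • Q g, (hT.mem_graph_iff _ _).2 ?_⟩
      rw [sub_add_cancel]
  · intro hf
    have hg := (hT.mem_graph_iff _ _).1 (T.mem_graph ⟨f, hf⟩)
    set v := T ⟨f, hf⟩ with hv
    obtain ⟨g, rfl⟩ := hdom hf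
    have hgv : g = v + m • Q g := hT.injective hg
    have hv' : v = g - m • Q g := eq_sub_of_add_eq hgv.symm
    have hreal : ∀ x, ((inner ℂ (Q x) x).re : ℂ) = inner ℂ (Q x) x := fun x =>
      Complex.conj_eq_iff_re.1 (by rw [inner_conj_symm, hQ.inner_map_left])
    rw [integral_map hτ.aemeasurable (by fun_prop), spectralMeasure_apply_self hQ,
      integral_withDensity_eq_integral_toReal_smul (by fun_prop)
        (Eventually.of_forall fun _ => ENNReal.ofReal_lt_top)]
    simp only [ENNReal.toReal_ofReal (sq_nonneg _), smul_eq_mul]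
    have h1 : ∀ s : ℝ, s ^ 2 * τ s = s - m * s ^ 2 := by
      intro s
      by_cases hs : s = 0
      · simp [hs]
      · simp only [τ]
        field_simp
    simp only [h1]
    rw [integral_sub (integrable_spectralMeasure hQ g (φ := fun s => s) continuous_id)
      (integrable_spectralMeasure hQ g (φ := fun s => m * s ^ 2) (by fun_prop)),
      integral_const_mul]
    have h2 := norm_cfc_apply_sq hQ g continuous_id
    have h3 := integral_spectralMeasure hQ g continuous_id
    rw [cfc_id ℝ Q hQ] at h2 h3
    simp only [id] at h2 h3
    rw [← h2, h3, hv', inner_sub_right, hQ.inner_map_left, RCLike.real_smul_eq_coe_smul (K := ℂ),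
      inner_smul_right, ← hQ.inner_map_left, inner_self_eq_norm_sq_to_K]
    push_cast
    rw [hreal]
    rfl

end SpectralTheoremUnbounded

/-! ### Selfadjoint operators and their resolution of the identity -/

section Resolution

open Filter Topology

variable {X : Type*} [NormedAddCommGroup X] [InnerProductSpace ℂ X]

theorem inner_real_smul (x y : X) (r : ℝ) : inner ℂ x (r • y) = (r : ℂ) * inner ℂ x y := by
  rw [RCLike.real_smul_eq_coe_smul (K := ℂ), inner_smul_right]
  rfl

theorem real_smul_inner (x y : X) (r : ℝ) : inner ℂ (r • x) y = (r : ℂ) * inner ℂ x y := by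
  rw [RCLike.real_smul_eq_coe_smul (K := ℂ), inner_smul_left]
  simp

theorem re_inner_self (x : X) : (inner ℂ x x).re = ‖x‖ ^ 2 := by
  rw [inner_self_eq_norm_sq_to_K]
  norm_cast

theorem integrable_id_of_integrable_sq {μ : Measure ℝ} [IsFiniteMeasure μ]
    (h : Integrable (fun t : ℝ => t ^ 2) μ) : Integrable (fun t : ℝ => t) μ := by
  refine (h.add (integrable_const 1)).mono' (by fun_prop) (Eventually.of_forall fun t => ?_)
  simp only [Pi.add_apply, Real.norm_eq_abs]
  nlinarith [sq_abs t, sq_nonneg (|t| - 1), abs_nonneg t]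

variable [CompleteSpace X]

namespace IsShiftedInverse

variable {T : X →ₗ.[ℂ] X} {Q : X →L[ℂ] X} {m : ℝ} (hT : IsShiftedInverse T Q m)
include hT

theorem mem_graph (g : X) : (Q g, g - m • Q g) ∈ T.graph :=
  (hT.mem_graph_iff _ _).2 (by rw [sub_add_cancel])

theorem symmetric {u v u' v' : X} (h : (u, v) ∈ T.graph) (h' : (u', v') ∈ T.graph) :
    inner ℂ v u' = inner ℂ u v' := by
  have h1 := (hT.mem_graph_iff _ _).1 h
  have h2 := (hT.mem_graph_iff _ _).1 h'
  have h3 : inner ℂ (v + m • u) u' = inner ℂ u (v' + m • u') := by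
    conv_lhs => rw [h2]
    conv_rhs => rw [h1]
    rw [hT.isSelfAdjoint.inner_map_left]
  rw [inner_add_left, inner_add_right, inner_real_smul, real_smul_inner] at h3
  exact add_right_cancel h3

theorem im_inner {u v : X} (h : (u, v) ∈ T.graph) : (inner ℂ u v).im = 0 :=
  Complex.conj_eq_iff_im.1 (by rw [inner_conj_symm, hT.symmetric h h])

theorem isClosed_graph : IsClosed (T.graph : Set (X × X)) := by
  have h : (T.graph : Set (X × X)) = {p | p.1 = Q (p.2 + m • p.1)} :=
    Set.ext fun p => hT.mem_graph_iff p.1 p.2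
  rw [h]
  exact isClosed_eq (by fun_prop) (by fun_prop)

theorem mem_graph_of_forall {u v : X}
    (h : ∀ a b, (a, b) ∈ T.graph → inner ℂ b u = inner ℂ a v) : (u, v) ∈ T.graph := by
  rw [hT.mem_graph_iff]
  refine ext_inner_left ℂ fun g => ?_
  have h1 := h _ _ (hT.mem_graph g)
  rw [inner_sub_left, real_smul_inner] at h1
  rw [← hT.isSelfAdjoint.inner_map_left, inner_add_right, inner_real_smul, ← h1]
  ring

end IsShiftedInverse

namespace IsResolutionOfIdentity

variable {T : X →ₗ.[ℂ] X} {F : Set ℝ → X →L[ℂ] X} (hF : IsResolutionOfIdentity T F)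
include hF

theorem isProjectionMeasure : IsProjectionMeasure F :=
  ⟨hF.projection, fun f => (hF.represents f).imp fun _ h => h.1⟩

/-- The spectral measure of a vector in the range of `F b` lives on `b`. -/
theorem ae_mem {b : Set ℝ} (hb : MeasurableSet b) {f : X} (hf : F b f = f) {μ : Measure ℝ}
    (hμ : ∀ b : Set ℝ, MeasurableSet b → μ b = ENNReal.ofReal (‖F b f‖ ^ 2)) :
    ∀ᵐ t ∂μ, t ∈ b := by
  rw [ae_iff]
  change μ bᶜ = 0
  rw [hμ _ hb.compl, hF.isProjectionMeasure.compl_apply hF.univ hb, hf]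
  simp

theorem mem_domain_of_isBounded {b : Set ℝ} (hb : MeasurableSet b) (hbb : Bornology.IsBounded b)
    (f : X) : F b f ∈ T.domain := by
  obtain ⟨μ, hμ, hdom, -⟩ := hF.represents (F b f)
  have hfin : IsFiniteMeasure μ :=
    ⟨(measure_ne_top_of_univ_eq (hμ _ MeasurableSet.univ) _).lt_top⟩
  obtain ⟨C, hC⟩ := hbb.exists_norm_le
  refine hdom.2 ((integrable_const (C ^ 2)).mono' (by fun_prop) ?_)
  filter_upwards [hF.ae_mem hb ((hF.projection b hb).apply_apply f) hμ] with t ht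
  rw [norm_pow]
  exact pow_le_pow_left₀ (norm_nonneg _) (hC t ht) 2

/-- The quadratic form of `T` is diagonal with respect to the splitting `f = F b f + F bᶜ f`. -/
theorem mem_domain_and_inner_add {b : Set ℝ} (hb : MeasurableSet b) {f : X} (hf : f ∈ T.domain) :
    ∃ (h₁ : F b f ∈ T.domain) (h₂ : F bᶜ f ∈ T.domain),
      inner ℂ f (T ⟨f, hf⟩) =
        inner ℂ (F b f) (T ⟨F b f, h₁⟩) + inner ℂ (F bᶜ f) (T ⟨F bᶜ f, h₂⟩) := by
  obtain ⟨μ, hμ, hdom, hval⟩ := hF.represents f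
  have hfin : IsFiniteMeasure μ :=
    ⟨(measure_ne_top_of_univ_eq (hμ _ MeasurableSet.univ) _).lt_top⟩
  have hint2 := hdom.1 hf
  have hint := integrable_id_of_integrable_sq hint2
  have key : ∀ c, MeasurableSet c → ∃ h : F c f ∈ T.domain,
      inner ℂ (F c f) (T ⟨F c f, h⟩) = ((∫ t in c, t ∂μ : ℝ) : ℂ) := by
    intro c hc
    obtain ⟨ν, hν, hdom', hval'⟩ := hF.represents (F c f)
    have hνμ : ν = μ.restrict c := by
      ext s hs
      rw [hν s hs, Measure.restrict_apply hs, hμ _ (hs.inter hc),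
        hF.isProjectionMeasure.inter hs hc, mul_apply_eq_comp]
    have h : F c f ∈ T.domain := hdom'.2 (hνμ ▸ hint2.restrict)
    exact ⟨h, by rw [hval' h, hνμ]⟩
  obtain ⟨h₁, e₁⟩ := key b hb
  obtain ⟨h₂, e₂⟩ := key bᶜ hb.compl
  refine ⟨h₁, h₂, ?_⟩
  rw [e₁, e₂, hval hf, ← Complex.ofReal_add, integral_add_compl hb hint]

theorem re_inner_le {b : Set ℝ} (hb : MeasurableSet b) {β : ℝ} (hβ : ∀ t ∈ b, t ≤ β) {u v : X}
    (hu : F b u = u) (h : (u, v) ∈ T.graph) : (inner ℂ u v).re ≤ β * ‖u‖ ^ 2 := by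
  obtain ⟨⟨a, ha⟩, rfl, rfl⟩ := (LinearPMap.mem_graph_iff _).1 h
  simp only at hu ⊢
  obtain ⟨μ, hμ, hdom, hval⟩ := hF.represents a
  have hfin : IsFiniteMeasure μ :=
    ⟨(measure_ne_top_of_univ_eq (hμ _ MeasurableSet.univ) _).lt_top⟩
  rw [hval ha, Complex.ofReal_re]
  have hint := integrable_id_of_integrable_sq (hdom.1 ha)
  have h1 := integral_mono_ae hint (integrable_const β)
    ((hF.ae_mem hb hu hμ).mono fun t ht => hβ t ht)
  rw [integral_const, measureReal_def, hμ _ MeasurableSet.univ, hF.univ, one_apply_eq_self,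
    ENNReal.toReal_ofReal (sq_nonneg _), smul_eq_mul] at h1
  linarith

theorem le_re_inner {b : Set ℝ} (hb : MeasurableSet b) {α : ℝ} (hα : ∀ t ∈ b, α ≤ t) {u v : X}
    (hu : F b u = u) (h : (u, v) ∈ T.graph) : α * ‖u‖ ^ 2 ≤ (inner ℂ u v).re := by
  obtain ⟨⟨a, ha⟩, rfl, rfl⟩ := (LinearPMap.mem_graph_iff _).1 h
  simp only at hu ⊢
  obtain ⟨μ, hμ, hdom, hval⟩ := hF.represents a
  have hfin : IsFiniteMeasure μ :=
    ⟨(measure_ne_top_of_univ_eq (hμ _ MeasurableSet.univ) _).lt_top⟩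
  rw [hval ha, Complex.ofReal_re]
  have hint := integrable_id_of_integrable_sq (hdom.1 ha)
  have h1 := integral_mono_ae (integrable_const α) hint
    ((hF.ae_mem hb hu hμ).mono fun t ht => hα t ht)
  rw [integral_const, measureReal_def, hμ _ MeasurableSet.univ, hF.univ, one_apply_eq_self,
    ENNReal.toReal_ofReal (sq_nonneg _), smul_eq_mul] at h1
  linarith

variable {Q : X →L[ℂ] X} {m : ℝ} (hT : IsShiftedInverse T Q m)
include hT

/-- The spectral projections commute with `T`. The definition of a resolution of the identity gives
only the diagonal values of the form of `T`; their additivity under `f = F b f + F bᶜ f` yields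
`T u = F b T F b u + F bᶜ T F bᶜ u` by polarization. -/
theorem map_mem_graph {b : Set ℝ} (hb : MeasurableSet b) {u v : X} (h : (u, v) ∈ T.graph) :
    (F b u, F b v) ∈ T.graph := by
  have hE := hF.isProjectionMeasure
  have hQd : ∀ g, Q g ∈ T.domain := fun g => LinearPMap.mem_domain_of_mem_graph (hT.mem_graph g)
  have hTQ : ∀ g, T ⟨Q g, hQd g⟩ = g - m • Q g := fun g =>
    (LinearPMap.mem_graph_snd_inj T (hT.mem_graph g) (T.mem_graph ⟨Q g, hQd g⟩) rfl).symm
  have hd : ∀ c, MeasurableSet c → ∀ g, F c (Q g) ∈ T.domain := fun c hc g =>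
    (hF.mem_domain_and_inner_add hc (hQd g)).1
  let K : ∀ c, MeasurableSet c → X →ₗ[ℂ] X := fun c hc => T.toFun ∘ₗ
    LinearMap.codRestrict T.domain ((F c : X →ₗ[ℂ] X) ∘ₗ (Q : X →ₗ[ℂ] X)) (hd c hc)
  -- the identity `T u = F b T F b u + F bᶜ T F bᶜ u` for `u = Q g`
  let M : X →ₗ[ℂ] X := (Q : X →ₗ[ℂ] X) ∘ₗ (LinearMap.id - (m : ℂ) • (Q : X →ₗ[ℂ] X) -
    (F b : X →ₗ[ℂ] X) ∘ₗ K b hb - (F bᶜ : X →ₗ[ℂ] X) ∘ₗ K bᶜ hb.compl)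
  have hM : M = 0 := by
    rw [← inner_map_self_eq_zero]
    intro g
    obtain ⟨h₁, h₂, h3⟩ := hF.mem_domain_and_inner_add hb (hQd g)
    rw [hTQ] at h3
    have h4 : M g = Q (g - m • Q g - F b (T ⟨F b (Q g), h₁⟩) - F bᶜ (T ⟨F bᶜ (Q g), h₂⟩)) := rfl
    rw [← inner_conj_symm, h4, ← hT.isSelfAdjoint.inner_map_left, inner_sub_right,
      inner_sub_right, h3, ← (hF.projection b hb).isSelfAdjoint.inner_map_left,
      ← (hF.projection _ hb.compl).isSelfAdjoint.inner_map_left]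
    simp
  have key : ∀ g, g - m • Q g =
      F b (T ⟨F b (Q g), hd b hb g⟩) + F bᶜ (T ⟨F bᶜ (Q g), hd bᶜ hb.compl g⟩) := by
    intro g
    have h1 : Q (g - m • Q g - F b (T ⟨F b (Q g), hd b hb g⟩) -
      F bᶜ (T ⟨F bᶜ (Q g), hd bᶜ hb.compl g⟩)) = Q 0 := by
      rw [map_zero]
      exact LinearMap.congr_fun hM g
    have h2 := hT.injective h1
    rw [sub_sub, sub_eq_zero] at h2
    exact h2
  have hzero : ∀ x, F b (F bᶜ x) = 0 := fun x =>
    DFunLike.congr_fun (hE.mul_eq_zero hb hb.compl disjoint_compl_right) x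
  have hzero' : ∀ x, F bᶜ (F b x) = 0 := fun x =>
    DFunLike.congr_fun (hE.mul_eq_zero hb.compl hb disjoint_compl_left) x
  have hFb := (hF.projection b hb).apply_apply
  set g := v + m • u with hg
  have hu : u = Q g := (hT.mem_graph_iff _ _).1 h
  have hv : v = g - m • Q g := by rw [← hu, hg, add_sub_cancel_right]
  -- `F b u = Q g'` for some `g'`, to which the identity applies again
  have h1 := (hT.mem_graph_iff _ _).1 (T.mem_graph ⟨F b (Q g), hd b hb g⟩)
  set w := T ⟨F b (Q g), hd b hb g⟩ with hw
  simp only at h1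
  have h2 : F b v = F b w := by
    rw [hv, key g, map_add, hFb, hzero, add_zero]
  have h3 := key (w + m • F b (Q g))
  simp only [← h1, hFb, hzero', add_sub_cancel_right] at h3
  rw [← hw] at h3
  have h5 : T ⟨0, T.domain.zero_mem⟩ = 0 := T.map_zero
  rw [h5, map_zero, add_zero] at h3
  rw [h2, ← h3, hu]
  exact T.mem_graph ⟨F b (Q g), hd b hb g⟩

theorem commute_resolvent {b : Set ℝ} (hb : MeasurableSet b) (g : X) : F b (Q g) = Q (F b g) := by
  have h := (hT.mem_graph_iff _ _).1 (hF.map_mem_graph hT hb (hT.mem_graph g))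
  rwa [map_sub, ContinuousLinearMap.map_smul_of_tower, sub_add_cancel] at h

end IsResolutionOfIdentity

end Resolution

/-! ### Parts of a selfadjoint operator in spectral subspaces -/

section SpectralParts

open Filter Topology

variable {X : Type*} [NormedAddCommGroup X] [InnerProductSpace ℂ X] [CompleteSpace X]

namespace IsResolutionOfIdentity

variable {T : X →ₗ.[ℂ] X} {F : Set ℝ → X →L[ℂ] X} (hF : IsResolutionOfIdentity T F)
variable {Q : X →L[ℂ] X} {m : ℝ} (hT : IsShiftedInverse T Q m)
include hF hT

theorem mem_graph_sub_smul {u v : X} (h : (u, v) ∈ T.graph) {b : Set ℝ} (hb : MeasurableSet b)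
    (t : ℝ) : (F b u, F b (v - t • u) + t • F b u) ∈ T.graph := by
  rw [map_sub, ContinuousLinearMap.map_smul_of_tower, sub_add_cancel]
  exact hF.map_mem_graph hT hb h

/-- On the range of `F b`, the operator `T - t` is bounded below by the distance of `t` to `b`. -/
theorem norm_le_norm_sub {b : Set ℝ} (hb : MeasurableSet b) {t d : ℝ} (hd : 0 ≤ d)
    (hbt : ∀ s ∈ b, d ≤ |s - t|) {u v : X} (hu : F b u = u) (h : (u, v) ∈ T.graph) :
    d * ‖u‖ ≤ ‖v - t • u‖ := by
  have hE := hF.isProjectionMeasure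
  -- split `b` at `t`: the form of `T - t` is definite on each of the two parts
  let bp := b ∩ Set.Ici t
  let bm := b ∩ Set.Iio t
  have hbp : MeasurableSet bp := hb.inter measurableSet_Ici
  have hbm : MeasurableSet bm := hb.inter measurableSet_Iio
  have hdisj : Disjoint bp bm := Set.disjoint_left.2 fun x hx hx' =>
    ((Set.mem_Iio.1 hx'.2).trans_le (Set.mem_Ici.1 hx.2)).false
  have hun : bp ∪ bm = b := by
    rw [← Set.inter_union_distrib_left, Set.Ici_union_Iio, Set.inter_univ]
  set w := v - t • u with hw
  have key : ∀ c, MeasurableSet c → (∀ p q, F c p = p → (p, q + t • p) ∈ T.graph →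
      d * ‖p‖ ^ 2 ≤ |(inner ℂ p q).re|) → d ^ 2 * ‖F c u‖ ^ 2 ≤ ‖F c w‖ ^ 2 := by
    intro c hc hcd
    have h1 := hcd (F c u) (F c w) ((hF.projection c hc).apply_apply u)
      (hF.mem_graph_sub_smul hT h hc t)
    have h2 : |(inner ℂ (F c u) (F c w)).re| ≤ ‖F c u‖ * ‖F c w‖ :=
      (Complex.abs_re_le_norm _).trans (norm_inner_le_norm _ _)
    rcases eq_or_lt_of_le (norm_nonneg (F c u)) with h3 | h3
    · rw [← h3]
      nlinarith [sq_nonneg ‖F c w‖]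
    · have h4 : d * ‖F c u‖ ≤ ‖F c w‖ := by
        refine le_of_mul_le_mul_left ?_ h3
        nlinarith
      calc d ^ 2 * ‖F c u‖ ^ 2 = (d * ‖F c u‖) ^ 2 := by ring
        _ ≤ _ := pow_le_pow_left₀ (by positivity) h4 2
  have h1 := key bp hbp fun p q hp hpq => by
    have h2 := hF.le_re_inner hbp (α := t + d) (fun s hs => by
      have h3 := hbt s hs.1
      have h4 : t ≤ s := hs.2
      rw [abs_of_nonneg (by linarith)] at h3
      linarith) hp hpq
    rw [inner_add_right, inner_real_smul, Complex.add_re, Complex.re_ofReal_mul, re_inner_self]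
      at h2
    refine le_trans ?_ (le_abs_self _)
    linarith
  have h2 := key bm hbm fun p q hp hpq => by
    have h2 := hF.re_inner_le hbm (β := t - d) (fun s hs => by
      have h3 := hbt s hs.1
      have h4 : s < t := hs.2
      rw [abs_of_neg (by linarith)] at h3
      linarith) hp hpq
    rw [inner_add_right, inner_real_smul, Complex.add_re, Complex.re_ofReal_mul, re_inner_self]
      at h2
    refine le_trans ?_ (neg_le_abs _)
    linarith
  have h3 := hE.norm_sq_union hbp hbm hdisj u
  have h4 := hE.norm_sq_union hbp hbm hdisj w
  rw [hun] at h3 h4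
  rw [hu] at h3
  have h5 := (hF.projection b hb).norm_apply_le w
  refine le_of_sq_le_sq ?_ (norm_nonneg _)
  calc (d * ‖u‖) ^ 2 = d ^ 2 * ‖F bp u‖ ^ 2 + d ^ 2 * ‖F bm u‖ ^ 2 := by rw [mul_pow, h3]; ring
    _ ≤ ‖F b w‖ ^ 2 := by rw [h4]; linarith
    _ ≤ ‖w‖ ^ 2 := pow_le_pow_left₀ (norm_nonneg _) h5 2

/-- The bound from the distance of `z` to `b` for real `z`, and from the imaginary part for the
remaining `z`. -/
theorem exists_lower_bound {b : Set ℝ} (hb : MeasurableSet b) {z : ℂ} {d : ℝ} (hd : 0 < d)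
    (hbz : ∀ s ∈ b, d ≤ ‖(s : ℂ) - z‖) :
    ∃ c : ℝ, 0 < c ∧ ∀ u v, F b u = u → (u, v) ∈ T.graph → c * ‖u‖ ≤ ‖v - z • u‖ := by
  by_cases hz : z.im = 0
  · obtain ⟨t, rfl⟩ : ∃ t : ℝ, (t : ℂ) = z := ⟨z.re, Complex.ext rfl hz.symm⟩
    refine ⟨d, hd, fun u v hu h => ?_⟩
    have := hF.norm_le_norm_sub hT hb hd.le (t := t) (fun s hs => by
      have h1 := hbz s hs
      rwa [← Complex.ofReal_sub, Complex.norm_real] at h1) hu h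
    rwa [RCLike.real_smul_eq_coe_smul (K := ℂ)] at this
  · refine ⟨|z.im|, abs_pos.2 hz, fun u v _ h => ?_⟩
    rcases eq_or_lt_of_le (norm_nonneg u) with h3 | h3
    · rw [← h3, mul_zero]
      exact norm_nonneg _
    · refine le_of_mul_le_mul_left ?_ h3
      refine le_trans ?_ (norm_inner_le_norm (𝕜 := ℂ) u (v - z • u))
      refine le_trans ?_ (Complex.abs_im_le_norm _)
      rw [inner_sub_right, inner_smul_right, inner_self_eq_norm_sq_to_K, Complex.sub_im,
        hT.im_inner h]
      have h4 : (z * ((‖u‖ : ℂ)) ^ 2).im = z.im * ‖u‖ ^ 2 := by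
        rw [← Complex.ofReal_pow, Complex.im_mul_ofReal]
      change _ ≤ |0 - (z * ((‖u‖ : ℂ)) ^ 2).im|
      rw [h4, zero_sub, abs_neg, abs_mul, abs_of_nonneg (sq_nonneg ‖u‖)]
      apply le_of_eq
      ring

/-- The part of `T` in the range of `F b` has a resolvent at each point at positive distance from
`b`; it is extended by zero to the whole space. -/
theorem exists_resolvent_part {b : Set ℝ} (hb : MeasurableSet b) {z : ℂ} {d : ℝ} (hd : 0 < d)
    (hbz : ∀ s ∈ b, d ≤ ‖(s : ℂ) - z‖) :
    ∃ G : X →L[ℂ] X, (∀ f, F b (G f) = G f) ∧ (∀ f, (G f, F b f + z • G f) ∈ T.graph) ∧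
      ∀ u v, (u, v) ∈ T.graph → G (v - z • u) = F b u := by
  have hFb := (hF.projection b hb).apply_apply
  have hsa := (hF.projection b hb).isSelfAdjoint
  obtain ⟨c, hc, hlow⟩ := hF.exists_lower_bound hT hb hd hbz
  obtain ⟨c', hc', hlow'⟩ := hF.exists_lower_bound hT hb (z := starRingEnd ℂ z) hd (fun s hs => by
    have := hbz s hs
    rwa [← Complex.norm_conj, map_sub, Complex.conj_ofReal] at this)
  -- the range of `T - z` on the range of `F b`
  let M : Submodule ℂ X :=
    { carrier := {w | ∃ u, F b u = u ∧ (u, w + z • u) ∈ T.graph}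
      zero_mem' := ⟨0, map_zero _, by simp⟩
      add_mem' := by
        rintro w w' ⟨u, hu, h⟩ ⟨u', hu', h'⟩
        refine ⟨u + u', by rw [map_add, hu, hu'], ?_⟩
        convert! T.graph.add_mem h h' using 1
        rw [Prod.mk_add_mk, smul_add]
        congr 1
        abel
      smul_mem' := by
        rintro r w ⟨u, hu, h⟩
        refine ⟨r • u, by rw [map_smul, hu], ?_⟩
        convert! T.graph.smul_mem r h using 1
        rw [Prod.smul_mk, smul_add, smul_comm] }
  have hMclosed : IsClosed (M : Set X) := by
    refine IsSeqClosed.isClosed ?_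
    intro w w₀ hw hlim
    choose u hu hg using hw
    have hcauchy : CauchySeq u := by
      have hwc := hlim.cauchySeq
      rw [Metric.cauchySeq_iff] at hwc ⊢
      intro ε hε
      obtain ⟨N, hN⟩ := hwc (c * ε) (by positivity)
      refine ⟨N, fun i hi j hj => ?_⟩
      have h1 := hN i hi j hj
      rw [dist_eq_norm] at h1 ⊢
      have h2 := hlow (u i - u j) _ (by rw [map_sub, hu, hu]) (T.graph.sub_mem (hg i) (hg j))
      have h3 : w i + z • u i - (w j + z • u j) - z • (u i - u j) = w i - w j := by
        rw [smul_sub]; abel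
      simp only [h3] at h2
      exact lt_of_mul_lt_mul_left (h2.trans_lt h1) hc.le
    obtain ⟨u₀, hu₀⟩ := cauchySeq_tendsto_of_complete hcauchy
    refine ⟨u₀, ?_, ?_⟩
    · refine tendsto_nhds_unique (((F b).continuous.tendsto u₀).comp hu₀) ?_
      simpa only [Function.comp_def, hu] using hu₀
    · exact hT.isClosed_graph.mem_of_tendsto
        (hu₀.prodMk_nhds (hlim.add (hu₀.const_smul z))) (Eventually.of_forall hg)
  have : CompleteSpace M := hMclosed.completeSpace_coe
  have hMb : ∀ w ∈ M, F b w = w := by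
    rintro w ⟨u, hu, h⟩
    have h1 := hF.map_mem_graph hT hb h
    rw [hu] at h1
    have h2 := LinearPMap.mem_graph_snd_inj T h h1 rfl
    rw [map_add, map_smul, hu] at h2
    exact (add_right_cancel h2).symm
  have hsurj : ∀ f, F b f ∈ M := by
    intro f
    obtain ⟨p, hp, q, hq, hpq⟩ := M.exists_add_mem_mem_orthogonal (F b f)
    have hqb : F b q = q := by
      have h1 : q = F b f - p := by rw [hpq, add_sub_cancel_left]
      rw [h1, map_sub, hFb, hMb p hp]
    -- a vector orthogonal to the range of `T - z` is an eigenvector of `T` for `conj z`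
    have h1 : (q, starRingEnd ℂ z • q) ∈ T.graph := by
      refine hT.mem_graph_of_forall fun a a' ha => ?_
      have h2 : F b (a' - z • a) ∈ M := ⟨F b a, hFb a, by
        rw [map_sub, map_smul, sub_add_cancel]
        exact hF.map_mem_graph hT hb ha⟩
      have h3 := (Submodule.mem_orthogonal _ _).1 hq _ h2
      rw [hsa.inner_map_left, hqb, inner_sub_left, inner_smul_left, sub_eq_zero] at h3
      rw [h3, inner_smul_right]
    have h2 := hlow' q _ hqb h1
    rw [sub_self, norm_zero] at h2
    have h3 : ‖q‖ = 0 := le_antisymm (by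
      by_contra h4
      have := mul_pos hc' (not_le.1 h4)
      linarith) (norm_nonneg q)
    rw [hpq, norm_eq_zero.1 h3, add_zero]
    exact hp
  choose g hgb hg using hsurj
  have huniq : ∀ f u, F b u = u → (u, F b f + z • u) ∈ T.graph → u = g f := by
    intro f u hu h
    have h1 := hlow (u - g f) _ (by rw [map_sub, hu, hgb]) (T.graph.sub_mem h (hg f))
    have h2 : F b f + z • u - (F b f + z • g f) - z • (u - g f) = 0 := by
      rw [smul_sub]; abel
    simp only [h2, norm_zero] at h1
    refine sub_eq_zero.1 (norm_eq_zero.1 (le_antisymm ?_ (norm_nonneg _)))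
    by_contra h4
    have := mul_pos hc (not_le.1 h4)
    linarith
  let G₀ : X →ₗ[ℂ] X :=
    { toFun := g
      map_add' := fun f f' => (huniq _ _ (by rw [map_add, hgb, hgb]) (by
        convert! T.graph.add_mem (hg f) (hg f') using 1
        rw [Prod.mk_add_mk, smul_add, map_add]
        congr 1
        abel)).symm
      map_smul' := fun r f => (huniq _ _ (by rw [map_smul, hgb]) (by
        convert! T.graph.smul_mem r (hg f) using 1
        rw [Prod.smul_mk, smul_add, smul_comm, map_smul]
        rfl)).symm }
  refine ⟨G₀.mkContinuous (1 / c) fun f => ?_, hgb, hg, fun u v h => ?_⟩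
  · have h1 := hlow _ _ (hgb f) (hg f)
    rw [add_sub_cancel_right] at h1
    change ‖g f‖ ≤ _
    rw [one_div, inv_mul_eq_div, le_div_iff₀ hc, mul_comm]
    exact h1.trans ((hF.projection b hb).norm_apply_le f)
  · refine (huniq _ _ (hFb u) ?_).symm
    rw [map_sub, map_smul, sub_add_cancel]
    exact hF.map_mem_graph hT hb h

/-- On the spectral subspace of a bounded interval around `t`, the operator `T - t` is bounded by
the radius. -/
theorem norm_sub_le {b : Set ℝ} (hb : MeasurableSet b) {t ε : ℝ} (hε : 0 < ε)
    (hbt : ∀ s ∈ b, |s - t| ≤ ε) {u v : X} (hu : F b u = u) (h : (u, v) ∈ T.graph) :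
    ‖v - t • u‖ ≤ ε * ‖u‖ := by
  have hbb : Bornology.IsBounded b := (Metric.isBounded_closedBall (x := t) (r := ε)).subset
    fun s hs => by
      rw [Metric.mem_closedBall, Real.dist_eq]
      exact hbt s hs
  have hform : ∀ p q, F b p = p → (p, q + t • p) ∈ T.graph →
      |(inner ℂ p q).re| ≤ ε * ‖p‖ ^ 2 := by
    intro p q hp hpq
    have h1 := hF.le_re_inner hb (α := t - ε)
      (fun s hs => by linarith [(abs_le.1 (hbt s hs)).1]) hp hpq
    have h2 := hF.re_inner_le hb (β := t + ε)
      (fun s hs => by linarith [(abs_le.1 (hbt s hs)).2]) hp hpq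
    rw [inner_add_right, inner_real_smul, Complex.add_re, Complex.re_ofReal_mul, re_inner_self]
      at h1 h2
    exact abs_le.2 ⟨by linarith, by linarith⟩
  set w := v - t • u with hw
  have hgu : (u, w + t • u) ∈ T.graph := by rwa [hw, sub_add_cancel]
  have hwb : F b w = w := by
    have h1 := hF.mem_graph_sub_smul hT h hb t
    rw [hu, ← hw] at h1
    exact add_right_cancel (LinearPMap.mem_graph_snd_inj T h1 hgu rfl)
  obtain ⟨y', hy'⟩ := LinearPMap.mem_domain_iff.1 (hF.mem_domain_of_isBounded hb hbb w)
  rw [hwb] at hy'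
  obtain ⟨y, hy⟩ : ∃ y, (w, y + t • w) ∈ T.graph := ⟨y' - t • w, by rwa [sub_add_cancel]⟩
  have hsym : inner ℂ u y = inner ℂ w w := by
    have h1 := hT.symmetric hgu hy
    rw [inner_add_left, inner_add_right, inner_real_smul, real_smul_inner] at h1
    exact (add_right_cancel h1).symm
  -- polarization: compare the form at `u ± ε⁻¹ (T - t) u`
  have hp : ∀ s : ℝ, |(inner ℂ (u + s • w) (w + s • y)).re| ≤ ε * ‖u + s • w‖ ^ 2 := by
    intro s
    refine hform _ _ (by rw [map_add, ContinuousLinearMap.map_smul_of_tower, hu, hwb]) ?_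
    have h1 := T.graph.add_mem hgu (T.graph.smul_mem (s : ℂ) hy)
    convert! h1 using 1
    rw [Prod.smul_mk, Prod.mk_add_mk]
    simp only [Complex.coe_smul]
    congr 1
    rw [smul_add, smul_add, smul_comm t s]
    abel
  have hexp : ∀ s : ℝ, (inner ℂ (u + s • w) (w + s • y)).re =
      (inner ℂ u w).re + 2 * s * ‖w‖ ^ 2 + s ^ 2 * (inner ℂ w y).re := by
    intro s
    rw [inner_add_left, inner_add_right, inner_add_right, inner_real_smul, inner_real_smul,
      real_smul_inner, real_smul_inner, hsym]
    simp only [Complex.add_re, Complex.re_ofReal_mul, re_inner_self]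
    ring
  have hpar := parallelogram_law_with_norm ℂ u (ε⁻¹ • w)
  have h1 := (le_abs_self _).trans (hp ε⁻¹)
  have h2 := (neg_le_abs _).trans (hp (-ε⁻¹))
  rw [hexp] at h1 h2
  rw [neg_smul, ← sub_eq_add_neg] at h2
  have h3 : 4 * ε⁻¹ * ‖w‖ ^ 2 ≤ ε * (2 * (‖u‖ ^ 2 + ε⁻¹ ^ 2 * ‖w‖ ^ 2)) := by
    have h4 : ‖ε⁻¹ • w‖ = ε⁻¹ * ‖w‖ := by
      rw [norm_smul, Real.norm_of_nonneg (by positivity)]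
    rw [h4] at hpar
    nlinarith
  have h5 : ε * (2 * (‖u‖ ^ 2 + ε⁻¹ ^ 2 * ‖w‖ ^ 2)) = 2 * ε * ‖u‖ ^ 2 + 2 * ε⁻¹ * ‖w‖ ^ 2 := by
    field_simp
  rw [h5] at h3
  have h6 : ε⁻¹ * ‖w‖ ^ 2 ≤ ε * ‖u‖ ^ 2 := by linarith
  refine le_of_sq_le_sq ?_ (by positivity)
  rw [inv_mul_le_iff₀ hε] at h6
  nlinarith

/-- A real point of the resolvent set has a neighborhood of spectral measure zero. -/
theorem exists_eq_zero_of_isResolvent {t : ℝ} {R : X →L[ℂ] X} (hR : IsResolvent T (t : ℂ) R) :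
    ∃ ε > 0, F (Set.Ioo (t - ε) (t + ε)) = 0 := by
  let ε := 1 / (2 * (‖R‖ + 1))
  have hε : 0 < ε := by positivity
  refine ⟨ε, hε, ?_⟩
  ext f
  set b := Set.Ioo (t - ε) (t + ε) with hb'
  have hb : MeasurableSet b := measurableSet_Ioo
  obtain ⟨v, hv⟩ := LinearPMap.mem_domain_iff.1
    (hF.mem_domain_of_isBounded hb (Metric.isBounded_Ioo _ _) f)
  have h1 := hF.norm_sub_le hT hb hε (t := t)
    (fun s hs => abs_le.2 ⟨by linarith [hs.1], by linarith [hs.2]⟩)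
    ((hF.projection b hb).apply_apply f) hv
  have h2 := (isResolvent_iff.1 hR).2 _ _ hv
  rw [Complex.coe_smul] at h2
  have h3 : ‖F b f‖ ≤ ‖R‖ * (ε * ‖F b f‖) := by
    conv_lhs => rw [← h2]
    exact (R.le_opNorm _).trans (mul_le_mul_of_nonneg_left h1 (norm_nonneg _))
  have h4 : ‖R‖ * ε ≤ 1 / 2 := by
    simp only [ε]
    rw [mul_one_div, div_le_div_iff₀ (by positivity) (by norm_num)]
    linarith [norm_nonneg R]
  have h5 : ‖F b f‖ = 0 := by nlinarith [norm_nonneg (F b f)]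
  exact norm_eq_zero.1 h5

/-- Near a real point of the resolvent set, `T` coincides with its part in the spectral subspace of
the complement of a neighborhood. -/
theorem isOpen_real_resolventSet : IsOpen {t : ℝ | (t : ℂ) ∈ opResolventSet T} := by
  rw [Metric.isOpen_iff]
  rintro t ⟨R, hR⟩
  obtain ⟨ε, hε, h0⟩ := hF.exists_eq_zero_of_isResolvent hT hR
  refine ⟨ε / 2, by positivity, fun s hs => ?_⟩
  rw [Metric.mem_ball, Real.dist_eq, abs_lt] at hs
  have hI : MeasurableSet (Set.Ioo (t - ε) (t + ε)) := measurableSet_Ioo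
  have h1 : F (Set.Ioo (t - ε) (t + ε))ᶜ = 1 := by
    ext f
    rw [hF.isProjectionMeasure.compl_apply hF.univ hI, h0]
    simp
  obtain ⟨G, -, hG1, hG2⟩ := hF.exists_resolvent_part hT hI.compl (z := (s : ℂ)) (d := ε / 2)
    (by positivity) (fun r hr => by
      rw [← Complex.ofReal_sub, Complex.norm_real, Real.norm_eq_abs]
      by_contra h2
      have h3 := abs_lt.1 (not_le.1 h2)
      exact hr ⟨by linarith, by linarith⟩)
  simp only [h1, one_apply_eq_self] at hG1 hG2
  exact ⟨G, isResolvent_iff.2 ⟨hG1, hG2⟩⟩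

theorem spectrum_eq_one : F {t : ℝ | (t : ℂ) ∈ opSpectrum T} = 1 := by
  have hopen := hF.isOpen_real_resolventSet hT
  have hc : {t : ℝ | (t : ℂ) ∈ opSpectrum T} = {t : ℝ | (t : ℂ) ∈ opResolventSet T}ᶜ := rfl
  ext f
  rw [hc, hF.isProjectionMeasure.compl_apply hF.univ hopen.measurableSet]
  obtain ⟨μ, hμ, -⟩ := hF.represents f
  have h0 : μ {t : ℝ | (t : ℂ) ∈ opResolventSet T} = 0 := by
    refine measure_null_of_locally_null _ fun t ht => ?_
    obtain ⟨R, hR⟩ := ht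
    obtain ⟨ε, hε, h0⟩ := hF.exists_eq_zero_of_isResolvent hT hR
    refine ⟨Set.Ioo (t - ε) (t + ε), mem_nhdsWithin_of_mem_nhds
      (Ioo_mem_nhds (by linarith) (by linarith)), ?_⟩
    rw [hμ _ measurableSet_Ioo, h0]
    simp
  rw [hμ _ hopen.measurableSet, ENNReal.ofReal_eq_zero] at h0
  rw [norm_eq_zero.1 (pow_eq_zero_iff two_ne_zero |>.1 (le_antisymm h0 (sq_nonneg _)))]
  simp

end IsResolutionOfIdentity

end SpectralParts

/-! ### Operators similar to a selfadjoint operator -/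

section Similarity

open Filter Topology

section Normed

variable {X : Type*} [NormedAddCommGroup X] [NormedSpace ℂ X]

/-- `T' = Y T Y⁻¹` for a bounded operator `Y` with bounded inverse `Z`. -/
structure IsSimilar (T' T : X →ₗ.[ℂ] X) (Y Z : X →L[ℂ] X) : Prop where
  right_inv : ∀ x, Y (Z x) = x
  left_inv : ∀ x, Z (Y x) = x
  mem_graph_iff : ∀ u v, (u, v) ∈ T'.graph ↔ (Z u, Z v) ∈ T.graph

namespace IsSimilar

variable {T' T : X →ₗ.[ℂ] X} {Y Z : X →L[ℂ] X}

protected theorem symm (h : IsSimilar T' T Y Z) : IsSimilar T T' Z Y :=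
  ⟨h.left_inv, h.right_inv, fun u v => by rw [h.mem_graph_iff, h.left_inv, h.left_inv]⟩

theorem isResolvent (h : IsSimilar T' T Y Z) {z : ℂ} {R : X →L[ℂ] X} (hR : IsResolvent T z R) :
    IsResolvent T' z (Y * R * Z) := by
  rw [isResolvent_iff] at hR ⊢
  refine ⟨fun x => ?_, fun u v huv => ?_⟩
  · rw [h.mem_graph_iff, map_add, map_smul]
    simp only [mul_apply_eq_comp, h.left_inv]
    exact hR.1 (Z x)
  · simp only [mul_apply_eq_comp, map_sub, map_smul]
    have h1 := hR.2 _ _ ((h.mem_graph_iff u v).1 huv)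
    rw [map_sub, map_smul] at h1
    rw [← map_smul, ← map_sub, h1, h.right_inv]

theorem opSpectrum_eq (h : IsSimilar T' T Y Z) : opSpectrum T' = opSpectrum T := by
  have : opResolventSet T' = opResolventSet T := by
    ext z
    exact ⟨fun ⟨R, hR⟩ => ⟨_, h.symm.isResolvent hR⟩, fun ⟨R, hR⟩ => ⟨_, h.isResolvent hR⟩⟩
  rw [opSpectrum, opSpectrum, this]

end IsSimilar

/-- A strongly countably additive map is determined by its values on the bounded sets. -/
theorem eq_of_extendsFromBounded {B : Set ℝ → X →ₗ.[ℂ] X} {E E' : Set ℝ → X →L[ℂ] X}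
    (hB : ExtendsFromBounded B E) (hB' : ExtendsFromBounded B E')
    (hE : StronglyCountablyAdditive E) (hE' : StronglyCountablyAdditive E') {b : Set ℝ}
    (hb : MeasurableSet b) : E' b = E b := by
  have hbd : ∀ c, MeasurableSet c → Bornology.IsBounded c → E' c = E c := by
    intro c hc hcb
    ext f
    have h1 : (f, E c f) ∈ (boundedOp (E' c)).graph := by
      rw [hB' c hc hcb, ← hB c hc hcb]
      exact mem_graph_boundedOp.2 rfl
    exact (mem_graph_boundedOp.1 h1).symm
  -- cut `b` into the bounded pieces where `⌊|t|⌋₊` is constant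
  let s : ℕ → Set ℝ := fun n => b ∩ (fun t : ℝ => ⌊|t|⌋₊) ⁻¹' {n}
  have hs : ∀ n, MeasurableSet (s n) := fun n =>
    hb.inter ((Nat.measurable_floor.comp measurable_norm) (measurableSet_singleton n))
  have hsb : ∀ n, Bornology.IsBounded (s n) := fun n =>
    (Metric.isBounded_closedBall (x := (0 : ℝ)) (r := n + 1)).subset fun t ht => by
      rw [Metric.mem_closedBall, Real.dist_eq, sub_zero]
      have h1 : ⌊|t|⌋₊ = n := ht.2
      exact h1 ▸ (Nat.lt_floor_add_one |t|).le
  have hd : Pairwise (Function.onFun Disjoint s) := fun i j hij =>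
    Set.disjoint_left.2 fun t ht ht' => hij (ht.2.symm.trans ht'.2)
  have hU : ⋃ n, s n = b := by
    ext t
    simp [s]
  ext f
  have h1 := hE s hs hd f
  have h2 := hE' s hs hd f
  simp only [hbd _ (hs _) (hsb _)] at h2
  rw [hU] at h1 h2
  exact h2.unique h1

end Normed

variable {X : Type*} [NormedAddCommGroup X] [InnerProductSpace ℂ X] [CompleteSpace X]

/-- An operator similar to a selfadjoint operator `T` has a spectral resolution, the conjugate of
the resolution of the identity of `T`. -/
theorem IsSimilar.isSpectralResolution {T' T : X →ₗ.[ℂ] X} {Y Z : X →L[ℂ] X}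
    (h : IsSimilar T' T Y Z) {Q : X →L[ℂ] X} {m : ℝ} (hT : IsShiftedInverse T Q m)
    {F : Set ℝ → X →L[ℂ] X} (hF : IsResolutionOfIdentity T F) {E : Set ℝ → X →L[ℂ] X}
    (hE : ∀ b, MeasurableSet b → E b = Y * F b * Z) {B : Set ℝ → X →ₗ.[ℂ] X}
    (hB : ExtendsFromBounded B E) : IsSpectralResolution T' B E := by
  have hP := hF.isProjectionMeasure
  have hEa : ∀ b, MeasurableSet b → ∀ f, E b f = Y (F b (Z f)) := fun b hb f => by
    rw [hE b hb]; rfl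
  have hYZ : Y * Z = 1 := ContinuousLinearMap.ext h.right_inv
  have hZY : Z * Y = 1 := ContinuousLinearMap.ext h.left_inv
  have hspec : {t : ℝ | (t : ℂ) ∈ opSpectrum T'} = {t : ℝ | (t : ℂ) ∈ opSpectrum T} := by
    rw [h.opSpectrum_eq]
  have hmeas : MeasurableSet {t : ℝ | (t : ℂ) ∈ opSpectrum T} :=
    (hF.isOpen_real_resolventSet hT).measurableSet.compl
  have hmul : ∀ b c, MeasurableSet b → MeasurableSet c → E b * E c = Y * (F b * F c) * Z := by
    intro b c hb hc
    rw [hE b hb, hE c hc]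
    calc Y * F b * Z * (Y * F c * Z) = Y * F b * (Z * Y) * F c * Z := by simp only [mul_assoc]
      _ = _ := by rw [hZY, mul_one, mul_assoc Y]
  have hgraph : ∀ b, MeasurableSet b → ∀ u v, (u, v) ∈ T'.graph → (E b u, E b v) ∈ T'.graph := by
    intro b hb u v huv
    rw [h.mem_graph_iff, hEa b hb, hEa b hb, h.left_inv, h.left_inv]
    exact hF.map_mem_graph hT hb ((h.mem_graph_iff u v).1 huv)
  constructor
  case extends_bounded => exact hB
  case uniformly_bounded =>
    refine ⟨‖Y‖ * ‖Z‖ + 1, by positivity, fun b hb => ?_⟩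
    have h1 : ‖E b‖ ≤ ‖Y‖ * ‖Z‖ := by
      refine ContinuousLinearMap.opNorm_le_bound _ (by positivity) fun f => ?_
      rw [hEa b hb, mul_assoc]
      exact (Y.le_opNorm _).trans (mul_le_mul_of_nonneg_left
        (((hF.projection b hb).norm_apply_le _).trans (Z.le_opNorm f)) (norm_nonneg _))
    linarith
  case empty => rw [hE _ MeasurableSet.empty, hP.empty, mul_zero, zero_mul]
  case univ => rw [hE _ MeasurableSet.univ, hF.univ, mul_one, hYZ]
  case spectrum_measurable => rwa [hspec]
  case spectrum => rw [hspec, hE _ hmeas, hF.spectrum_eq_one hT, mul_one, hYZ]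
  case inter =>
    intro b c hb hc
    rw [hmul b c hb hc, hE _ (hb.inter hc), hP.inter hb hc]
  case union =>
    intro b c hb hc
    rw [hmul b c hb hc, hE _ (hb.union hc), hE b hb, hE c hc, hP.union hb hc, mul_sub, mul_add,
      sub_mul, add_mul]
  case countably_additive =>
    intro b hb hd f
    rw [hEa _ (MeasurableSet.iUnion hb)]
    simp only [hEa _ (hb _)]
    exact (hF.countably_additive b hb hd (Z f)).mapL Y
  case ascending =>
    intro b hb hm f
    rw [hEa _ (MeasurableSet.iUnion hb)]
    simp only [hEa _ (hb _)]
    exact (Y.continuous.tendsto _).comp (hP.ascending b hb hm (Z f))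
  case descending =>
    intro b hb hm f
    rw [hEa _ (MeasurableSet.iInter hb)]
    simp only [hEa _ (hb _)]
    exact (Y.continuous.tendsto _).comp (hP.descending hF.univ b hb hm (Z f))
  case resolvent_comm =>
    intro b hb z R hR
    rw [isResolvent_iff] at hR
    ext x
    have h1 := hR.2 _ _ (hgraph b hb _ _ (hR.1 x))
    rw [map_add, map_smul, add_sub_cancel_right] at h1
    exact h1.symm
  case range_subset =>
    intro b hb hbb f
    obtain ⟨v, hv⟩ := LinearPMap.mem_domain_iff.1 (hF.mem_domain_of_isBounded hb hbb (Z f))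
    refine LinearPMap.mem_domain_iff.2 ⟨Y v, ?_⟩
    rw [h.mem_graph_iff, hEa b hb, h.left_inv, h.left_inv]
    exact hv
  case op_comm =>
    intro b hb f
    have h1 := hgraph b hb _ _ (T'.mem_graph f)
    have h2 := LinearPMap.mem_domain_of_mem_graph h1
    exact ⟨h2, LinearPMap.mem_graph_snd_inj T' h1 (T'.mem_graph ⟨_, h2⟩) rfl⟩
  case restrict_spectrum =>
    intro b hb z hz
    by_contra hzb
    refine hz ?_
    have hclosed : IsClosed ((fun t : ℝ => (t : ℂ)) '' closure b) :=
      Complex.isometry_ofReal.isClosedEmbedding.isClosedMap _ isClosed_closure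
    obtain ⟨d, hd, hball⟩ := Metric.isOpen_iff.1 hclosed.isOpen_compl z hzb
    obtain ⟨G, hGb, hG1, hG2⟩ := hF.exists_resolvent_part hT hb hd (z := z) fun s hs => by
      by_contra h1
      refine hball (a := (s : ℂ)) ?_ ⟨s, subset_closure hs, rfl⟩
      rw [Metric.mem_ball, dist_eq_norm]
      exact not_le.1 h1
    set K := LinearMap.range (E b : X →ₗ[ℂ] X) with hK
    have hKmem : ∀ x : K, F b (Z x) = Z x := by
      rintro ⟨-, x, rfl⟩
      change F b (Z (E b x)) = Z (E b x)
      rw [hEa b hb, h.left_inv, (hF.projection b hb).apply_apply]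
    have hmem : ∀ x, (Y * G * Z) x ∈ K := fun x => ⟨Y (G (Z x)), by
      change E b (Y (G (Z x))) = Y (G (Z x))
      rw [hEa b hb, h.left_inv, hGb]⟩
    refine ⟨((Y * G * Z).comp K.subtypeL).codRestrict K fun x => hmem x,
      isResolvent_iff.2 ⟨fun x => ?_, fun u v huv => ?_⟩⟩
    · rw [mem_graph_restrictOp, h.mem_graph_iff]
      change (Z (Y (G (Z x))), Z ((x : X) + z • Y (G (Z x)))) ∈ T.graph
      rw [map_add, map_smul, h.left_inv]
      have h1 := hG1 (Z x)
      rwa [hKmem x] at h1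
    · rw [mem_graph_restrictOp, h.mem_graph_iff] at huv
      apply Subtype.ext
      change Y (G (Z ((v : X) - z • (u : X)))) = u
      rw [map_sub, map_smul, hG2 _ _ huv, hKmem, h.right_inv]

end Similarity

/-! ### The positive square root of an unbounded operator -/

section SquareRoot

variable {X : Type*} [NormedAddCommGroup X] [InnerProductSpace ℂ X] [CompleteSpace X]

theorem ContinuousLinearMap.sqrt_apply_sqrt_apply {A : X →L[ℂ] X} (hA : 0 ≤ A) (x : X) :
    CFC.sqrt A (CFC.sqrt A x) = A x :=
  DFunLike.congr_fun (CFC.sqrt_mul_sqrt_self A hA) x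

theorem ContinuousLinearMap.isSelfAdjoint_sqrt (A : X →L[ℂ] X) : IsSelfAdjoint (CFC.sqrt A) :=
  (CFC.sqrt_nonneg A).isSelfAdjoint

theorem ContinuousLinearMap.injective_sqrt {A : X →L[ℂ] X} (hA : 0 ≤ A)
    (hinj : Function.Injective A) : Function.Injective (CFC.sqrt A : X →L[ℂ] X) := fun x y hxy =>
  hinj (by rw [← sqrt_apply_sqrt_apply hA, ← sqrt_apply_sqrt_apply hA, hxy])

/-- For a bounded positive injective operator `A`, the operator `A⁻¹` has the unique positive
square root `(A^{1/2})⁻¹`. -/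
theorem mem_graph_positiveSqrt {A : X →L[ℂ] X} (hA : 0 ≤ A) (hinj : Function.Injective A)
    {D : X →ₗ.[ℂ] X} (hD : ∀ u v, (u, v) ∈ D.graph ↔ u = A v) (u v : X) :
    (u, v) ∈ (positiveSqrt D).graph ↔ u = CFC.sqrt A v := by
  set S := CFC.sqrt A with hS
  have hSsa : IsSelfAdjoint S := ContinuousLinearMap.isSelfAdjoint_sqrt A
  have hSS : ∀ x, S (S x) = A x := ContinuousLinearMap.sqrt_apply_sqrt_apply hA
  have hSinj : Function.Injective S := ContinuousLinearMap.injective_sqrt hA hinj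
  -- `S⁻¹` is a positive square root of `D`
  have hex : IsPositiveSqrt D (boundedOp S).inverse := by
    have hg : ∀ x y, (x, y) ∈ (boundedOp S).inverse.graph ↔ x = S y := fun x y => by
      rw [mem_graph_inverse, mem_graph_boundedOp]
      intro w hw
      rw [mem_graph_boundedOp] at hw
      exact hSinj (by rw [← hw, map_zero])
    have hdense : Dense ((boundedOp S).inverse.domain : Set X) := by
      refine (hSsa.denseRange hSinj).mono ?_
      rintro _ ⟨y, rfl⟩
      exact LinearPMap.mem_domain_iff.2 ⟨y, (hg _ _).2 rfl⟩
    refine ⟨?_, fun w => ?_, LinearPMap.ext_graph fun x z => ?_⟩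
    · rw [LinearPMap.isSelfAdjoint_def]
      refine LinearPMap.ext_graph fun x y => ?_
      rw [mem_graph_adjoint hdense, hg]
      constructor
      · intro h
        refine ext_inner_left ℂ fun b => ?_
        rw [h (S b) b ((hg _ _).2 rfl), hSsa.inner_map_left]
      · rintro rfl a b hab
        rw [(hg _ _).1 hab, hSsa.inner_map_left]
    · have h1 := (hg _ _).1 ((boundedOp S).inverse.mem_graph w)
      rw [h1]
      exact ((ContinuousLinearMap.nonneg_iff_isPositive _).1
        (CFC.sqrt_nonneg A)).re_inner_nonneg_left _
    · rw [mem_graph_opMul, hD]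
      simp only [hg]
      constructor
      · rintro ⟨y, rfl, rfl⟩
        exact hSS z
      · rintro rfl
        exact ⟨S z, (hSS z).symm, rfl⟩
  obtain ⟨hsa, hpos, hsq⟩ : IsPositiveSqrt D (positiveSqrt D) := Classical.epsilon_spec ⟨_, hex⟩
  -- uniqueness: the inverse of a positive square root is a bounded positive square root of `A`
  set B := positiveSqrt D with hB
  have hD' : ∀ x z, x = A z ↔ ∃ y, (x, y) ∈ B.graph ∧ (y, z) ∈ B.graph := fun x z => by
    rw [← hD, ← hsq, mem_graph_opMul]
  have hker : ∀ x, (x, 0) ∈ B.graph → x = 0 := by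
    intro x hx
    have := (hD' x 0).2 ⟨0, hx, B.graph.zero_mem⟩
    rw [this, map_zero]
  have huniq : ∀ x x' y, (x, y) ∈ B.graph → (x', y) ∈ B.graph → x = x' := by
    intro x x' y h h'
    have h1 := B.graph.sub_mem h h'
    rw [Prod.mk_sub_mk, sub_self] at h1
    exact sub_eq_zero.1 (hker _ h1)
  have hsymm : ∀ x y x' y', (x, y) ∈ B.graph → (x', y') ∈ B.graph →
      inner ℂ y x' = inner ℂ x y' := by
    intro x y x' y' h h'
    rw [← LinearPMap.isSelfAdjoint_def.1 hsa, mem_graph_adjoint hsa.dense_domain] at h'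
    exact h' x y h
  have hsurj : ∀ y, ∃ x, (x, y) ∈ B.graph := by
    intro y
    obtain ⟨x, -, hx⟩ := (hD' (A y) y).1 rfl
    exact ⟨x, hx⟩
  choose g hg using hsurj
  let g₀ : X →ₗ[ℂ] X :=
    { toFun := g
      map_add' := fun x y => huniq _ _ _ (hg (x + y)) (B.graph.add_mem (hg x) (hg y))
      map_smul' := fun c x => huniq _ _ _ (hg (c • x)) (B.graph.smul_mem c (hg x)) }
  have hg₀ : g₀.IsSymmetric := fun x y => (hsymm _ _ _ _ (hg x) (hg y)).symm
  let G : X →L[ℂ] X := ⟨g₀, hg₀.continuous⟩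
  have hGsa : IsSelfAdjoint G := ContinuousLinearMap.isSelfAdjoint_iff_isSymmetric.2 hg₀
  have hGpos : 0 ≤ G := by
    rw [ContinuousLinearMap.nonneg_iff_isPositive, ContinuousLinearMap.isPositive_def']
    refine ⟨hGsa, fun x => ?_⟩
    rw [ContinuousLinearMap.reApplyInnerSelf_apply]
    obtain ⟨a, ha, ha'⟩ := (LinearPMap.mem_graph_iff _).1 (hg x)
    have := hpos a
    rw [ha, ha'] at this
    exact this
  have hGG : G * G = A := by
    ext x
    obtain ⟨y, h1, h2⟩ := (hD' (A x) x).1 rfl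
    obtain rfl : y = g x := huniq _ _ _ h2 (hg x)
    exact huniq _ _ _ (hg (g x)) h1
  have hGS : S = G := CFC.sqrt_unique hGG hGpos
  rw [hGS]
  constructor
  · exact fun h => huniq _ _ _ h (hg v)
  · rintro rfl
    exact hg v

end SquareRoot

/-! ### The product of two operators as a similarity transform -/

section Product

variable {X : Type*} [NormedAddCommGroup X] [InnerProductSpace ℂ X] [CompleteSpace X]

/-- If the norms `‖Q u‖` and `‖A² u‖` are comparable, then so are `‖|Q|^{1/4} u‖` and `‖A^{1/2} u‖`,
by operator monotonicity of the square root, used twice. Hence each of `G = |Q|^{1/4}` and `A^{1/2}`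
is the other one times a bounded operator. -/
theorem exists_quarter_power_factorization {A Q : X →L[ℂ] X} (hA : 0 ≤ A)
    (hAinj : Function.Injective A) (hQ : IsSelfAdjoint Q) {c c' : ℝ} (hc : 0 ≤ c) (hc' : 0 ≤ c')
    (h : ∀ u, ‖Q u‖ ≤ c * ‖A (A u)‖) (h' : ∀ u, ‖A (A u)‖ ≤ c' * ‖Q u‖) :
    ∃ G Y Z : X →L[ℂ] X, Function.Injective G ∧
      (∀ P : X →L[ℂ] X, (∀ x, P (Q x) = Q (P x)) → ∀ x, P (G x) = G (P x)) ∧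
      (∀ x, CFC.sqrt A (Y x) = G x) ∧ (∀ x, G (Z x) = CFC.sqrt A x) := by
  have hAsa := hA.isSelfAdjoint
  have hQQ : 0 ≤ Q * Q := by
    have := star_mul_self_nonneg Q
    rwa [hQ.star_eq] at this
  have hAA : 0 ≤ A * A := by
    have := star_mul_self_nonneg A
    rwa [hAsa.star_eq] at this
  -- `|Q|`, `|Q|^{1/2}` and `|Q|^{1/4}`
  let P₁ := CFC.sqrt (Q * Q)
  let P₂ := CFC.sqrt P₁
  let G := CFC.sqrt P₂
  have hP₁ : 0 ≤ P₁ := CFC.sqrt_nonneg _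
  have hP₂ : 0 ≤ P₂ := CFC.sqrt_nonneg _
  have hG : 0 ≤ G := CFC.sqrt_nonneg _
  have e₁ : P₁ * P₁ = Q * Q := CFC.sqrt_mul_sqrt_self _ hQQ
  have e₂ : P₂ * P₂ = P₁ := CFC.sqrt_mul_sqrt_self _ hP₁
  have e₃ : G * G = P₂ := CFC.sqrt_mul_sqrt_self _ hP₂
  have e₄ : CFC.sqrt A * CFC.sqrt A = A := CFC.sqrt_mul_sqrt_self A hA
  have hSsa : IsSelfAdjoint (CFC.sqrt A) := ContinuousLinearMap.isSelfAdjoint_sqrt A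
  have hnorm : ∀ u, ‖P₁ u‖ = ‖Q u‖ := by
    intro u
    have h1 : (inner ℂ (P₁ u) (P₁ u)).re = (inner ℂ (Q u) (Q u)).re := by
      rw [hP₁.isSelfAdjoint.inner_map_left, hQ.inner_map_left, ← mul_apply_eq_comp, e₁]
      rfl
    rw [re_inner_self, re_inner_self] at h1
    exact (sq_eq_sq₀ (norm_nonneg _) (norm_nonneg _)).1 h1
  have i₁ : P₁ ≤ c • (A * A) :=
    ContinuousLinearMap.le_smul_of_norm_le hP₁ hAA hc fun u => by rw [hnorm]; exact h u
  have i₁' : A * A ≤ c' • P₁ :=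
    ContinuousLinearMap.le_smul_of_norm_le hAA hP₁ hc' fun u => by rw [hnorm]; exact h' u
  rw [← e₂] at i₁ i₁'
  have i₂ : P₂ ≤ Real.sqrt c • A := ContinuousLinearMap.le_smul_of_norm_le hP₂ hA
    (Real.sqrt_nonneg _) (ContinuousLinearMap.norm_le_of_le_smul hP₂.isSelfAdjoint hAsa hc i₁)
  have i₂' : A ≤ Real.sqrt c' • P₂ := ContinuousLinearMap.le_smul_of_norm_le hA hP₂
    (Real.sqrt_nonneg _) (ContinuousLinearMap.norm_le_of_le_smul hAsa hP₂.isSelfAdjoint hc' i₁')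
  rw [← e₃, ← e₄] at i₂ i₂'
  have j := ContinuousLinearMap.norm_le_of_le_smul hG.isSelfAdjoint hSsa (Real.sqrt_nonneg _) i₂
  have j' := ContinuousLinearMap.norm_le_of_le_smul hSsa hG.isSelfAdjoint (Real.sqrt_nonneg _) i₂'
  have hSinj : Function.Injective (CFC.sqrt A : X →L[ℂ] X) :=
    ContinuousLinearMap.injective_sqrt hA hAinj
  have hGinj : Function.Injective G := by
    rw [injective_iff_map_eq_zero]
    intro x hx
    have h1 := j' x
    rw [hx, norm_zero, mul_zero] at h1
    exact hSinj (by rw [map_zero]; exact norm_eq_zero.1 (le_antisymm h1 (norm_nonneg _)))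
  obtain ⟨W₁, hW₁⟩ := ContinuousLinearMap.exists_mul_eq_of_norm_le hSsa hSinj j
  obtain ⟨W₂, hW₂⟩ := ContinuousLinearMap.exists_mul_eq_of_norm_le hG.isSelfAdjoint hGinj j'
  refine ⟨G, star W₁, star W₂, hGinj, fun P hP x => ?_, fun x => ?_, fun x => ?_⟩
  · have h1 : Commute Q P := (ContinuousLinearMap.ext hP : P * Q = Q * P).symm
    have h2 : Commute G P :=
      (((h1.mul_left h1).cfcₙ_nnreal NNReal.sqrt).cfcₙ_nnreal NNReal.sqrt).cfcₙ_nnreal NNReal.sqrt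
    exact (DFunLike.congr_fun h2.eq x).symm
  · have := congrArg star hW₁
    rw [star_mul, hSsa.star_eq, hG.isSelfAdjoint.star_eq] at this
    exact DFunLike.congr_fun this x
  · have := congrArg star hW₂
    rw [star_mul, hSsa.star_eq, hG.isSelfAdjoint.star_eq] at this
    exact DFunLike.congr_fun this x

/-- Let `D₂ = A⁻¹` and `D₁ = D₂ + V`, where multiplication by `V` is bounded in the norm
`‖A^{1/2} u‖`. Then `D₂ D₁` is similar to the selfadjoint operator `D₂^{1/2} D₁ D₂^{1/2}`, by a
transformation whose product with `A^{1/2} = D₂^{-1/2}` commutes with the spectral projections. -/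
theorem exists_isSimilar_opMul {A V : X →L[ℂ] X} (hA : 0 ≤ A) (hinj : Function.Injective A)
    (hV : IsSelfAdjoint V) {k : ℝ} (hk : ∀ u, ‖CFC.sqrt A (V u)‖ ≤ k * ‖CFC.sqrt A u‖)
    {D₁ D₂ : X →ₗ.[ℂ] X} (hD₂ : ∀ u v, (u, v) ∈ D₂.graph ↔ u = A v)
    (hD₁ : ∀ u v, (u, v) ∈ D₁.graph ↔ u = A (v - V u)) :
    ∃ (Q Y Z G : X →L[ℂ] X) (m : ℝ),
      IsShiftedInverse (opMul (positiveSqrt D₂) (opMul D₁ (positiveSqrt D₂))) Q m ∧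
      IsSimilar (opMul D₂ D₁) (opMul (positiveSqrt D₂) (opMul D₁ (positiveSqrt D₂))) Y Z ∧
      (∀ P : X →L[ℂ] X, (∀ x, P (Q x) = Q (P x)) → ∀ x, P (G x) = G (P x)) ∧
      (∀ x, CFC.sqrt A (Y x) = G x) ∧ (∀ x, G (Z x) = CFC.sqrt A x) := by
  have hAsa := hA.isSelfAdjoint
  have hroot := mem_graph_positiveSqrt hA hinj hD₂
  set S := CFC.sqrt A with hS
  have hSsa : IsSelfAdjoint S := ContinuousLinearMap.isSelfAdjoint_sqrt A
  have hSS : ∀ x, S (S x) = A x := ContinuousLinearMap.sqrt_apply_sqrt_apply hA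
  have hSinj : Function.Injective S := ContinuousLinearMap.injective_sqrt hA hinj
  have hSA : ∀ x, S (A x) = A (S x) := fun x => by rw [← hSS, ← hSS]
  set Λ := opMul (positiveSqrt D₂) (opMul D₁ (positiveSqrt D₂)) with hΛ
  have hΛg : ∀ u v, (u, v) ∈ Λ.graph ↔ ∃ x, u = S x ∧ x = A (S v - V x) := by
    intro u v
    simp only [hΛ, mem_graph_opMul, hroot, hD₁]
    constructor
    · rintro ⟨_, ⟨x, h1, h2⟩, rfl⟩
      exact ⟨x, h1, h2⟩
    · rintro ⟨x, h1, h2⟩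
      exact ⟨S v, ⟨x, h1, h2⟩, rfl⟩
  -- `S V` is bounded relative to `S`; the adjoint of the quotient is `W`
  obtain ⟨W, hW⟩ : ∃ W : X →L[ℂ] X, ∀ x, V (S x) = S (W x) := by
    obtain ⟨W₁, hW₁⟩ := ContinuousLinearMap.exists_mul_eq_of_norm_le (A := S * V) hSsa hSinj hk
    refine ⟨star W₁, fun x => ?_⟩
    have := congrArg star hW₁
    rw [star_mul, star_mul, hSsa.star_eq, hV.star_eq] at this
    exact (DFunLike.congr_fun this x).symm
  -- `Λ = A⁻² + W A⁻¹`, parametrized by `p = D₂² u`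
  have hΛp : ∀ u v, (u, v) ∈ Λ.graph ↔ ∃ p, u = A (A p) ∧ v = p + W (A p) := by
    intro u v
    rw [hΛg]
    constructor
    · rintro ⟨x, rfl, hx⟩
      set r := S v - V x with hr
      obtain ⟨p, hp⟩ : ∃ p, p = v - W (S r) := ⟨_, rfl⟩
      have h1 : r = S p := by
        rw [hp, map_sub, ← hW, hSS, ← hx]
      refine ⟨p, ?_, ?_⟩
      · rw [hx, h1, hSA, hSS]
      · rw [← hSS p, ← h1, hp, sub_add_cancel]
    · rintro ⟨p, rfl, rfl⟩
      refine ⟨A (S p), ?_, ?_⟩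
      · rw [hSA, hSS]
      · rw [map_add, ← hSA p, hW, add_sub_cancel_right, hSA]
  -- for this `m` the term `W A` is absorbed by `1` and `m A²` in the quadratic form of `N`
  let m : ℝ := ‖W‖ ^ 2
  let N : X →L[ℂ] X := 1 + W * A + m • (A * A)
  have hNa : ∀ p, N p = p + W (A p) + m • A (A p) := fun p => rfl
  obtain ⟨N', hN'⟩ : IsUnit N := by
    refine ContinuousLinearMap.isUnit_of_forall_le_norm_inner_map N (c := 1 / 2) (by norm_num)
      fun x => ?_
    refine le_trans ?_ (Complex.re_le_norm _)
    rw [hNa, inner_add_left, inner_add_left, Complex.add_re, Complex.add_re, re_inner_self,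
      real_smul_inner, Complex.re_ofReal_mul, hAsa.inner_map_left, re_inner_self]
    have h1 : |(inner ℂ (W (A x)) x).re| ≤ ‖W‖ * ‖A x‖ * ‖x‖ :=
      (Complex.abs_re_le_norm _).trans ((norm_inner_le_norm _ _).trans
        (mul_le_mul_of_nonneg_right (W.le_opNorm _) (norm_nonneg _)))
    have h2 := (abs_le.1 h1).1
    push_cast
    nlinarith [sq_nonneg (‖x‖ - ‖W‖ * ‖A x‖), sq_nonneg (‖W‖ * ‖A x‖)]
  let N₁ : X →L[ℂ] X := ↑(N'⁻¹)
  have hN₁ : ∀ x, N (N₁ x) = x := fun x => by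
    rw [← hN', ← mul_apply_eq_comp, Units.mul_inv, one_apply_eq_self]
  have hN₂ : ∀ x, N₁ (N x) = x := fun x => by
    rw [← hN', ← mul_apply_eq_comp, Units.inv_mul, one_apply_eq_self]
  let Q : X →L[ℂ] X := A * A * N₁
  have hQa : ∀ x, Q x = A (A (N₁ x)) := fun x => rfl
  have hANsymm : ∀ p q, inner ℂ (A (A p)) (N q) = inner ℂ (N p) (A (A q)) := by
    intro p q
    have h1 : inner ℂ (A (A p)) (W (A q)) = inner ℂ (W (A p)) (A (A q)) := by
      have h2 : ∀ p q, inner ℂ (A (A p)) (W (A q)) = inner ℂ (S (A p)) (V (S (A q))) := by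
        intro p q
        rw [← hSS (A p), hSsa.inner_map_left, hW]
      rw [← inner_conj_symm (W (A p)), h2, h2, inner_conj_symm, hV.inner_map_left]
    simp only [hNa, inner_add_left, inner_add_right, inner_real_smul, real_smul_inner, h1]
    rw [hAsa.inner_map_left, hAsa.inner_map_left]
  have hQsa : IsSelfAdjoint Q := by
    rw [ContinuousLinearMap.isSelfAdjoint_iff_isSymmetric]
    intro x y
    change inner ℂ (A (A (N₁ x))) y = inner ℂ x (A (A (N₁ y)))
    conv_lhs => rw [← hN₁ y]
    rw [hANsymm, hN₁]
  have hΛQ : IsShiftedInverse Λ Q m := by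
    refine ⟨hQsa, fun x y hxy => ?_, fun u v => ?_⟩
    · have h1 := hinj (hinj hxy)
      rw [← hN₁ x, ← hN₁ y]
      exact congrArg N h1
    · rw [hΛp]
      constructor
      · rintro ⟨p, rfl, rfl⟩
        rw [hQa, ← hNa, hN₂]
      · intro hu
        refine ⟨N₁ (v + m • u), hu, ?_⟩
        have h1 := hN₁ (v + m • u)
        rw [hNa, ← hQa, ← hu] at h1
        exact (add_right_cancel h1).symm
  have hstar : ∀ x, star N (Q x) = A (A x) := by
    intro x
    have h1 : Q * N = A * A := ContinuousLinearMap.ext fun y => congrArg (A ∘ A) (hN₂ y)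
    have h2 : star N * star Q = star (A * A) := by rw [← star_mul, h1]
    rw [hQsa.star_eq, star_mul, hAsa.star_eq] at h2
    exact DFunLike.congr_fun h2 x
  have hstar' : ∀ x, Q x = star N₁ (A (A x)) := by
    intro x
    have h2 : star Q = star N₁ * star (A * A) := star_mul _ _
    rw [hQsa.star_eq, star_mul, hAsa.star_eq] at h2
    exact DFunLike.congr_fun h2 x
  obtain ⟨G, Y, Z, hGinj, hGc, hY, hZ⟩ := exists_quarter_power_factorization hA hinj hQsa
    (norm_nonneg (star N₁)) (norm_nonneg (star N))
    (fun u => by rw [hstar']; exact (star N₁).le_opNorm _)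
    (fun u => by rw [← hstar]; exact (star N).le_opNorm _)
  refine ⟨Q, Y, Z, G, m, hΛQ, ⟨fun x => ?_, fun x => ?_, fun u v => ?_⟩, hGc, hY, hZ⟩
  · exact hSinj (by rw [← hS] at hY hZ; rw [hY, hZ])
  · exact hGinj (by rw [← hS] at hY hZ; rw [hZ, hY])
  · rw [← hS] at hZ
    have hQG : ∀ x, Q (G x) = G (Q x) := hGc Q fun x => rfl
    have h1 : (Z u, Z v) ∈ Λ.graph ↔ (S u, S v) ∈ Λ.graph := by
      have h2 : Q (S v + m • S u) = G (Q (Z v + m • Z u)) := by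
        rw [← hQG, map_add G, ContinuousLinearMap.map_smul_of_tower G, hZ, hZ]
      rw [hΛQ.mem_graph_iff, hΛQ.mem_graph_iff, h2, ← hZ u]
      exact ⟨congrArg G, fun h => hGinj h⟩
    rw [h1, hΛg, mem_graph_opMul]
    simp only [hD₁, hD₂]
    constructor
    · rintro ⟨_, h2, rfl⟩
      exact ⟨u, rfl, by rwa [hSS]⟩
    · rintro ⟨x, h2, h3⟩
      obtain rfl := hSinj h2
      exact ⟨A v, by rwa [hSS] at h3, rfl⟩

end Product

/-! ### Bounded perturbations of a positive operator -/

section Perturbation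

variable {X : Type*} [NormedAddCommGroup X] [InnerProductSpace ℂ X] [CompleteSpace X]

/-- If `D = R⁻¹ - U` is bounded below by a positive constant, then `D R = 1 - U R` is invertible,
so that `D` has a bounded inverse. The proof inverts `D + m` for large `m` and returns to `m = 0`
by means of `1 - m (D + m)⁻¹ = D (D + m)⁻¹`, where the lower bound gives `m ‖(D + m)⁻¹‖ < 1`. -/
theorem isUnit_one_sub_mul {R U : X →L[ℂ] X} (hR : 0 ≤ R) {c : ℝ} (hc : 0 < c)
    (h : ∀ p, c * ‖R p‖ ^ 2 ≤ (inner ℂ (R p) (p - U (R p))).re) : IsUnit (1 - U * R) := by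
  -- `‖R x‖² ≤ ‖R‖ (R x, x)`, as `‖R^{1/2}‖² = ‖R‖`
  have hRsq : ∀ x, ‖R x‖ ^ 2 ≤ ‖R‖ * (inner ℂ (R x) x).re := by
    intro x
    have hS : ∀ x, ‖CFC.sqrt R x‖ ^ 2 = (inner ℂ (R x) x).re := fun x => by
      rw [← ContinuousLinearMap.sqrt_apply_sqrt_apply hR,
        (ContinuousLinearMap.isSelfAdjoint_sqrt R).inner_map_left, re_inner_self]
    have hn : ‖(CFC.sqrt R : X →L[ℂ] X)‖ ^ 2 = ‖R‖ := by
      rw [← (ContinuousLinearMap.isSelfAdjoint_sqrt R).norm_mul_self,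
        CFC.sqrt_mul_sqrt_self R hR]
    rw [← hS, ← hn, ← mul_pow, ← ContinuousLinearMap.sqrt_apply_sqrt_apply hR]
    exact pow_le_pow_left₀ (norm_nonneg _) (ContinuousLinearMap.le_opNorm _ _) 2
  -- for this `m` the term `U R` is absorbed by `1` and `m R` in the quadratic form of `N`
  let m : ℝ := ‖U‖ ^ 2 * ‖R‖
  have hm : 0 ≤ m := by positivity
  let N : X →L[ℂ] X := 1 - U * R + m • R
  have hNa : ∀ p, N p = p - U (R p) + m • R p := fun p => rfl
  obtain ⟨N', hN'⟩ : IsUnit N := by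
    refine ContinuousLinearMap.isUnit_of_forall_le_norm_inner_map N (c := 1 / 2) (by norm_num)
      fun x => ?_
    refine le_trans ?_ (Complex.re_le_norm _)
    rw [hNa, inner_add_left, inner_sub_left, Complex.add_re, Complex.sub_re, re_inner_self,
      real_smul_inner, Complex.re_ofReal_mul]
    have h1 : (inner ℂ (U (R x)) x).re ≤ ‖U‖ * ‖R x‖ * ‖x‖ :=
      (Complex.re_le_norm _).trans ((norm_inner_le_norm _ _).trans
        (mul_le_mul_of_nonneg_right (U.le_opNorm _) (norm_nonneg _)))
    have h2 : (‖U‖ * ‖R x‖) ^ 2 ≤ m * (inner ℂ (R x) x).re := by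
      rw [mul_pow, mul_assoc]
      exact mul_le_mul_of_nonneg_left (hRsq x) (sq_nonneg _)
    push_cast
    nlinarith [sq_nonneg (‖x‖ - ‖U‖ * ‖R x‖), sq_nonneg (‖U‖ * ‖R x‖)]
  let N₁ : X →L[ℂ] X := ↑(N'⁻¹)
  have hN₁ : ∀ x, N (N₁ x) = x := fun x => by
    rw [← hN', ← mul_apply_eq_comp, Units.mul_inv, one_apply_eq_self]
  -- the lower bound of `D` gives `‖(D + m)⁻¹‖ ≤ (m + c)⁻¹`
  have hB : ∀ q, (m + c) * ‖R (N₁ q)‖ ≤ ‖q‖ := by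
    intro q
    have h1 := h (N₁ q)
    have h2 : N₁ q - U (R (N₁ q)) = q - m • R (N₁ q) := by
      rw [eq_sub_iff_add_eq, ← hNa, hN₁]
    rw [h2, inner_sub_right, Complex.sub_re, inner_real_smul, Complex.re_ofReal_mul,
      re_inner_self] at h1
    have h3 : (inner ℂ (R (N₁ q)) q).re ≤ ‖R (N₁ q)‖ * ‖q‖ :=
      (Complex.re_le_norm _).trans (norm_inner_le_norm _ _)
    rcases (norm_nonneg (R (N₁ q))).eq_or_lt with h4 | h4
    · rw [← h4, mul_zero]
      exact norm_nonneg q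
    · refine le_of_mul_le_mul_left ?_ h4
      nlinarith
  have hM : IsUnit (1 - m • (R * N₁)) := by
    refine ContinuousLinearMap.isUnit_of_forall_le_norm_inner_map _
      (c := (c / (m + c)).toNNReal) (by simp only [Real.toNNReal_pos]; positivity) fun x => ?_
    refine le_trans ?_ (Complex.re_le_norm _)
    rw [Real.coe_toNNReal _ (by positivity)]
    have e : (1 - m • (R * N₁)) x = x - m • R (N₁ x) := rfl
    rw [e, inner_sub_left, Complex.sub_re, re_inner_self, real_smul_inner, Complex.re_ofReal_mul]
    have h3 : (inner ℂ (R (N₁ x)) x).re ≤ ‖R (N₁ x)‖ * ‖x‖ :=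
      (Complex.re_le_norm _).trans (norm_inner_le_norm _ _)
    have h4 : ‖R (N₁ x)‖ ≤ ‖x‖ / (m + c) := by
      rw [le_div_iff₀ (by positivity), mul_comm]
      exact hB x
    have h5 : m * (inner ℂ (R (N₁ x)) x).re ≤ m * (‖x‖ / (m + c) * ‖x‖) :=
      mul_le_mul_of_nonneg_left (h3.trans (mul_le_mul_of_nonneg_right h4 (norm_nonneg _))) hm
    have h6 : ‖x‖ ^ 2 * (c / (m + c)) = ‖x‖ ^ 2 - m * (‖x‖ / (m + c) * ‖x‖) := by
      field_simp
      ring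
    linarith
  have hfac : 1 - U * R = (1 - m • (R * N₁)) * N := by
    have h1 : N₁ * N = 1 := by rw [← hN']; exact Units.inv_mul N'
    rw [sub_mul, one_mul, smul_mul_assoc, mul_assoc, h1, mul_one]
    exact (add_sub_cancel_right _ _).symm
  rw [hfac]
  exact hM.mul ⟨N', hN'⟩

/-- Let `D₂ = R⁻¹ - U₂` be bounded below by a positive constant and let `D₁ = R⁻¹ - U₁`, where the
difference `V = U₂ - U₁` is bounded with respect to the quadratic form of `R`. Then `D₂ = A⁻¹` and
`D₁ = A⁻¹ + V` for a positive operator `A`, and `V` is bounded with respect to the quadratic form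
of `A`. -/
theorem exists_inverse_of_perturbation {R U₁ U₂ : X →L[ℂ] X} (hR : 0 ≤ R)
    (hRinj : Function.Injective R) (hU₂ : IsSelfAdjoint U₂)
    {D₁ D₂ : X →ₗ.[ℂ] X} (hD₁ : ∀ u v, (u, v) ∈ D₁.graph ↔ u = R (v + U₁ u))
    (hD₂ : ∀ u v, (u, v) ∈ D₂.graph ↔ u = R (v + U₂ u))
    {K : ℝ} (hK : 0 ≤ K) (hV : ∀ u, (inner ℂ ((U₂ - U₁) u) (R ((U₂ - U₁) u))).re ≤
      K * (inner ℂ u (R u)).re)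
    {c : ℝ} (hc : 0 < c)
    (hpos : ∀ u v, (u, v) ∈ D₂.graph → c * ‖u‖ ^ 2 ≤ (inner ℂ u v).re) :
    ∃ A : X →L[ℂ] X, 0 ≤ A ∧ Function.Injective A ∧
      (∃ k, ∀ u, ‖CFC.sqrt A ((U₂ - U₁) u)‖ ≤ k * ‖CFC.sqrt A u‖) ∧
      (∀ u v, (u, v) ∈ D₂.graph ↔ u = A v) ∧
      (∀ u v, (u, v) ∈ D₁.graph ↔ u = A (v - (U₂ - U₁) u)) := by
  have hRsa := hR.isSelfAdjoint
  have hU : IsUnit (1 - U₂ * R) := by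
    refine isUnit_one_sub_mul hR hc fun p => hpos _ _ ?_
    rw [hD₂, sub_add_cancel]
  obtain ⟨N', hN'⟩ := hU
  let N : X →L[ℂ] X := ↑N'
  let N₁ : X →L[ℂ] X := ↑(N'⁻¹)
  have hNa : ∀ p, N p = p - U₂ (R p) := fun p => by
    change (N' : X →L[ℂ] X) p = _
    rw [hN']
    rfl
  have hNN₁ : N * N₁ = 1 := Units.mul_inv N'
  have hN₁N : N₁ * N = 1 := Units.inv_mul N'
  have hN₁ : ∀ x, N (N₁ x) = x := fun x => DFunLike.congr_fun hNN₁ x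
  have hN₂ : ∀ x, N₁ (N x) = x := fun x => DFunLike.congr_fun hN₁N x
  obtain ⟨A, hA⟩ : ∃ A, A = R * N₁ := ⟨_, rfl⟩
  have hAa : ∀ x, A x = R (N₁ x) := fun x => DFunLike.congr_fun hA x
  have hD₂A : ∀ u v, (u, v) ∈ D₂.graph ↔ u = A v := by
    intro u v
    rw [hD₂, hAa]
    constructor
    · intro hu
      have h1 : v = N (v + U₂ u) := by
        rw [hNa, ← hu, add_sub_cancel_right]
      rw [h1, hN₂]
      exact hu
    · rintro rfl
      have h1 := hNa (N₁ v)
      rw [hN₁, eq_sub_iff_add_eq] at h1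
      rw [h1]
  have hAsa : IsSelfAdjoint A := by
    rw [ContinuousLinearMap.isSelfAdjoint_iff_isSymmetric]
    intro x y
    change inner ℂ (A x) y = inner ℂ x (A y)
    rw [← hN₁ x, ← hN₁ y, hAa, hAa, hN₂, hN₂]
    generalize N₁ x = p, N₁ y = q
    rw [hNa, hNa, inner_sub_left, inner_sub_right, hRsa.inner_map_left, hU₂.inner_map_left]
  have hApos : 0 ≤ A := by
    rw [ContinuousLinearMap.nonneg_iff_isPositive, ContinuousLinearMap.isPositive_def']
    refine ⟨hAsa, fun x => ?_⟩
    rw [ContinuousLinearMap.reApplyInnerSelf_apply]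
    exact le_trans (by positivity) (hpos _ _ ((hD₂A _ x).2 rfl))
  have hAinj : Function.Injective A := by
    intro x y hxy
    rw [hAa, hAa] at hxy
    rw [← hN₁ x, ← hN₁ y, hRinj hxy]
  -- `A = R N⁻¹` and its adjoint make `A` and `R` comparable in norm, hence as forms
  have e₁ : A = star N₁ * R := by
    rw [← hAsa.star_eq, hA, star_mul, hRsa.star_eq]
  have e₂ : R = star N * A := by
    have h1 : A * N = R := by rw [hA, mul_assoc, hN₁N, mul_one]
    rw [← hRsa.star_eq, ← h1, star_mul, hAsa.star_eq]
  have i₁ : A ≤ ‖star N₁‖ • R :=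
    ContinuousLinearMap.le_smul_of_norm_le hApos hR (norm_nonneg _) fun u => by
      conv_lhs => rw [e₁]
      exact (star N₁).le_opNorm _
  have i₂ : R ≤ ‖star N‖ • A :=
    ContinuousLinearMap.le_smul_of_norm_le hR hApos (norm_nonneg _) fun u => by
      conv_lhs => rw [e₂]
      exact (star N).le_opNorm _
  have hform : ∀ {B : X →L[ℂ] X}, 0 ≤ B → ∀ x, ‖CFC.sqrt B x‖ ^ 2 = (inner ℂ x (B x)).re := by
    intro B hB x
    rw [← ContinuousLinearMap.sqrt_apply_sqrt_apply hB,
      ← (ContinuousLinearMap.isSelfAdjoint_sqrt B).inner_map_left, re_inner_self]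
  have hform' : ∀ {B C : X →L[ℂ] X} {r : ℝ}, B ≤ r • C → ∀ x,
      (inner ℂ x (B x)).re ≤ r * (inner ℂ x (C x)).re := by
    intro B C r h x
    have h1 := ((ContinuousLinearMap.le_def _ _).1 h).re_inner_nonneg_right x
    have e : (r • C - B) x = r • C x - B x := rfl
    rw [e, inner_sub_right, inner_real_smul] at h1
    have h2 : 0 ≤ r * (inner ℂ x (C x)).re - (inner ℂ x (B x)).re := by
      rw [← Complex.re_ofReal_mul, ← Complex.sub_re]
      exact h1
    linarith
  refine ⟨A, hApos, hAinj, ⟨Real.sqrt (‖star N₁‖ * (K * ‖star N‖)), fun u => ?_⟩, hD₂A,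
    fun u v => ?_⟩
  · refine abs_le_of_sq_le_sq' ?_ (by positivity) |>.2
    rw [mul_pow, Real.sq_sqrt (by positivity), hform hApos, hform hApos]
    calc _ ≤ ‖star N₁‖ * _ := hform' i₁ _
      _ ≤ ‖star N₁‖ * (K * _) := mul_le_mul_of_nonneg_left (hV u) (norm_nonneg _)
      _ ≤ ‖star N₁‖ * (K * (‖star N‖ * _)) := by gcongr; exact hform' i₂ u
      _ = _ := by ring
  · rw [← hD₂A, hD₁, hD₂]
    have : v - (U₂ - U₁) u + U₂ u = v + U₁ u := by
      rw [_root_.sub_apply]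
      abel
    rw [this]

end Perturbation

/-! ### Multiplication operators and Fourier multipliers in `L²(ℝ)` -/

section FreeResolvent

open TemperedDistribution FourierTransform

/-- Multiplication by a bounded continuous function is a bounded operator in `L²(ℝ)`. -/
theorem exists_mul_clm {g : ℝ → ℂ} (hg : Continuous g) {C : ℝ} (hC : ∀ x, ‖g x‖ ≤ C) :
    ∃ M : HilbertL2 →L[ℂ] HilbertL2, ∀ f : HilbertL2, ∀ᵐ x, M f x = g x * f x := by
  have hmem : MemLp g ∞ (volume : Measure ℝ) :=
    memLp_top_of_bound hg.aestronglyMeasurable C (Filter.Eventually.of_forall hC)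
  refine ⟨(ContinuousLinearMap.mul ℂ ℂ).holderL volume ∞ 2 2 (hmem.toLp g), fun f => ?_⟩
  filter_upwards [(ContinuousLinearMap.mul ℂ ℂ).coeFn_holder (r := 2) (hmem.toLp g) f,
    hmem.coeFn_toLp] with x h₁ h₂
  rw [← h₂]
  exact h₁

theorem injective_toTemperedDistribution :
    Function.Injective (fun f : HilbertL2 => (f : 𝓢'(ℝ, ℂ))) := by
  have h := Lp.ker_toTemperedDistributionCLM_eq_bot (F := ℂ) (μ := (volume : Measure ℝ)) (p := 2)
  exact LinearMap.ker_eq_bot.1 h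

/-- A Fourier multiplier with bounded symbol is a bounded operator in `L²(ℝ)`. -/
theorem exists_fourierMultiplier_clm {g : ℝ → ℂ} (hg : g.HasTemperateGrowth) {C : ℝ}
    (hC : ∀ x, ‖g x‖ ≤ C) :
    ∃ M : HilbertL2 →L[ℂ] HilbertL2, ∀ f : HilbertL2,
      (M f : 𝓢'(ℝ, ℂ)) = fourierMultiplierCLM ℂ g (f : 𝓢'(ℝ, ℂ)) := by
  have hmem : MemLp g ∞ (volume : Measure ℝ) :=
    memLp_top_of_bound hg.1.continuous.aestronglyMeasurable C (Filter.Eventually.of_forall hC)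
  obtain ⟨M, hM⟩ := exists_mul_clm hg.1.continuous hC
  let F : HilbertL2 ≃ₗᵢ[ℂ] HilbertL2 := Lp.fourierTransformₗᵢ ℝ ℂ
  refine ⟨(F.symm : HilbertL2 →L[ℂ] HilbertL2) ∘L M ∘L (F : HilbertL2 →L[ℂ] HilbertL2),
    fun f => ?_⟩
  have h1 : M (𝓕 f) = hmem.toLp g • 𝓕 f := by
    refine Lp.ext ?_
    filter_upwards [hM (𝓕 f), Lp.coeFn_lpSMul (r := 2) (hmem.toLp g) (𝓕 f),
      hmem.coeFn_toLp] with x h₁ h₂ h₃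
    rw [h₁, h₂, Pi.smul_apply', h₃, smul_eq_mul]
  change ((𝓕⁻ (M (𝓕 f)) : HilbertL2) : 𝓢'(ℝ, ℂ)) = _
  rw [fourierMultiplierCLM_apply, Lp.fourier_toTemperedDistribution_eq,
    ← Lp.fourierInv_toTemperedDistribution_eq, h1, Lp.toTemperedDistribution_smul_eq hg]

theorem derivCLM_eq_fourierMultiplierCLM (T : 𝓢'(ℝ, ℂ)) :
    TemperedDistribution.derivCLM ℂ T =
      (2 * Real.pi * Complex.I) • fourierMultiplierCLM ℂ (fun x : ℝ => (x : ℂ)) T := by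
  have h := TemperedDistribution.lineDeriv_eq_fourierMultiplierCLM (1 : ℝ) T
  have h1 : (fun x : ℝ => ((inner ℝ x 1 : ℝ) : ℂ)) = fun x : ℝ => (x : ℂ) := by
    ext x
    simp
  rw [h1] at h
  rw [← h]
  ext φ
  rw [TemperedDistribution.derivCLM_apply_apply, TemperedDistribution.lineDerivOp_apply_apply]
  rfl

/-- `(2π)² - d²` is `(2π)²` times a Bessel potential, whose symbol is `1 + x²` in the normalization
of Mathlib. -/
theorem besselPotential_two_eq (T : 𝓢'(ℝ, ℂ)) :
    ((2 * Real.pi) ^ 2 : ℂ) • besselPotential ℝ ℂ 2 T = ((2 * Real.pi) ^ 2 : ℂ) • T -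
      TemperedDistribution.derivCLM ℂ (TemperedDistribution.derivCLM ℂ T) := by
  have hx : (fun x : ℝ => (x : ℂ)).HasTemperateGrowth := by fun_prop
  have h1 : besselPotential ℝ ℂ 2 T =
      T + fourierMultiplierCLM ℂ ((fun x : ℝ => (x : ℂ)) * fun x : ℝ => (x : ℂ)) T := by
    have h2 : (fun x : ℝ => (((1 + ‖x‖ ^ 2) ^ ((2 : ℝ) / 2) : ℝ) : ℂ)) =
        (fun _ => (1 : ℂ)) + (fun x : ℝ => (x : ℂ)) * fun x : ℝ => (x : ℂ) := by
      ext x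
      simp [sq]
    rw [besselPotential, h2, fourierMultiplierCLM_apply, smulLeftCLM_add (by fun_prop)
      (hx.mul hx), _root_.add_apply, smulLeftCLM_const, one_smul,
      FourierTransform.fourierInv_add, FourierTransform.fourierInv_fourier_eq]
    rfl
  rw [derivCLM_eq_fourierMultiplierCLM, derivCLM_eq_fourierMultiplierCLM, map_smul,
    fourierMultiplierCLM_fourierMultiplierCLM_apply hx hx, h1, smul_add, smul_smul]
  have h3 : (2 * Real.pi * Complex.I) * (2 * Real.pi * Complex.I) =
      -((2 * Real.pi) ^ 2 : ℂ) := by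
    rw [mul_mul_mul_comm, Complex.I_mul_I]
    ring
  rw [h3, neg_smul, sub_neg_eq_add]

/-- The resolvent `R = ((2π)² - d²)⁻¹` of the free operator, together with `P = d R`. -/
theorem exists_free_resolvent : ∃ R P : HilbertL2 →L[ℂ] HilbertL2,
    (∀ f : HilbertL2, ((2 * Real.pi) ^ 2 : ℂ) • (R f : 𝓢'(ℝ, ℂ)) =
      besselPotential ℝ ℂ (-2) (f : 𝓢'(ℝ, ℂ))) ∧
    ∀ f : HilbertL2, (P f : 𝓢'(ℝ, ℂ)) = TemperedDistribution.derivCLM ℂ (R f : 𝓢'(ℝ, ℂ)) := by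
  have hsmul : ∀ (c : ℂ) (a : HilbertL2), ((c • a : HilbertL2) : 𝓢'(ℝ, ℂ)) = c • (a : 𝓢'(ℝ, ℂ)) :=
    map_smul (Lp.toTemperedDistributionCLM ℂ (volume : Measure ℝ) 2)
  have hκ : ((2 * Real.pi) ^ 2 : ℂ) ≠ 0 := by
    exact_mod_cast (by positivity : ((2 * Real.pi) ^ 2 : ℝ) ≠ 0)
  let g : ℝ → ℂ := fun x => (((1 + ‖x‖ ^ 2) ^ ((-2 : ℝ) / 2) : ℝ) : ℂ)
  have hg : g.HasTemperateGrowth := by fun_prop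
  have hx : (fun x : ℝ => (x : ℂ)).HasTemperateGrowth := by fun_prop
  have hgx : ∀ x : ℝ, ‖g x‖ = (1 + x ^ 2)⁻¹ := by
    intro x
    have : (-2 : ℝ) / 2 = -1 := by norm_num
    simp only [g, this, Real.rpow_neg_one, Complex.norm_real, Real.norm_eq_abs, sq_abs]
    exact abs_of_nonneg (by positivity)
  obtain ⟨B, hB⟩ := exists_fourierMultiplier_clm hg (C := 1) fun x => by
    rw [hgx]
    exact inv_le_one_of_one_le₀ (by nlinarith [sq_nonneg x])
  obtain ⟨B', hB'⟩ := exists_fourierMultiplier_clm (hg.mul hx) (C := 1) fun x => by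
    rw [Pi.mul_apply, norm_mul, hgx, Complex.norm_real, Real.norm_eq_abs, inv_mul_le_one₀
      (by positivity)]
    nlinarith [sq_abs x, sq_nonneg (|x| - 1)]
  refine ⟨((2 * Real.pi) ^ 2 : ℂ)⁻¹ • B,
    (((2 * Real.pi) ^ 2 : ℂ)⁻¹ * (2 * Real.pi * Complex.I)) • B', fun f => ?_, fun f => ?_⟩
  · rw [_root_.smul_apply, hsmul, smul_smul, mul_inv_cancel₀ hκ, one_smul, hB]
    rfl
  · rw [_root_.smul_apply, _root_.smul_apply, hsmul, hsmul, map_smul, hB, hB',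
      derivCLM_eq_fourierMultiplierCLM, fourierMultiplierCLM_fourierMultiplierCLM_apply hg hx,
      smul_smul]

end FreeResolvent

/-! ### The quadratic form of the free resolvent -/

section FreeForm

open TemperedDistribution ComplexConjugate

/-- `R` is the resolvent `((2π)² - d²)⁻¹` of the free operator, and `P = d R`. -/
structure IsFreeResolvent (R P : HilbertL2 →L[ℂ] HilbertL2) : Prop where
  smul_eq : ∀ f : HilbertL2, ((2 * Real.pi) ^ 2 : ℂ) • (R f : 𝓢'(ℝ, ℂ)) =
    besselPotential ℝ ℂ (-2) (f : 𝓢'(ℝ, ℂ))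
  deriv_eq : ∀ f : HilbertL2,
    (P f : 𝓢'(ℝ, ℂ)) = TemperedDistribution.derivCLM ℂ (R f : 𝓢'(ℝ, ℂ))

theorem two_pi_sq_ne_zero : ((2 * Real.pi) ^ 2 : ℂ) ≠ 0 := by
  exact_mod_cast (by positivity : ((2 * Real.pi) ^ 2 : ℝ) ≠ 0)

theorem Lp.toTemperedDistribution_smul (c : ℂ) (a : HilbertL2) :
    ((c • a : HilbertL2) : 𝓢'(ℝ, ℂ)) = c • (a : 𝓢'(ℝ, ℂ)) :=
  map_smul (Lp.toTemperedDistributionCLM ℂ (volume : Measure ℝ) 2) c a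

theorem Lp.toTemperedDistribution_sub (a b : HilbertL2) :
    ((a - b : HilbertL2) : 𝓢'(ℝ, ℂ)) = (a : 𝓢'(ℝ, ℂ)) - (b : 𝓢'(ℝ, ℂ)) :=
  map_sub (Lp.toTemperedDistributionCLM ℂ (volume : Measure ℝ) 2) a b

theorem Lp.ext_toTemperedDistribution {a b : HilbertL2}
    (h : (a : 𝓢'(ℝ, ℂ)) = (b : 𝓢'(ℝ, ℂ))) : a = b :=
  injective_toTemperedDistribution h

theorem SchwartzMap.eq_of_toLp_eq {f g : 𝓢(ℝ, ℂ)}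
    (h : (f.toLp 2 : HilbertL2) = g.toLp 2) : f = g := by
  have h1 : (f : ℝ → ℂ) =ᵐ[volume] g := by
    filter_upwards [f.coeFn_toLp 2 volume, g.coeFn_toLp 2 volume] with x hf hg
    rw [← hf, ← hg, h]
  exact DFunLike.coe_injective (Continuous.ae_eq_iff_eq volume f.continuous g.continuous |>.1 h1)

namespace IsFreeResolvent

variable {R P : HilbertL2 →L[ℂ] HilbertL2}

/-- `f = (2π)² u - u''` holds in the sense of distributions for `u = R f`, and determines `u`. -/
theorem eq_iff (h : IsFreeResolvent R P) (u f : HilbertL2) :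
    u = R f ↔ (f : 𝓢'(ℝ, ℂ)) = ((2 * Real.pi) ^ 2 : ℂ) • (u : 𝓢'(ℝ, ℂ)) -
      TemperedDistribution.derivCLM ℂ (TemperedDistribution.derivCLM ℂ (u : 𝓢'(ℝ, ℂ))) := by
  rw [← besselPotential_two_eq, ← map_smul, eq_comm (a := (f : 𝓢'(ℝ, ℂ))),
    ← besselPotential_neg_apply_eq_iff, ← h.smul_eq]
  constructor
  · rintro rfl
    rfl
  · intro h1
    exact injective_toTemperedDistribution (smul_right_injective _ two_pi_sq_ne_zero h1).symm

theorem injective (h : IsFreeResolvent R P) : Function.Injective R := by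
  intro f g hfg
  have h1 := (h.eq_iff _ f).1 rfl
  have h2 := (h.eq_iff _ g).1 rfl
  rw [hfg, ← h2] at h1
  exact injective_toTemperedDistribution h1

/-- On Schwartz functions the resolvent yields classical solutions. -/
theorem exists_schwartz (h : IsFreeResolvent R P) (f : 𝓢(ℝ, ℂ)) : ∃ u : 𝓢(ℝ, ℂ),
    R (f.toLp 2) = u.toLp 2 ∧ P (f.toLp 2) = (SchwartzMap.derivCLM ℂ ℂ u).toLp 2 ∧
    f = ((2 * Real.pi) ^ 2 : ℂ) • u -
      SchwartzMap.derivCLM ℂ ℂ (SchwartzMap.derivCLM ℂ ℂ u) := by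
  have hg : (fun x : ℝ => (((1 + ‖x‖ ^ 2) ^ ((-2 : ℝ) / 2) : ℝ) : ℂ)).HasTemperateGrowth := by
    fun_prop
  obtain ⟨u, hu⟩ : ∃ u : 𝓢(ℝ, ℂ), ((2 * Real.pi) ^ 2 : ℂ) • u =
      SchwartzMap.fourierMultiplierCLM ℂ
        (fun x : ℝ => (((1 + ‖x‖ ^ 2) ^ ((-2 : ℝ) / 2) : ℝ) : ℂ)) f :=
    ⟨((2 * Real.pi) ^ 2 : ℂ)⁻¹ • _, by
      rw [smul_smul, mul_inv_cancel₀ two_pi_sq_ne_zero, one_smul]⟩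
  have hderiv : ∀ v : 𝓢(ℝ, ℂ), (((SchwartzMap.derivCLM ℂ ℂ v).toLp 2 : HilbertL2) : 𝓢'(ℝ, ℂ)) =
      TemperedDistribution.derivCLM ℂ ((v.toLp 2 : HilbertL2) : 𝓢'(ℝ, ℂ)) := fun v => by
    rw [Lp.toTemperedDistribution_toLp_eq, Lp.toTemperedDistribution_toLp_eq,
      derivCLM_toTemperedDistributionCLM_eq ℂ]
  have h1 : R (f.toLp 2) = u.toLp 2 := by
    refine Lp.ext_toTemperedDistribution (smul_right_injective _ two_pi_sq_ne_zero ?_)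
    have h2 : ((2 * Real.pi) ^ 2 : ℂ) • (R (f.toLp 2) : 𝓢'(ℝ, ℂ)) =
        ((2 * Real.pi) ^ 2 : ℂ) • ((u.toLp 2 : HilbertL2) : 𝓢'(ℝ, ℂ)) := by
      rw [h.smul_eq, Lp.toTemperedDistribution_toLp_eq, Lp.toTemperedDistribution_toLp_eq,
        ← map_smul, hu, besselPotential, fourierMultiplierCLM_toTemperedDistributionCLM_eq hg]
    exact h2
  refine ⟨u, h1, ?_, ?_⟩
  · refine Lp.ext_toTemperedDistribution ?_
    rw [h.deriv_eq, h1, ← hderiv]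
  · refine SchwartzMap.eq_of_toLp_eq (Lp.ext_toTemperedDistribution ?_)
    rw [(h.eq_iff _ _).1 h1.symm, ← hderiv, ← hderiv, ← Lp.toTemperedDistribution_smul,
      ← Lp.toTemperedDistribution_sub]
    congr 1

/-- Integration by parts in `(w R f, g)`, where `g = (2π)² z - z''` with `z = R g`. -/
theorem inner_mul_eq (h : IsFreeResolvent R P) {w w' : ℝ → ℝ} (hw : ∀ x, HasDerivAt w (w' x) x)
    (hw' : Continuous w') {C : ℝ} (hC : ∀ x, |w x| ≤ C) (hC' : ∀ x, |w' x| ≤ C)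
    {V V' : HilbertL2 →L[ℂ] HilbertL2}
    (hV : ∀ f : HilbertL2, ∀ᵐ x, V f x = (w x : ℂ) * f x)
    (hV' : ∀ f : HilbertL2, ∀ᵐ x, V' f x = (w' x : ℂ) * f x) (f g : HilbertL2) :
    inner ℂ (V (R f)) g = ((2 * Real.pi) ^ 2 : ℂ) * inner ℂ (V (R f)) (R g) +
      inner ℂ (V' (R f) + V (P f)) (P g) := by
  refine (SchwartzMap.denseRange_toLpCLM (E := ℝ) (F := ℂ) (p := 2) (μ := volume)
    (by norm_num)).induction_on₂ (p := fun f g => inner ℂ (V (R f)) g =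
      ((2 * Real.pi) ^ 2 : ℂ) * inner ℂ (V (R f)) (R g) +
      inner ℂ (V' (R f) + V (P f)) (P g)) ?_ (fun f g => ?_) f g
  · have c₁ : ∀ A : HilbertL2 →L[ℂ] HilbertL2,
        Continuous fun p : HilbertL2 × HilbertL2 => A p.1 := fun A =>
      A.continuous.comp continuous_fst
    have c₂ : ∀ A : HilbertL2 →L[ℂ] HilbertL2,
        Continuous fun p : HilbertL2 × HilbertL2 => A p.2 := fun A =>
      A.continuous.comp continuous_snd
    exact isClosed_eq ((c₁ (V * R)).inner continuous_snd)
      ((continuous_const.mul ((c₁ (V * R)).inner (c₂ R))).add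
        (((c₁ (V' * R)).add (c₁ (V * P))).inner (c₂ P)))
  rw [SchwartzMap.toLpCLM_apply, SchwartzMap.toLpCLM_apply]
  obtain ⟨u, hu, hu', -⟩ := h.exists_schwartz f
  obtain ⟨z, hz, hz', rfl⟩ := h.exists_schwartz g
  set u' := SchwartzMap.derivCLM ℂ ℂ u with hu'd
  set z' := SchwartzMap.derivCLM ℂ ℂ z with hz'd
  set z'' := SchwartzMap.derivCLM ℂ ℂ z' with hz''d
  have hwc : Continuous w := continuous_iff_continuousAt.2 fun x => (hw x).continuousAt
  -- products with a bounded factor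
  have hint : ∀ {b : ℝ → ℝ}, Continuous b → (∀ x, |b x| ≤ C) → ∀ φ ψ : 𝓢(ℝ, ℂ),
      Integrable fun x => (b x : ℂ) * conj (φ x) * ψ x := by
    intro b hb hbC φ ψ
    refine ψ.integrable.bdd_mul (c := C * ‖φ.toBoundedContinuousFunction‖) ?_ ?_
    · exact (Continuous.mul (by fun_prop)
        (Complex.continuous_conj.comp φ.continuous)).aestronglyMeasurable
    · refine Filter.Eventually.of_forall fun x => ?_
      rw [norm_mul, Complex.norm_real, Complex.norm_conj]
      exact mul_le_mul (hbC x) (φ.toBoundedContinuousFunction.norm_coe_le_norm x)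
        (norm_nonneg _) ((abs_nonneg _).trans (hbC x))
  have hda : ∀ x, HasDerivAt (fun x => (w x : ℂ) * conj (u x))
      ((w' x : ℂ) * conj (u x) + (w x : ℂ) * conj (u' x)) x := fun x =>
    (hw x).ofReal_comp.mul ((u.hasDerivAt x).star)
  have hdz : ∀ x, HasDerivAt (fun x => z' x) (z'' x) x := fun x => z'.hasDerivAt x
  have hparts := integral_mul_deriv_eq_deriv_mul_of_integrable
    (u := fun x => (w x : ℂ) * conj (u x))
    (v := fun x => z' x) (fun x _ => hda x) (fun x _ => hdz x) (hint hwc hC u z'')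
    (by
      have := (hint hw' hC' u z').add (hint hwc hC u' z')
      refine this.congr (Filter.Eventually.of_forall fun x => ?_)
      simp only [Pi.add_apply, Pi.mul_apply]
      ring)
    (hint hwc hC u z')
  have hinner : ∀ {b : ℝ → ℝ} {B : HilbertL2 →L[ℂ] HilbertL2},
      (∀ f : HilbertL2, ∀ᵐ x, B f x = (b x : ℂ) * f x) → ∀ φ ψ : 𝓢(ℝ, ℂ),
      inner ℂ (B (φ.toLp 2)) (ψ.toLp 2) = ∫ x, (b x : ℂ) * conj (φ x) * ψ x := by
    intro b B hB φ ψ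
    rw [L2.inner_def]
    refine integral_congr_ae ?_
    filter_upwards [hB (φ.toLp 2), φ.coeFn_toLp 2 volume, ψ.coeFn_toLp 2 volume] with x h1 h2 h3
    rw [h1, h2, h3, RCLike.inner_apply, map_mul, Complex.conj_ofReal]
    ring
  rw [hz, hz', hu, hu', inner_add_left, hinner hV, hinner hV, hinner hV', hinner hV,
    ← integral_add (hint hw' hC' _ _) (hint hwc hC _ _)]
  have e1 : ∀ x, (w x : ℂ) * conj (u x) * (((2 * Real.pi) ^ 2 : ℂ) • z - z'') x =
      ((2 * Real.pi) ^ 2 : ℂ) * ((w x : ℂ) * conj (u x) * z x) -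
        (w x : ℂ) * conj (u x) * z'' x := by
    intro x
    simp only [_root_.sub_apply, _root_.smul_apply, smul_eq_mul]
    ring
  simp only [e1]
  rw [integral_sub ((hint hwc hC _ _).const_mul _) (hint hwc hC _ _), hparts, sub_neg_eq_add,
    integral_const_mul]
  congr 1
  refine integral_congr_ae (Filter.Eventually.of_forall fun x => ?_)
  simp only
  ring

/-- The quadratic form of `R` is the squared norm of `R f` in the Sobolev space `H¹`. -/
theorem inner_eq (h : IsFreeResolvent R P) (f g : HilbertL2) :
    inner ℂ (R f) g = ((2 * Real.pi) ^ 2 : ℂ) * inner ℂ (R f) (R g) + inner ℂ (P f) (P g) := by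
  have h1 := h.inner_mul_eq (w := fun _ => 1) (w' := fun _ => 0) (C := 1)
    (fun x => hasDerivAt_const x 1) continuous_const (by simp) (by simp)
    (V := 1) (V' := 0) (fun f => Filter.Eventually.of_forall fun x => by simp)
    (fun f => by
      filter_upwards [Lp.coeFn_zero ℂ 2 (volume : Measure ℝ)] with x hx
      rw [_root_.zero_apply, hx, Pi.zero_apply, Complex.ofReal_zero, zero_mul]) f g
  simpa using h1

theorem re_inner_eq (h : IsFreeResolvent R P) (f : HilbertL2) :
    (inner ℂ (R f) f).re = (2 * Real.pi) ^ 2 * ‖R f‖ ^ 2 + ‖P f‖ ^ 2 := by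
  rw [h.inner_eq, Complex.add_re, re_inner_self, ← re_inner_self (R f)]
  have : ((2 * Real.pi) ^ 2 : ℂ) = (((2 * Real.pi) ^ 2 : ℝ) : ℂ) := by push_cast; rfl
  rw [this, Complex.re_ofReal_mul]

theorem isSelfAdjoint (h : IsFreeResolvent R P) : IsSelfAdjoint R := by
  rw [ContinuousLinearMap.isSelfAdjoint_iff_isSymmetric]
  intro f g
  change inner ℂ (R f) g = inner ℂ f (R g)
  rw [← inner_conj_symm f (R g), h.inner_eq f g, h.inner_eq g f, map_add, map_mul,
    inner_conj_symm, inner_conj_symm]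
  congr 2
  rw [map_pow, map_mul, Complex.conj_ofReal, Complex.conj_ofNat]

theorem nonneg (h : IsFreeResolvent R P) : 0 ≤ R := by
  rw [ContinuousLinearMap.nonneg_iff_isPositive, ContinuousLinearMap.isPositive_def']
  refine ⟨h.isSelfAdjoint, fun x => ?_⟩
  rw [ContinuousLinearMap.reApplyInnerSelf_apply]
  change 0 ≤ (inner ℂ (R x) x).re
  rw [h.re_inner_eq]
  positivity

/-- A function with bounded derivative acts boundedly on the Sobolev space `H¹`, hence it is
bounded with respect to the form of `R` by duality: with `v = R V f` and `z = R f`,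
`(R V f, V f) = ‖v‖₁²` and `(R V f, V f) = (V v, f)` is at most a multiple of `‖v‖₁ ‖z‖₁`. -/
theorem exists_mul_form_bound (h : IsFreeResolvent R P) {w w' : ℝ → ℝ}
    (hw : ∀ x, HasDerivAt w (w' x) x) (hw' : Continuous w') {C : ℝ} (hC : ∀ x, |w x| ≤ C)
    (hC' : ∀ x, |w' x| ≤ C) {V : HilbertL2 →L[ℂ] HilbertL2} (hVsa : IsSelfAdjoint V)
    (hV : ∀ f : HilbertL2, ∀ᵐ x, V f x = (w x : ℂ) * f x) :
    ∃ K : ℝ, 0 ≤ K ∧ ∀ f : HilbertL2, (inner ℂ (V f) (R (V f))).re ≤ K * (inner ℂ f (R f)).re := by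
  obtain ⟨V', hV'⟩ := exists_mul_clm (g := fun x => (w' x : ℂ)) (by fun_prop) (C := C)
    (fun x => by rw [Complex.norm_real]; exact hC' x)
  refine ⟨(2 * ‖V‖ + ‖V'‖) ^ 2, sq_nonneg _, fun f => ?_⟩
  rw [← h.isSelfAdjoint.inner_map_left, ← h.isSelfAdjoint.inner_map_left]
  set N : HilbertL2 → ℝ := fun f => (inner ℂ (R f) f).re with hN
  have hNe : ∀ f, N f = (2 * Real.pi) ^ 2 * ‖R f‖ ^ 2 + ‖P f‖ ^ 2 := h.re_inner_eq
  have hN0 : ∀ f, 0 ≤ N f := fun f => by rw [hNe]; positivity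
  have hπ : (1 : ℝ) ≤ 2 * Real.pi := by linarith [Real.pi_gt_three]
  have b1 : ∀ f, 2 * Real.pi * ‖R f‖ ≤ √(N f) := fun f => by
    refine Real.le_sqrt_of_sq_le ?_
    rw [hNe]
    nlinarith [sq_nonneg ‖P f‖]
  have b2 : ∀ f, ‖P f‖ ≤ √(N f) := fun f => by
    refine Real.le_sqrt_of_sq_le ?_
    rw [hNe]
    have : 0 ≤ (2 * Real.pi) ^ 2 * ‖R f‖ ^ 2 := by positivity
    linarith
  have b3 : ∀ f, ‖R f‖ ≤ √(N f) := fun f => le_trans (by nlinarith [norm_nonneg (R f)]) (b1 f)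
  have key : N (V f) ≤ (2 * ‖V‖ + ‖V'‖) * (√(N (V f)) * √(N f)) := by
    have e1 : N (V f) = (((2 * Real.pi) ^ 2 : ℂ) * inner ℂ (V (R (V f))) (R f) +
        inner ℂ (V' (R (V f)) + V (P (V f))) (P f)).re := by
      rw [← h.inner_mul_eq hw hw' hC hC' hV hV', hVsa.inner_map_left]
    refine e1.le.trans ?_
    generalize V f = v
    refine (Complex.re_le_norm _).trans ((norm_add_le _ _).trans ?_)
    rw [norm_mul, norm_pow, norm_mul, Complex.norm_real, Complex.norm_ofNat,
      Real.norm_of_nonneg Real.pi_pos.le]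
    have t1 : ‖(inner ℂ (V (R v)) (R f) : ℂ)‖ ≤ ‖V‖ * ‖R v‖ * ‖R f‖ :=
      (norm_inner_le_norm _ _).trans
        (mul_le_mul_of_nonneg_right (V.le_opNorm _) (norm_nonneg _))
    have t2 : ‖(inner ℂ (V' (R v) + V (P v)) (P f) : ℂ)‖ ≤
        (‖V'‖ * ‖R v‖ + ‖V‖ * ‖P v‖) * ‖P f‖ :=
      (norm_inner_le_norm _ _).trans (mul_le_mul_of_nonneg_right
        ((norm_add_le _ _).trans (add_le_add (V'.le_opNorm _) (V.le_opNorm _))) (norm_nonneg _))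
    have s1 : (2 * Real.pi) ^ 2 * (‖V‖ * ‖R v‖ * ‖R f‖) ≤ ‖V‖ * (√(N v) * √(N f)) := by
      calc _ = ‖V‖ * ((2 * Real.pi * ‖R v‖) * (2 * Real.pi * ‖R f‖)) := by ring
        _ ≤ _ := by gcongr <;> exact b1 _
    have s2 : (‖V'‖ * ‖R v‖ + ‖V‖ * ‖P v‖) * ‖P f‖ ≤
        (‖V'‖ * √(N v) + ‖V‖ * √(N v)) * √(N f) := by
      gcongr
      · exact b3 _
      · exact b2 _
      · exact b2 _
    have s3 := mul_le_mul_of_nonneg_left t1 (sq_nonneg (2 * Real.pi))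
    linarith
  have hs : √(N (V f)) ≤ (2 * ‖V‖ + ‖V'‖) * √(N f) := by
    rcases (Real.sqrt_nonneg (N (V f))).eq_or_lt with h0 | h0
    · rw [← h0]
      positivity
    · refine le_of_mul_le_mul_left ?_ h0
      rw [Real.mul_self_sqrt (hN0 _)]
      linarith
  have := pow_le_pow_left₀ (Real.sqrt_nonneg _) hs 2
  rwa [mul_pow, Real.sq_sqrt (hN0 _), Real.sq_sqrt (hN0 _)] at this

end IsFreeResolvent

end FreeForm

/-! ### The spectral resolution of the product -/

section ProductResolution

variable {X : Type*} [NormedAddCommGroup X] [InnerProductSpace ℂ X] [CompleteSpace X]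

/-- If `T' = Y T Y⁻¹` with `T` selfadjoint, then `T'* = (Y*)⁻¹ T Y*`. -/
theorem IsSimilar.adjoint {T' T : X →ₗ.[ℂ] X} {Y Z : X →L[ℂ] X} (h : IsSimilar T' T Y Z)
    {Q : X →L[ℂ] X} {m : ℝ} (hT : IsShiftedInverse T Q m) :
    IsSimilar T'.adjoint T (ContinuousLinearMap.adjoint Z) (ContinuousLinearMap.adjoint Y) := by
  have hdense : Dense (T'.domain : Set X) := by
    have h1 : DenseRange (Y ∘ Q) := by
      have hY : Function.Surjective Y := fun x => ⟨Z x, h.right_inv x⟩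
      exact hY.denseRange.comp (hT.isSelfAdjoint.denseRange hT.injective) Y.continuous
    refine Dense.mono ?_ h1
    rintro _ ⟨g, rfl⟩
    refine LinearPMap.mem_domain_iff.2 ⟨Y (g - m • Q g), ?_⟩
    rw [h.mem_graph_iff, h.left_inv, Function.comp_apply, h.left_inv]
    exact hT.mem_graph g
  refine ⟨fun x => ?_, fun x => ?_, fun x y => ?_⟩
  · refine ext_inner_left ℂ fun v => ?_
    rw [ContinuousLinearMap.adjoint_inner_right, ContinuousLinearMap.adjoint_inner_right,
      h.right_inv]
  · refine ext_inner_left ℂ fun v => ?_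
    rw [ContinuousLinearMap.adjoint_inner_right, ContinuousLinearMap.adjoint_inner_right,
      h.left_inv]
  · rw [mem_graph_adjoint hdense]
    constructor
    · intro hxy
      refine hT.mem_graph_of_forall fun a b hab => ?_
      rw [ContinuousLinearMap.adjoint_inner_right, ContinuousLinearMap.adjoint_inner_right]
      refine hxy _ _ ?_
      rwa [h.mem_graph_iff, h.left_inv, h.left_inv]
    · intro hxy a b hab
      have h1 := hT.symmetric ((h.mem_graph_iff a b).1 hab) hxy
      rwa [ContinuousLinearMap.adjoint_inner_right, ContinuousLinearMap.adjoint_inner_right,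
        h.right_inv, h.right_inv] at h1

/-- The operators `D₂^{1/2} E_Λ(b) D₂^{-1/2}` are bounded and equal to `Y E_Λ(b) Y⁻¹`, where `Y` is
the similarity between `Λ` and `D₂ D₁`: the operator `D₂^{-1/2} Y` commutes with `E_Λ(b)`. -/
theorem exists_isSpectralResolution_opMul {A V : X →L[ℂ] X} (hA : 0 ≤ A)
    (hinj : Function.Injective A) (hV : IsSelfAdjoint V) {k : ℝ}
    (hk : ∀ u, ‖CFC.sqrt A (V u)‖ ≤ k * ‖CFC.sqrt A u‖)
    {D₁ D₂ : X →ₗ.[ℂ] X} (hD₂ : ∀ u v, (u, v) ∈ D₂.graph ↔ u = A v)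
    (hD₁ : ∀ u v, (u, v) ∈ D₁.graph ↔ u = A (v - V u)) {B : Set ℝ → X →ₗ.[ℂ] X}
    (hB : ∀ b, B b = opMul (positiveSqrt D₂) (opMul (boundedOp (resolutionOfIdentity
      (opMul (positiveSqrt D₂) (opMul D₁ (positiveSqrt D₂))) b)) (positiveSqrt D₂).inverse)) :
    ∃ E : Set ℝ → X →L[ℂ] X, IsSpectralResolution (opMul D₂ D₁) B E ∧
      IsSpectralResolution (opMul D₂ D₁).adjoint (fun b => (B b).adjoint)
        (fun b => ContinuousLinearMap.adjoint (E b)) := by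
  obtain ⟨Q, Y, Z, G, m, hQ, hsim, hG, hY, hZ⟩ := exists_isSimilar_opMul hA hinj hV hk hD₂ hD₁
  have hroot := mem_graph_positiveSqrt hA hinj hD₂
  have hSinj := ContinuousLinearMap.injective_sqrt hA hinj
  set Λ := opMul (positiveSqrt D₂) (opMul D₁ (positiveSqrt D₂)) with hΛ
  set F := resolutionOfIdentity Λ with hFdef
  have hF : IsResolutionOfIdentity Λ F :=
    Classical.epsilon_spec hQ.exists_isResolutionOfIdentity
  have hinv : ∀ x y, (x, y) ∈ (positiveSqrt D₂).inverse.graph ↔ y = CFC.sqrt A x := fun x y => by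
    rw [mem_graph_inverse, hroot]
    intro u hu
    rw [(hroot u 0).1 hu, map_zero]
  have hBE : ∀ b, MeasurableSet b → boundedOp (Y * F b * Z) = B b := by
    intro b hb
    refine LinearPMap.ext_graph fun u w => ?_
    rw [hB, mem_graph_opMul, mem_graph_boundedOp]
    simp only [mem_graph_opMul, mem_graph_boundedOp, hinv, hroot]
    have h1 : CFC.sqrt A (Y (F b (Z u))) = F b (CFC.sqrt A u) := by
      rw [hY, ← hZ u, ← hG (F b) (hF.commute_resolvent hQ hb)]
    constructor
    · rintro rfl
      exact ⟨_, ⟨_, rfl, rfl⟩, h1.symm⟩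
    · rintro ⟨_, ⟨_, rfl, rfl⟩, h2⟩
      exact hSinj (h2.symm.trans h1.symm)
  have hadj : ∀ b, MeasurableSet b → ContinuousLinearMap.adjoint (Y * F b * Z) =
      ContinuousLinearMap.adjoint Z * F b * ContinuousLinearMap.adjoint Y := by
    intro b hb
    have h1 : star (Y * F b * Z) = star Z * F b * star Y := by
      rw [star_mul, star_mul, (hF.projection b hb).isSelfAdjoint.star_eq, mul_assoc]
    exact h1
  refine ⟨fun b => Y * F b * Z, hsim.isSpectralResolution hQ hF (fun _ _ => rfl)
    fun b hb _ => hBE b hb, (hsim.adjoint hQ).isSpectralResolution hQ hF hadj fun b hb _ => ?_⟩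
  rw [← hBE b hb, adjoint_boundedOp]

end ProductResolution

/-! ### Schrödinger operators -/

section Schrodinger

theorem AdmissiblePotential.integrable_iteratedDeriv {q : ℝ → ℝ} (hq : AdmissiblePotential q)
    {k : ℕ} (hk : k ≤ 2) (hm : Measurable (iteratedDeriv k q)) :
    Integrable (iteratedDeriv k q) := by
  refine (hq.integrable k hk).mono' hm.aestronglyMeasurable
    (Filter.Eventually.of_forall fun x => ?_)
  rw [Real.norm_eq_abs]
  have : 0 ≤ |x| ^ 3 * |iteratedDeriv k q x| := by positivity
  linarith

theorem exists_abs_le_of_integrable_deriv {f f' : ℝ → ℝ} (hf' : Integrable f')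
    (h : ∀ a b, ∫ x in a..b, f' x = f b - f a) : ∃ C, ∀ x, |f x| ≤ C := by
  refine ⟨(∫ x, ‖f' x‖) + |f 0|, fun x => ?_⟩
  have h1 : ‖∫ t in (0 : ℝ)..x, f' t‖ ≤ ∫ t, ‖f' t‖ :=
    intervalIntegral.norm_integral_le_integral_norm_uIoc.trans
      (setIntegral_le_integral hf'.norm (Filter.Eventually.of_forall fun _ => norm_nonneg _))
  rw [h, Real.norm_eq_abs] at h1
  have h2 := abs_sub_abs_le_abs_sub (f x) (f 0)
  linarith

theorem AdmissiblePotential.exists_abs_le {q : ℝ → ℝ} (hq : AdmissiblePotential q) :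
    ∃ C, ∀ x, |q x| ≤ C := by
  have hd : Continuous (deriv q) := hq.contDiff.continuous_deriv le_rfl
  have h1 : Integrable (deriv q) := by
    have := hq.integrable_iteratedDeriv (k := 1) (by norm_num)
    rw [iteratedDeriv_one] at this
    exact this hd.measurable
  exact exists_abs_le_of_integrable_deriv h1 fun a b =>
    intervalIntegral.integral_deriv_eq_sub
      (fun x _ => (hq.contDiff.differentiable one_ne_zero).differentiableAt)
      (hd.intervalIntegrable a b)

theorem AdmissiblePotential.exists_abs_deriv_le {q : ℝ → ℝ} (hq : AdmissiblePotential q) :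
    ∃ C, ∀ x, |deriv q x| ≤ C := by
  have h1 : Integrable (deriv (deriv q)) := by
    have := hq.integrable_iteratedDeriv (k := 2) le_rfl
    rw [iteratedDeriv_succ, iteratedDeriv_one] at this
    exact this (measurable_deriv _)
  exact exists_abs_le_of_integrable_deriv h1 fun a b => (hq.deriv_ac a b).integral_deriv_eq_sub

theorem isSelfAdjoint_of_ae_eq_mul {w : ℝ → ℝ} {M : HilbertL2 →L[ℂ] HilbertL2}
    (hM : ∀ f : HilbertL2, ∀ᵐ x, M f x = (w x : ℂ) * f x) : IsSelfAdjoint M := by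
  rw [ContinuousLinearMap.isSelfAdjoint_iff_isSymmetric]
  intro f g
  change inner ℂ (M f) g = inner ℂ f (M g)
  rw [L2.inner_def, L2.inner_def]
  refine integral_congr_ae ?_
  filter_upwards [hM f, hM g] with x h1 h2
  rw [h1, h2, RCLike.inner_apply, RCLike.inner_apply, map_mul, Complex.conj_ofReal]
  ring

/-- The Schrödinger operator as a bounded perturbation of `R⁻¹ = (2π)² - d²`. -/
theorem mem_graph_schrodingerOp {R P : HilbertL2 →L[ℂ] HilbertL2} (hR : IsFreeResolvent R P)
    {q : ℝ → ℝ} {h : ℝ} {U : HilbertL2 →L[ℂ] HilbertL2}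
    (hU : ∀ f : HilbertL2, ∀ᵐ x, U f x = (((2 * Real.pi) ^ 2 - (q x + h) : ℝ) : ℂ) * f x)
    (u v : HilbertL2) :
    (u, v) ∈ (schrodingerOp q h).graph ↔ u = R (v + U u) := by
  rw [schrodingerOp, Submodule.toLinearPMap_graph_eq _ (schrodingerGraph_functional q h),
    hR.eq_iff]
  constructor
  · rintro ⟨-, w, hw, hv⟩
    simp only at hw hv
    have h1 : v + U u = ((2 * Real.pi) ^ 2 : ℂ) • u - w := by
      refine Lp.ext ?_
      filter_upwards [hv, hU u, Lp.coeFn_add v (U u), Lp.coeFn_sub (((2 * Real.pi) ^ 2 : ℂ) • u) w,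
        Lp.coeFn_smul ((2 * Real.pi) ^ 2 : ℂ) u] with x h1 h2 h3 h4 h5
      rw [h3, h4, Pi.add_apply, Pi.sub_apply, h5, h1, h2, Pi.smul_apply, smul_eq_mul]
      push_cast
      ring
    rw [h1, Lp.toTemperedDistribution_sub, Lp.toTemperedDistribution_smul, hw]
  · intro h1
    refine ⟨⟨((2 * Real.pi) ^ 2 : ℂ)⁻¹ • (v + U u), ?_⟩,
      ((2 * Real.pi) ^ 2 : ℂ) • u - (v + U u), ?_, ?_⟩
    · rw [Lp.toTemperedDistribution_smul, h1, ← besselPotential_two_eq, smul_smul,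
        inv_mul_cancel₀ two_pi_sq_ne_zero, one_smul]
    · rw [Lp.toTemperedDistribution_sub, Lp.toTemperedDistribution_smul, h1, sub_sub_cancel]
    · filter_upwards [hU u, Lp.coeFn_add v (U u),
        Lp.coeFn_sub (((2 * Real.pi) ^ 2 : ℂ) • u) (v + U u),
        Lp.coeFn_smul ((2 * Real.pi) ^ 2 : ℂ) u] with x h2 h3 h4 h5
      rw [h4, Pi.sub_apply, h3, Pi.add_apply, h5, h2, Pi.smul_apply, smul_eq_mul]
      push_cast
      ring

end Schrodinger

theorem mainTheorem1 (h₁ h₂ : ℝ) (q₁ q₂ : ℝ → ℝ) (hh₁ : 0 < h₁) (hh₂ : h₁ < h₂)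
    (hq₁ : AdmissiblePotential q₁) (hq₂ : AdmissiblePotential q₂)
    (D₁ D₂ L : HilbertL2 →ₗ.[ℂ] HilbertL2)
    (hD₁ : D₁ = schrodingerOp q₁ h₁) (hD₂ : D₂ = schrodingerOp q₂ h₂) (hL : L = opL D₁ D₂)
    (hpos : ∃ c : ℝ, 0 < c ∧ ∀ u : D₂.domain,
      c * ‖(u : HilbertL2)‖ ^ 2 ≤ (inner ℂ (u : HilbertL2) (D₂ u)).re) :
    ∃ E : Set ℝ → HilbertL2 →L[ℂ] HilbertL2,
      IsSpectralResolution L (opBL D₁ D₂) E ∧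
      IsSpectralResolution L.adjoint (fun b => (opBL D₁ D₂ b).adjoint)
        (fun b => ContinuousLinearMap.adjoint (E b)) ∧
      ∀ E' : Set ℝ → HilbertL2 →L[ℂ] HilbertL2,
        ExtendsFromBounded (opBL D₁ D₂) E' → StronglyCountablyAdditive E' →
        ∀ b : Set ℝ, MeasurableSet b → E' b = E b := by
  obtain ⟨c, hc, hpos⟩ := hpos
  obtain ⟨R, P, hR₁, hR₂⟩ := exists_free_resolvent
  have hR : IsFreeResolvent R P := ⟨hR₁, hR₂⟩
  have hmul : ∀ (q : ℝ → ℝ) (h : ℝ), AdmissiblePotential q → ∃ U : HilbertL2 →L[ℂ] HilbertL2,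
      ∀ f : HilbertL2, ∀ᵐ x, U f x = (((2 * Real.pi) ^ 2 - (q x + h) : ℝ) : ℂ) * f x := by
    intro q h hq
    obtain ⟨C, hC⟩ := hq.exists_abs_le
    have hqc := hq.contDiff.continuous
    refine exists_mul_clm (by fun_prop) (C := (2 * Real.pi) ^ 2 + (C + |h|)) fun x => ?_
    rw [Complex.norm_real, Real.norm_eq_abs]
    refine (abs_sub _ _).trans ?_
    rw [abs_of_nonneg (sq_nonneg (2 * Real.pi))]
    have := (abs_add_le (q x) h).trans (add_le_add_left (hC x) _)
    linarith
  -- `D_i = R⁻¹ - U_i`, and `V = U₂ - U₁` is the multiplication by `q₁ + h₁ - (q₂ + h₂)`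
  obtain ⟨U₁, hU₁⟩ := hmul q₁ h₁ hq₁
  obtain ⟨U₂, hU₂⟩ := hmul q₂ h₂ hq₂
  have hV : ∀ f : HilbertL2, ∀ᵐ x, (U₂ - U₁) f x = ((q₁ x + h₁ - (q₂ x + h₂) : ℝ) : ℂ) * f x := by
    intro f
    filter_upwards [hU₁ f, hU₂ f, Lp.coeFn_sub (U₂ f) (U₁ f)] with x h1 h2 h3
    rw [_root_.sub_apply, h3, Pi.sub_apply, h1, h2]
    push_cast
    ring
  have hVsa := isSelfAdjoint_of_ae_eq_mul hV
  obtain ⟨K, hK, hform⟩ : ∃ K : ℝ, 0 ≤ K ∧ ∀ f : HilbertL2,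
      (inner ℂ ((U₂ - U₁) f) (R ((U₂ - U₁) f))).re ≤ K * (inner ℂ f (R f)).re := by
    obtain ⟨C₁, hC₁⟩ := hq₁.exists_abs_le
    obtain ⟨C₂, hC₂⟩ := hq₂.exists_abs_le
    obtain ⟨C₁', hC₁'⟩ := hq₁.exists_abs_deriv_le
    obtain ⟨C₂', hC₂'⟩ := hq₂.exists_abs_deriv_le
    refine hR.exists_mul_form_bound (w' := fun x => deriv q₁ x - deriv q₂ x)
      (C := max (C₁ + |h₁| + (C₂ + |h₂|)) (C₁' + C₂')) (fun x => ?_) ?_ (fun x => ?_)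
      (fun x => ?_) hVsa hV
    · exact ((hq₁.contDiff.differentiable one_ne_zero x).hasDerivAt.add_const h₁).sub
        ((hq₂.contDiff.differentiable one_ne_zero x).hasDerivAt.add_const h₂)
    · exact (hq₁.contDiff.continuous_deriv le_rfl).sub (hq₂.contDiff.continuous_deriv le_rfl)
    · refine le_trans ?_ (le_max_left _ _)
      exact (abs_sub _ _).trans (add_le_add ((abs_add_le _ _).trans (add_le_add_left (hC₁ x) _))
        ((abs_add_le _ _).trans (add_le_add_left (hC₂ x) _)))
    · exact ((abs_sub _ _).trans (add_le_add (hC₁' x) (hC₂' x))).trans (le_max_right _ _)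
  have hg₁ : ∀ u v, (u, v) ∈ D₁.graph ↔ u = R (v + U₁ u) := fun u v => by
    rw [hD₁, mem_graph_schrodingerOp hR hU₁]
  have hg₂ : ∀ u v, (u, v) ∈ D₂.graph ↔ u = R (v + U₂ u) := fun u v => by
    rw [hD₂, mem_graph_schrodingerOp hR hU₂]
  obtain ⟨A, hA, hAinj, ⟨k, hk⟩, hA₂, hA₁⟩ := exists_inverse_of_perturbation hR.nonneg hR.injective
    (isSelfAdjoint_of_ae_eq_mul hU₂) hg₁ hg₂ hK hform hc fun u v huv => by
      obtain ⟨a, rfl, rfl⟩ := (LinearPMap.mem_graph_iff _).1 huv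
      exact hpos a
  obtain ⟨E, hE, hE'⟩ := exists_isSpectralResolution_opMul hA hAinj hVsa hk hA₂ hA₁
    (B := opBL D₁ D₂) fun b => rfl
  rw [hL]
  exact ⟨E, hE, hE', fun E' hE₁ hE₂ b hb =>
    eq_of_extendsFromBounded hE.extends_bounded hE₁ hE.countably_additive hE₂ hb⟩
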